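/- Let $d\ge 1$, $1<p<\infty$, $0\le a<b<\infty$, and let $\Omega=\{x\in\mathbb R^d:|x|<b\}$ or $\Omega=\{x\in\mathbb R^d: a<|x|<b\}$. Let $w(x)=\eta(|x|)$ where $\eta\in L^1_{\rm loc}([0,\infty))$, $\eta\ge 0$ a.e., and $\eta=0$ a.e. outside $(a,b)$. Let $I_p$ be the set of $r\in(a,b)$ such that $\eta^{-1/(p-1)}\in L^1((r-\varepsilon,r+\varepsilon))$ for some $\varepsilon>0$ (with $0^{-1/(p-1)}=\infty$), and put $I_{\Omega,w}=\{x\in\Omega:|x|\in I_p\}$. Assume that $w$ is finitely degenerate: $I_p=\bigcup_{i=1}^{N}(a_i,b_i)$ is a disjoint union of nonempty open intervals with $1\le N<\infty$. For $s<t$ let $J(s,t)=\int_{\{y\in I_{\Omega,w}:\,s<|y|<t\}}\big[|y|^{(d-1)p}w(y)\big]^{-1/(p-1)}\,dy$. Define the weight $\hat w_p$ on $\Omega$, up to null sets, as follows. If $a_i<|x|<b_i$, then $$\hat w_p(x)=\begin{cases}J\big(|x|,\tfrac{a_i+b_i}2\big)^{-1}&\text{if }a_i<|x|\le\tfrac{3a_i+b_i}4,\\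 J\big(\tfrac{3a_i+b_i}4,\tfrac{a_i+3b_i}4\big)^{-1}&\text{if }\tfrac{3a_i+b_i}4<|x|\le\tfrac{a_i+3b_i}4,\\ J\big(\tfrac{a_i+b_i}2,|x|\big)^{-1}&\text{if }\tfrac{a_i+3b_i}4<|x|<b_i,\end{cases}$$ and $\hat w_p=0$ elsewhere. Let $X=L^p(\Omega,\hat w_p^{\,p-1})$ be the $L^p$ space of the measure $\hat w_p^{\,p-1}dx$ on $\Omega$. Consider the following classes of functions on $\Omega$ (or $\overline\Omega$): - $C^1_r(\overline\Omega)$ and ${\rm Lip}_r(\overline\Omega)$: the functions that are radial in $\Omega$ and, respectively, of class $C^1$ up to the boundary or Lipschitz on $\overline\Omega$; - $AC^d_r(\Omega)$: the measurable $u:\Omega\to\mathbb R$ with $u\in W^{1,1}_{\rm loc}(I_{\Omega,w})$ and $u(x)=v(|x|)$ in $I_{\Omega,w}$ for some $v$ absolutely continuous on $[a,b]$; - $\mathcal W^{1,p}_r(\Omega)$: the $u\in AC^d_r(\Omega)$ that are differentiable a.e. in $\Omega$ with $\nabla u\in L^p(\Omega)$. For a class $\mathcal C$ of functions and $f\in X$,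 let $$F_{\mathcal C}(f)=\inf\Big\{\int_\Omega|\nabla u|^p\,w\,dx:\ u\in\mathcal C,\ u \text{ represents } f \text{ in } X\Big\},$$ where $\nabla u$ is the a.e. gradient, the energy of a function not differentiable a.e. in $\Omega$ is $+\infty$, and $\inf\emptyset=+\infty$. Let $\overline{F_{\mathcal C}}$ be the largest lower semicontinuous function on $X$ (with its norm topology) that is $\le F_{\mathcal C}$. Write $F^1,F^2,F^3,F$ for $F_{\mathcal C}$ with $\mathcal C=C^1_r(\overline\Omega),\ {\rm Lip}_r(\overline\Omega),\ \mathcal W^{1,p}_r(\Omega),\ AC^d_r(\Omega)$, respectively. Then, for every $f\in X$, $$\overline{F^1}(f)=\overline{F^2}(f)=\overline{F^3}(f)=\overline F(f).$$ Moreover, let ${\rm Dom}_{r,w}$ be the set of measurable $u:\Omega\to\mathbb R$ of the form $u(x)=v(|x|)$ with $v\in W^{1,1}_{\rm loc}(I_p)$ and $\int_{I_p}r^{d-1}|v'(r)|^p\eta(r)\,dr<\infty$. Let $W={\rm Dom}_{r,w}\cap L^p(\Omega,\hat w_p^{\,p-1})$, with the norm $$\|u\|_W=\Big(\int_{I_{\Omega,w}}|u|^p\,\hat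 w_p^{\,p-1}dx+\int_{I_{\Omega,w}}|\nabla u|^p\,w\,dx\Big)^{1/p},$$ where $\nabla u$ is the weak gradient of $u$ in $I_{\Omega,w}$. Then ${\rm Lip}_r(\overline\Omega)\subset W$ and its closure in $(W,\|\cdot\|_W)$ is $$\overline{{\rm Lip}_r(\overline\Omega)}^{\,W}={\rm Dom}_{r,w}\cap L^p(\Omega,\hat w_p^{\,p-1}).$$ -/

import Mathlib

open MeasureTheory Set
open scoped ENNReal ContDiff

noncomputable section

namespace RadialRelaxation

/-- Euclidean space `ℝ^d`. -/
abbrev E (d : ℕ) : Type := EuclideanSpace ℝ (Fin d)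

/-- The exponent `p`, seen in `[0,∞]`, is at least `1`; this makes `Lp` a normed space. -/
instance instFactOneLeOfReal (p : ℝ) [h : Fact (1 < p)] : Fact (1 ≤ ENNReal.ofReal p) :=
  ⟨by simpa using ENNReal.ofReal_le_ofReal h.out.le⟩

/-! ### The weight and the set where it is not degenerate -/

/-- The radial weight `w(x) = η(|x|)`, with values in `[0,∞]` (so that `w ^ (-1/(p-1)) = ∞`
where `w = 0`). -/
def weight {d : ℕ} (η : ℝ → ℝ) (x : E d) : ℝ≥0∞ := ENNReal.ofReal (η ‖x‖)

/-- `I_p`: the radii `r ∈ (a,b)` such that `η ^ (-1/(p-1))` is summable near `r`. -/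
def goodRadii (p a b : ℝ) (η : ℝ → ℝ) : Set ℝ :=
  {r | r ∈ Ioo a b ∧ ∃ ε > 0,
    ∫⁻ s in Ioo (r - ε) (r + ε), (ENNReal.ofReal (η s)) ^ (-(1 / (p - 1))) < ⊤}

/-- `I_{Ω,w}`: the points of `Ω` whose radius belongs to `I_p`. -/
def goodSet {d : ℕ} (p a b : ℝ) (η : ℝ → ℝ) (Ω : Set (E d)) : Set (E d) :=
  {x | x ∈ Ω ∧ ‖x‖ ∈ goodRadii p a b η}

/-- `I` is the union of the pairwise disjoint nonempty open intervals `(α i, β i)`, which are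
then the connected components of `I`. -/
structure IsIntervalDecomposition (I : Set ℝ) {N : ℕ} (α β : Fin N → ℝ) : Prop where
  lt : ∀ i, α i < β i
  disjoint : ∀ i j, i ≠ j → Disjoint (Ioo (α i) (β i)) (Ioo (α j) (β j))
  union : I = ⋃ i, Ioo (α i) (β i)

/-! ### The auxiliary weight -/

/-- `∫ [|y|^{(d-1)p} w(y)]^{-1/(p-1)} dy` over the shell `{y ∈ I_{Ω,w} : s < |y| < t}`. -/
def shellIntegral {d : ℕ} (p a b : ℝ) (η : ℝ → ℝ) (Ω : Set (E d)) (s t : ℝ) : ℝ≥0∞ :=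
  ∫⁻ y in {y | y ∈ goodSet p a b η Ω ∧ s < ‖y‖ ∧ ‖y‖ < t},
    (ENNReal.ofReal (‖y‖ ^ (((d : ℝ) - 1) * p)) * weight η y) ^ (-(1 / (p - 1)))

/-- The value of the auxiliary weight at a point `x` whose radius lies in the component
`(α, β)` of `I_p`. -/
def hatWeightOn {d : ℕ} (p a b : ℝ) (η : ℝ → ℝ) (Ω : Set (E d)) (α β : ℝ) (x : E d) : ℝ≥0∞ :=
  if ‖x‖ ≤ (3 * α + β) / 4 then (shellIntegral p a b η Ω ‖x‖ ((α + β) / 2))⁻¹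
  else if ‖x‖ ≤ (α + 3 * β) / 4 then
    (shellIntegral p a b η Ω ((3 * α + β) / 4) ((α + 3 * β) / 4))⁻¹
  else (shellIntegral p a b η Ω ((α + β) / 2) ‖x‖)⁻¹

open Classical in
/-- The auxiliary weight `ŵ_p`. It vanishes outside the closure of `I_{Ω,w}`; on the finitely many
spheres `|x| = α i`, `|x| = β i`, which are Lebesgue null sets, the value `0` is used. -/
def hatWeight {d : ℕ} (p a b : ℝ) (η : ℝ → ℝ) (Ω : Set (E d)) {N : ℕ} (α β : Fin N → ℝ)
    (x : E d) : ℝ≥0∞ :=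
  ∑ i, if x ∈ Ω ∧ ‖x‖ ∈ Ioo (α i) (β i) then hatWeightOn p a b η Ω (α i) (β i) x else 0

/-- The measure `ŵ_p^{p-1} dx` on `Ω`; the ambient space is `Lp ℝ p` of this measure. -/
def hatMeasure {d : ℕ} (p a b : ℝ) (η : ℝ → ℝ) (Ω : Set (E d)) {N : ℕ} (α β : Fin N → ℝ) :
    Measure (E d) :=
  (volume.restrict Ω).withDensity fun x => hatWeight p a b η Ω α β x ^ (p - 1)

/-! ### Weak derivatives -/

/-- `u ∈ W^{1,1}_loc(U)` with weak gradient `G`, where `U` is an open subset of `ℝ^d`. -/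
structure HasWeakGradient {d : ℕ} (U : Set (E d)) (u : E d → ℝ) (G : E d → E d) : Prop where
  locallyIntegrable : LocallyIntegrableOn u U
  locallyIntegrable_grad : LocallyIntegrableOn G U
  integral_eq : ∀ φ : E d → ℝ, ContDiff ℝ ∞ φ → HasCompactSupport φ → tsupport φ ⊆ U →
    ∀ e : E d, ∫ x, u x * fderiv ℝ φ x e = -∫ x, inner ℝ (G x) e * φ x

/-- `v ∈ W^{1,1}_loc(U)` with weak derivative `g`, where `U` is an open subset of `ℝ`. -/
structure HasWeakDerivative (U : Set ℝ) (v g : ℝ → ℝ) : Prop where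
  locallyIntegrable : LocallyIntegrableOn v U
  locallyIntegrable_deriv : LocallyIntegrableOn g U
  integral_eq : ∀ φ : ℝ → ℝ, ContDiff ℝ ∞ φ → HasCompactSupport φ → tsupport φ ⊆ U →
    ∫ r, v r * deriv φ r = -∫ r, g r * φ r

/-! ### Classes of functions

A function on `Ω` (or on its closure) is represented by a function on `ℝ^d` whose values elsewhere
play no role. -/

/-- `u` is radial in `Ω`. -/
def RadialOn {d : ℕ} (Ω : Set (E d)) (u : E d → ℝ) : Prop :=
  ∀ x ∈ Ω, ∀ y ∈ Ω, ‖x‖ = ‖y‖ → u x = u y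

/-- Radial functions of class `C^1` up to the boundary: `u` is `C^1` in `Ω`, and `u` and its
gradient are continuous up to the boundary. -/
def C1Radial {d : ℕ} (Ω : Set (E d)) : Set (E d → ℝ) :=
  {u | RadialOn Ω u ∧ ContDiffOn ℝ 1 u Ω ∧ ContinuousOn u (closure Ω) ∧
    ∃ G : E d → E d →L[ℝ] ℝ, ContinuousOn G (closure Ω) ∧ EqOn (fderiv ℝ u) G Ω}

/-- Radial functions that are Lipschitz on the closure of `Ω`. -/
def LipRadial {d : ℕ} (Ω : Set (E d)) : Set (E d → ℝ) :=
  {u | RadialOn Ω u ∧ ∃ K, LipschitzOnWith K u (closure Ω)}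

/-- `AC_r^d(Ω)`: measurable functions on `Ω` of class `W^{1,1}_loc(I_{Ω,w})` which in `I_{Ω,w}`
are of the form `v(|x|)` with `v` absolutely continuous on `[a,b]`. -/
def ACRadial {d : ℕ} (p a b : ℝ) (η : ℝ → ℝ) (Ω : Set (E d)) : Set (E d → ℝ) :=
  {u | Measurable (Ω.domRestrict u) ∧ (∃ G, HasWeakGradient (goodSet p a b η Ω) u G) ∧
    ∃ v : ℝ → ℝ, AbsolutelyContinuousOnInterval v a b ∧ ∀ x ∈ goodSet p a b η Ω, u x = v ‖x‖}

/-- The Sobolev-type space of those functions in `AC_r^d(Ω)` whose (almost everywhere defined)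
gradient is in `L^p(Ω)`. -/
def SobolevRadial {d : ℕ} (p a b : ℝ) (η : ℝ → ℝ) (Ω : Set (E d)) : Set (E d → ℝ) :=
  {u | u ∈ ACRadial p a b η Ω ∧ (∀ᵐ x ∂volume.restrict Ω, DifferentiableAt ℝ u x) ∧
    MemLp (fderiv ℝ u) (ENNReal.ofReal p) (volume.restrict Ω)}

/-! ### The energies and their relaxations -/

open Classical in
/-- The energy `∫_Ω |∇u|^p w dx`, with `∇u` the almost everywhere defined gradient; it is `+∞` if
`u` is not differentiable almost everywhere in `Ω`. -/
def energy {d : ℕ} (p : ℝ) (η : ℝ → ℝ) (Ω : Set (E d)) (u : E d → ℝ) : ℝ≥0∞ :=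
  if ∀ᵐ x ∂volume.restrict Ω, DifferentiableAt ℝ u x then
    ∫⁻ x in Ω, ‖fderiv ℝ u x‖ₑ ^ p * weight η x
  else ⊤

/-- The functional on `L^p(μ)` that is the energy on the class `C` and `+∞` elsewhere. An element
of `L^p(μ)` is a class of functions up to `μ`-null sets; the infimum is over its representatives
in `C`. -/
def functional {d : ℕ} (p : ℝ) (η : ℝ → ℝ) (Ω : Set (E d)) (μ : Measure (E d))
    (C : Set (E d → ℝ)) (f : Lp ℝ (ENNReal.ofReal p) μ) : ℝ≥0∞ :=
  ⨅ u ∈ {u | u ∈ C ∧ f =ᵐ[μ] u}, energy p η Ω u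

/-- The lower semicontinuous envelope of `F`: the largest lower semicontinuous function below
`F`. -/
def lscEnvelope {X : Type*} [TopologicalSpace X] (F : X → ℝ≥0∞) (x : X) : ℝ≥0∞ :=
  ⨆ G ∈ {G : X → ℝ≥0∞ | LowerSemicontinuous G ∧ ∀ y, G y ≤ F y}, G x

/-- The relaxation in `L^p(μ)` of the energy restricted to the class `C`. -/
def relaxation {d : ℕ} (p : ℝ) [Fact (1 < p)] (η : ℝ → ℝ) (Ω : Set (E d)) (μ : Measure (E d))
    (C : Set (E d → ℝ)) : Lp ℝ (ENNReal.ofReal p) μ → ℝ≥0∞ :=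
  lscEnvelope (functional p η Ω μ C)

/-! ### The weighted Sobolev space `W` -/

/-- `Dom_η`: functions `v ∈ W^{1,1}_loc(I_p)` with `∫_{I_p} r^{d-1} |v'|^p η dr < ∞`. -/
def DomEta (d : ℕ) (p a b : ℝ) (η : ℝ → ℝ) : Set (ℝ → ℝ) :=
  {v | ∃ g, HasWeakDerivative (goodRadii p a b η) v g ∧
    ∫⁻ r in goodRadii p a b η,
      ENNReal.ofReal (r ^ (d - 1)) * ‖g r‖ₑ ^ p * ENNReal.ofReal (η r) < ⊤}

/-- `Dom_{r,w}`: measurable functions on `Ω` of the form `v(|x|)` with `v ∈ Dom_η`. -/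
def DomRadial {d : ℕ} (p a b : ℝ) (η : ℝ → ℝ) (Ω : Set (E d)) : Set (E d → ℝ) :=
  {u | Measurable (Ω.domRestrict u) ∧ ∃ v ∈ DomEta d p a b η, ∀ x ∈ Ω, u x = v ‖x‖}

/-- `W = Dom_{r,w} ∩ L^p(Ω, ŵ_p^{p-1})`. -/
def W {d : ℕ} (p a b : ℝ) (η : ℝ → ℝ) (Ω : Set (E d)) {N : ℕ} (α β : Fin N → ℝ) :
    Set (E d → ℝ) :=
  DomRadial p a b η Ω ∩ {u | MemLp u (ENNReal.ofReal p) (hatMeasure p a b η Ω α β)}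

/-- The norm of `W`: the `p`-th root of
`∫_{I_{Ω,w}} |u|^p ŵ_p^{p-1} dx + ∫_{I_{Ω,w}} |∇u|^p w dx`, with `∇u` the weak gradient of `u` in
`I_{Ω,w}`. As the weak gradient is unique almost everywhere, all members of the infimum agree (and
there are none if `u` has no weak gradient). -/
def normW {d : ℕ} (p a b : ℝ) (η : ℝ → ℝ) (Ω : Set (E d)) {N : ℕ} (α β : Fin N → ℝ)
    (u : E d → ℝ) : ℝ≥0∞ :=
  ⨅ G ∈ {G | HasWeakGradient (goodSet p a b η Ω) u G},
    ((∫⁻ x in goodSet p a b η Ω, ‖u x‖ₑ ^ p * hatWeight p a b η Ω α β x ^ (p - 1)) +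
      ∫⁻ x in goodSet p a b η Ω, ‖G x‖ₑ ^ p * weight η x) ^ (1 / p)

/-- The closure of `S` in `W` with respect to the norm of `W`. -/
def closureInW {d : ℕ} (p a b : ℝ) (η : ℝ → ℝ) (Ω : Set (E d)) {N : ℕ} (α β : Fin N → ℝ)
    (S : Set (E d → ℝ)) : Set (E d → ℝ) :=
  {u | u ∈ W p a b η Ω α β ∧ ∀ ε > 0, ∃ l ∈ S, normW p a b η Ω α β (fun x => u x - l x) < ε}

end RadialRelaxation

end

open RadialRelaxation

open RadialRelaxation
open Filter Topology

namespace RadialRelaxation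

/-! ### Polar coordinates for radial functions -/

/-! Everything rests on one approximation result, `exists_radial_approx`. A radial function whose
profile v has finite weighted energy on I_p is a limit in L^p(ŵ^{p-1}) of functions φ(|x|), where φ
is C^1 and φ' is bounded with compact support in (a,b). At the same time φ' tends to 1_{I_p} v' in
L^p((a,b), r^{d-1} η dr). These φ(|x|) belong to all four classes, and their energies have upper
limit at most the energy of v on I_p, which is at most the energy of u. Hence a lower semicontinuous
functional below the energy on such φ(|x|) is below the energy on AC_r^d (`le_functional_ACRadial`):
the four functionals have the same lower semicontinuous minorants, so the same envelope. The same
approximants give the density of Lipschitz functions in W.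

Two facts make the approximation possible. The first is that jumps are free outside I_p
(`exists_cheap_jump`). Near a bad radius the dual weight σ = η^{-1/(p-1)} has infinite integral, and
with A = ∫ min(σ,n) the density min(σ,n)/A has integral 1 and energy at most A^{1-p}, which tends to
0. The end points of the components of I_p that lie inside (a,b) are bad radii. So φ' can
approximate 1_{I_p} v' while the values of φ at the midpoints of the components are prescribed
independently, at no cost.

The second is a Hardy-type inequality (`lintegral_hatMeasure_le`). On a component with midpoint m,
Hölder's inequality gives |∫_m^r k|^p ŵ^{p-1} ≤ C ∫ |k|^p r^{d-1} η dr, because ŵ is the reciprocal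
of the integral of the dual weight over a shell containing the path from m to r. As there are
finitely many components, ŵ is bounded. Convergence of the derivatives and of the N midpoint values
therefore forces convergence in L^p(ŵ^{p-1}).

The passage between profiles and functions on Ω uses polar coordinates, the representation of weakly
differentiable profiles as primitives, and the formula v'(|x|) x/|x| for the weak gradient
(`HasWeakDerivative.hasWeakGradient`). -/

lemma nontrivial_E {d : ℕ} (hd : 1 ≤ d) : Nontrivial (E d) := by
  have : Nonempty (Fin d) := ⟨⟨0, hd⟩⟩
  infer_instance

/-- The surface measure of the unit sphere of `ℝ^d`. -/
noncomputable def sphereArea (d : ℕ) : ℝ≥0∞ := (volume : Measure (E d)).toSphere univ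

lemma sphereArea_ne_top (d : ℕ) : sphereArea d ≠ ⊤ := measure_ne_top _ _

lemma sphereArea_ne_zero {d : ℕ} (hd : 1 ≤ d) : sphereArea d ≠ 0 := by
  have := nontrivial_E hd
  rw [sphereArea, Measure.toSphere_apply_univ]
  refine mul_ne_zero ?_ (Metric.measure_ball_pos _ _ one_pos).ne'
  simp only [finrank_euclideanSpace, Fintype.card_fin]
  exact_mod_cast (by omega : d ≠ 0)

/-- The origin is null because d ≥ 1, and its complement is, as a measure space, the product of the
unit sphere and (0,∞) with measure r^{d-1} dr. -/
lemma lintegral_comp_norm {d : ℕ} (hd : 1 ≤ d) {f : ℝ → ℝ≥0∞} (hf : Measurable f) :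
    ∫⁻ x : E d, f ‖x‖ = sphereArea d * ∫⁻ r in Ioi 0, ENNReal.ofReal (r ^ (d - 1)) * f r := by
  have := nontrivial_E hd
  have hdim : Module.finrank ℝ (E d) = d := by simp
  calc
    ∫⁻ x : E d, f ‖x‖ = ∫⁻ x in ({(0)}ᶜ : Set (E d)), f ‖x‖ := by
      rw [restrict_compl_singleton]
    _ = ∫⁻ x : ({(0)}ᶜ : Set (E d)), f (‖x.1‖) ∂(volume.comap Subtype.val) :=
      (lintegral_subtype_comap (measurableSet_singleton _).compl _).symm
    _ = ∫⁻ x : Metric.sphere (0 : E d) 1 × Ioi (0 : ℝ), f x.2.1 ∂(volume : Measure (E d)).toSphere.prod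
          (.volumeIoiPow (Module.finrank ℝ (E d) - 1)) := by
      have h := (volume : Measure (E d)).measurePreserving_homeomorphUnitSphereProd.lintegral_comp_emb
        (Homeomorph.measurableEmbedding _) (f ∘ Subtype.val ∘ Prod.snd)
      simpa using h
    _ = sphereArea d * ∫⁻ r : Ioi (0 : ℝ), f r ∂.volumeIoiPow (Module.finrank ℝ (E d) - 1) := by
      rw [lintegral_prod _ (by fun_prop)]
      simp only [lintegral_const]
      rw [mul_comm, sphereArea]
    _ = _ := by
      rw [hdim, Measure.volumeIoiPow, lintegral_withDensity_eq_lintegral_mul _ (by fun_prop)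
        (by fun_prop)]
      congr 1
      exact lintegral_subtype_comap measurableSet_Ioi
        (fun r => ENNReal.ofReal (r ^ (d - 1)) * f r)

/-- Transfers almost everywhere identities and measurable representatives from profiles to radial
functions. -/
lemma quasiMeasurePreserving_norm {d : ℕ} (hd : 1 ≤ d) :
    Measure.QuasiMeasurePreserving (fun x : E d => ‖x‖) volume (volume.restrict (Ioi 0)) := by
  refine ⟨measurable_norm, Measure.AbsolutelyContinuous.mk fun s hs h0 => ?_⟩
  rw [Measure.map_apply measurable_norm hs, ← lintegral_indicator_one (measurable_norm hs)]
  have h := lintegral_comp_norm hd (f := s.indicator 1) (measurable_one.indicator hs)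
  have h2 : (fun x : E d => s.indicator (1 : ℝ → ℝ≥0∞) ‖x‖)
      = ((fun x : E d => ‖x‖) ⁻¹' s).indicator 1 := by
    ext x; by_cases hx : ‖x‖ ∈ s <;> simp [hx]
  rw [← h2, h]
  have : ∀ᵐ r ∂volume.restrict (Ioi (0 : ℝ)), r ∉ s := by
    rw [ae_iff]; simpa using h0
  have h3 : ∫⁻ r in Ioi 0, ENNReal.ofReal (r ^ (d - 1)) * s.indicator 1 r = 0 := by
    rw [← lintegral_zero (μ := volume.restrict (Ioi (0 : ℝ)))]
    refine lintegral_congr_ae ?_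
    filter_upwards [this] with r hr
    simp [hr]
  rw [h3, mul_zero]

lemma quasiMeasurePreserving_norm_restrict {d : ℕ} (hd : 1 ≤ d) {U : Set ℝ}
    (hU : MeasurableSet U) (hU0 : U ⊆ Ioi 0) :
    Measure.QuasiMeasurePreserving (fun x : E d => ‖x‖) (volume.restrict {x | ‖x‖ ∈ U})
      (volume.restrict U) := by
  have h := (quasiMeasurePreserving_norm hd).restrict (s := {x | ‖x‖ ∈ U}) (t := U)
    (fun x hx => hx)
  rwa [Measure.restrict_restrict hU, inter_eq_left.2 hU0] at h

lemma measurableSet_norm_mem {d : ℕ} {U : Set ℝ} (hU : MeasurableSet U) :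
    MeasurableSet {x : E d | ‖x‖ ∈ U} := measurable_norm hU

lemma setLIntegral_comp_norm {d : ℕ} (hd : 1 ≤ d) {U : Set ℝ} (hU : MeasurableSet U)
    (hU0 : U ⊆ Ioi 0) {f : ℝ → ℝ≥0∞} (hf : AEMeasurable f (volume.restrict U)) :
    ∫⁻ x in {x : E d | ‖x‖ ∈ U}, f ‖x‖
      = sphereArea d * ∫⁻ r in U, ENNReal.ofReal (r ^ (d - 1)) * f r := by
  have hq := quasiMeasurePreserving_norm_restrict hd hU hU0
  have h1 : ∫⁻ x in {x : E d | ‖x‖ ∈ U}, f ‖x‖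
      = ∫⁻ x in {x : E d | ‖x‖ ∈ U}, hf.mk f ‖x‖ := by
    refine lintegral_congr_ae ?_
    exact hq.ae_eq hf.ae_eq_mk
  have h2 : ∫⁻ r in U, ENNReal.ofReal (r ^ (d - 1)) * f r
      = ∫⁻ r in U, ENNReal.ofReal (r ^ (d - 1)) * hf.mk f r := by
    refine lintegral_congr_ae ?_
    filter_upwards [hf.ae_eq_mk] with r hr
    rw [hr]
  rw [h1, h2, ← lintegral_indicator (measurableSet_norm_mem hU), ← lintegral_indicator hU]
  have h3 := lintegral_comp_norm hd (hf.measurable_mk.indicator hU)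
  have h4 : (fun x : E d => U.indicator (hf.mk f) ‖x‖)
      = {x : E d | ‖x‖ ∈ U}.indicator (fun x => hf.mk f ‖x‖) := by
    ext x; simp only [indicator, mem_ofPred_eq]
  rw [← h4, h3, ← lintegral_indicator measurableSet_Ioi]
  congr 2
  ext r
  by_cases hr : r ∈ U
  · simp [hr, mem_Ioi.1 (hU0 hr)]
  · simp [hr]

lemma integrableOn_comp_norm {d : ℕ} (hd : 1 ≤ d) {U : Set ℝ} (hU : MeasurableSet U)
    (hU0 : U ⊆ Ioi 0) {R : ℝ} (hR : U ⊆ Iic R) {f : ℝ → ℝ} (hf : IntegrableOn f U) :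
    IntegrableOn (fun x : E d => f ‖x‖) {x | ‖x‖ ∈ U} := by
  have hq := quasiMeasurePreserving_norm_restrict hd hU hU0
  refine ⟨hf.1.comp_quasiMeasurePreserving hq, ?_⟩
  rw [hasFiniteIntegral_iff_enorm,
    setLIntegral_comp_norm hd hU hU0 (f := fun r => ‖f r‖ₑ) hf.1.enorm]
  refine ENNReal.mul_lt_top (sphereArea_ne_top d).lt_top ?_
  calc ∫⁻ r in U, ENNReal.ofReal (r ^ (d - 1)) * ‖f r‖ₑ
      ≤ ∫⁻ r in U, ENNReal.ofReal (R ^ (d - 1)) * ‖f r‖ₑ := by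
        refine setLIntegral_mono' hU fun r hr => ?_
        have : 0 < r := hU0 hr
        have : r ≤ R := hR hr
        gcongr
    _ = ENNReal.ofReal (R ^ (d - 1)) * ∫⁻ r in U, ‖f r‖ₑ := by
        rw [lintegral_const_mul' _ _ ENNReal.ofReal_ne_top]
    _ < ⊤ := ENNReal.mul_lt_top ENNReal.ofReal_lt_top hf.2

lemma locallyIntegrableOn_comp_norm {d : ℕ} (hd : 1 ≤ d) {U : Set ℝ} (hU : IsOpen U)
    (hU0 : U ⊆ Ioi 0) {f : ℝ → ℝ} (hf : LocallyIntegrableOn f U) :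
    LocallyIntegrableOn (fun x : E d => f ‖x‖) {x | ‖x‖ ∈ U} := by
  have hV : IsOpen {x : E d | ‖x‖ ∈ U} := hU.preimage continuous_norm
  rw [locallyIntegrableOn_iff hV.isLocallyClosed]
  intro K hK hKc
  have hKc' : IsCompact ((fun x : E d => ‖x‖) '' K) := hKc.image continuous_norm
  have hKU : (fun x : E d => ‖x‖) '' K ⊆ U := by rintro _ ⟨x, hx, rfl⟩; exact hK hx
  have h1 := hf.integrableOn_compact_subset hKU hKc'
  obtain ⟨R, hR⟩ := hKc'.bddAbove
  exact (integrableOn_comp_norm hd hKc'.measurableSet (hKU.trans hU0)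
    (fun r hr => hR hr) h1).mono_set fun x hx => ⟨x, hx, rfl⟩

/-! ### Weak derivatives on the line -/

lemma integrable_mul_of_tsupport_subset {X : Type*} [TopologicalSpace X] [MeasurableSpace X]
    [OpensMeasurableSpace X] [T2Space X] {μ : Measure X} {U : Set X} {f ψ : X → ℝ}
    (hf : LocallyIntegrableOn f U μ) (hψ : Continuous ψ) (hψc : HasCompactSupport ψ)
    (hψU : tsupport ψ ⊆ U) : Integrable (fun x => f x * ψ x) μ := by
  have h1 : IntegrableOn f (tsupport ψ) μ := hf.integrableOn_compact_subset hψU hψc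
  have h2 : IntegrableOn (fun x => f x * ψ x) (tsupport ψ) μ :=
    h1.mul_continuousOn hψ.continuousOn hψc
  rwa [integrableOn_iff_integrable_of_support_subset] at h2
  intro x hx
  refine subset_tsupport _ ?_
  rw [Function.mem_support] at hx ⊢
  exact right_ne_zero_of_mul hx

lemma exists_smooth_cutoff {K U : Set ℝ} (hK : IsCompact K) (hU : IsOpen U) (hKU : K ⊆ U) :
    ∃ χ : ℝ → ℝ, ContDiff ℝ ∞ χ ∧ HasCompactSupport χ ∧ tsupport χ ⊆ U ∧
      (∀ᶠ x in 𝓝ˢ K, χ x = 1) ∧ ∀ x, χ x ∈ Icc (0 : ℝ) 1 := by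
  obtain ⟨L, hL, hKL, hLU⟩ := exists_compact_between hK hU hKU
  obtain ⟨f, h1, h0, h01⟩ := exists_contMDiffMap_one_nhds_of_subset_interior (n := (⊤ : ℕ∞))
    (modelWithCornersSelf ℝ ℝ) hK.isClosed hKL
  have hsub : tsupport (f : ℝ → ℝ) ⊆ L := by
    refine closure_minimal (fun x hx => ?_) hL.isClosed
    by_contra hxL
    exact hx (h0 x hxL)
  exact ⟨f, f.contMDiff.contDiff, hL.of_isClosed_subset (isClosed_tsupport _) hsub,
    hsub.trans hLU, h1, h01⟩

/-- Adjoining m makes the compact set nonempty and keeps the base point of the primitives inside the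
interval. -/
lemma exists_Icc_of_isCompact_subset {K U : Set ℝ} (hK : IsCompact K) (hU : IsOpen U)
    (hUc : U.OrdConnected) {m : ℝ} (hm : m ∈ U) (hKU : K ⊆ U) :
    ∃ s t, s < m ∧ m < t ∧ K ⊆ Ioo s t ∧ Icc s t ⊆ U := by
  have hK' : IsCompact (insert m K) := hK.insert m
  have hsub : insert m K ⊆ U := insert_subset hm hKU
  have hne : (insert m K).Nonempty := insert_nonempty _ _
  have h0 := hsub (hK'.sInf_mem hne)
  have h1 := hsub (hK'.sSup_mem hne)
  obtain ⟨s, hs, hsU⟩ : ∃ s < sInf (insert m K), s ∈ U := by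
    obtain ⟨ε, hε, hb⟩ := Metric.isOpen_iff.1 hU _ h0
    refine ⟨sInf (insert m K) - ε / 2, by linarith, hb ?_⟩
    rw [Metric.mem_ball, Real.dist_eq, abs_lt]; constructor <;> linarith
  obtain ⟨t, ht, htU⟩ : ∃ t > sSup (insert m K), t ∈ U := by
    obtain ⟨ε, hε, hb⟩ := Metric.isOpen_iff.1 hU _ h1
    refine ⟨sSup (insert m K) + ε / 2, by linarith, hb ?_⟩
    rw [Metric.mem_ball, Real.dist_eq, abs_lt]; constructor <;> linarith
  have hl : ∀ x ∈ insert m K, s < x ∧ x < t := fun x hx =>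
    ⟨hs.trans_le (csInf_le hK'.bddBelow hx), (le_csSup hK'.bddAbove hx).trans_lt ht⟩
  exact ⟨s, t, (hl m (mem_insert _ _)).1, (hl m (mem_insert _ _)).2,
    fun x hx => hl x (mem_insert_of_mem _ hx), hUc.out hsU htU⟩

lemma integral_mul_deriv_eq_neg_of_absolutelyContinuous {v g φ : ℝ → ℝ} {s t : ℝ}
    (hst : s ≤ t) (hv : AbsolutelyContinuousOnInterval v s t)
    (hg : ∀ᵐ x, x ∈ Icc s t → deriv v x = g x)
    (hφ : ContDiff ℝ 1 φ) (hsupp : tsupport φ ⊆ Ioo s t) :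
    ∫ r, v r * deriv φ r = -∫ r, g r * φ r := by
  have hφac : AbsolutelyContinuousOnInterval φ s t := hφ.contDiffOn.absolutelyContinuousOnInterval
  have h0 : ∀ x, x ∉ Ioo s t → φ x = 0 := fun x hx =>
    image_eq_zero_of_notMem_tsupport fun h => hx (hsupp h)
  have h1 : ∫ r in s..t, v r * deriv φ r = ∫ r, v r * deriv φ r := by
    refine intervalIntegral.integral_eq_integral_of_support_subset fun x hx => ?_
    have : deriv φ x ≠ 0 := right_ne_zero_of_mul hx
    exact Ioo_subset_Ioc_self (hsupp (support_deriv_subset this))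
  have h2 : ∫ r in s..t, g r * φ r = ∫ r, g r * φ r := by
    refine intervalIntegral.integral_eq_integral_of_support_subset fun x hx => ?_
    have : φ x ≠ 0 := right_ne_zero_of_mul hx
    exact Ioo_subset_Ioc_self (hsupp (subset_tsupport _ this))
  rw [← h1, ← h2, hv.integral_mul_deriv_eq_deriv_mul hφac, h0 s (by simp), h0 t (by simp)]
  have h3 : ∫ x in s..t, deriv v x * φ x = ∫ x in s..t, g x * φ x := by
    refine intervalIntegral.integral_congr_ae ?_
    filter_upwards [hg] with x hx hxm
    rw [uIoc_of_le hst] at hxm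
    rw [hx (Ioc_subset_Icc_self hxm)]
  rw [h3]; ring

/-- The zero mean is what makes the primitive from s vanish again to the right of t. -/
lemma exists_smooth_primitive {φ : ℝ → ℝ} (hφ : ContDiff ℝ ∞ φ) {s t : ℝ}
    (hsupp : tsupport φ ⊆ Ioo s t) (hint : ∫ x, φ x = 0) :
    ∃ Φ : ℝ → ℝ, ContDiff ℝ ∞ Φ ∧ tsupport Φ ⊆ Icc s t ∧ deriv Φ = φ := by
  have h0 : ∀ x, x ∉ Ioo s t → φ x = 0 := fun x hx =>
    image_eq_zero_of_notMem_tsupport fun h => hx (hsupp h)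
  have hd : ∀ x, HasDerivAt (fun y => ∫ u in s..y, φ u) (φ x) x := fun x =>
    (hφ.continuous.integral_hasStrictDerivAt s x).hasDerivAt
  have hderiv : deriv (fun y => ∫ u in s..y, φ u) = φ := funext fun x => (hd x).deriv
  refine ⟨fun y => ∫ u in s..y, φ u, ?_, ?_, hderiv⟩
  · rw [contDiff_infty_iff_deriv, hderiv]
    exact ⟨fun x => (hd x).differentiableAt, hφ⟩
  · refine closure_minimal (fun x hx => ?_) isClosed_Icc
    by_contra hxm
    refine hx ?_
    rw [mem_Icc, not_and_or, not_le, not_le] at hxm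
    rcases hxm with hxs | hxt
    · show ∫ u in s..x, φ u = 0
      rw [intervalIntegral.integral_congr (g := fun _ => 0)]
      · simp
      · intro u hu
        rw [uIcc_of_ge hxs.le] at hu
        exact h0 u fun h => absurd h.1 (not_lt.2 hu.2)
    · show ∫ u in s..x, φ u = 0
      rw [intervalIntegral.integral_eq_integral_of_support_subset, hint]
      intro u hu
      have := hsupp (subset_tsupport _ hu)
      exact ⟨this.1, (this.2.trans hxt).le⟩

lemma intervalIntegrable_of_locallyIntegrableOn {U : Set ℝ} {g : ℝ → ℝ}
    (hg : LocallyIntegrableOn g U) {s t : ℝ} (h : uIcc s t ⊆ U) :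
    IntervalIntegrable g volume s t :=
  (hg.integrableOn_compact_subset h isCompact_uIcc).intervalIntegrable

lemma locallyIntegrableOn_primitive {U : Set ℝ} (hU : IsOpen U) (hUc : U.OrdConnected)
    {g : ℝ → ℝ} (hg : LocallyIntegrableOn g U) {m : ℝ} (hm : m ∈ U) :
    LocallyIntegrableOn (fun r => ∫ x in m..r, g x) U := by
  rw [locallyIntegrableOn_iff hU.isLocallyClosed]
  intro K hKU hK
  obtain ⟨s, t, hs, ht, hKst, hstU⟩ := exists_Icc_of_isCompact_subset hK hU hUc hm hKU
  have hi : IntervalIntegrable g volume s t := intervalIntegrable_of_locallyIntegrableOn hg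
    (by rwa [uIcc_of_le (hs.trans ht).le])
  have hac := hi.absolutelyContinuousOnInterval_intervalIntegral (c := m)
    (by rw [uIcc_of_le (hs.trans ht).le]; exact ⟨hs.le, ht.le⟩)
  have hc := hac.continuousOn
  rw [uIcc_of_le (hs.trans ht).le] at hc
  exact (hc.mono (hKst.trans Ioo_subset_Icc_self)).integrableOn_compact hK

lemma hasWeakDerivative_primitive {U : Set ℝ} (hU : IsOpen U) (hUc : U.OrdConnected)
    {g : ℝ → ℝ} (hg : LocallyIntegrableOn g U) {m : ℝ} (hm : m ∈ U) :
    HasWeakDerivative U (fun r => ∫ x in m..r, g x) g := by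
  refine ⟨locallyIntegrableOn_primitive hU hUc hg hm, hg, fun φ hφ hφc hφU => ?_⟩
  obtain ⟨s, t, hs, ht, hKst, hstU⟩ := exists_Icc_of_isCompact_subset hφc hU hUc hm hφU
  have hst := (hs.trans ht).le
  have hi : IntervalIntegrable g volume s t := intervalIntegrable_of_locallyIntegrableOn hg
    (by rwa [uIcc_of_le hst])
  have hmst : m ∈ uIcc s t := by rw [uIcc_of_le hst]; exact ⟨hs.le, ht.le⟩
  refine integral_mul_deriv_eq_neg_of_absolutelyContinuous hst
    (hi.absolutelyContinuousOnInterval_intervalIntegral hmst) ?_ (hφ.of_le (by simp)) hKst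
  filter_upwards [hi.ae_hasDerivAt_integral] with x hx hxm
  rw [← uIcc_of_le hst] at hxm
  exact (hx hxm m hmst).deriv

lemma HasWeakDerivative.sub {U : Set ℝ} {v g v' g' : ℝ → ℝ} (h : HasWeakDerivative U v g)
    (h' : HasWeakDerivative U v' g') :
    HasWeakDerivative U (fun r => v r - v' r) (fun r => g r - g' r) := by
  refine ⟨h.1.sub h'.1, h.2.sub h'.2, fun φ hφ hφc hφU => ?_⟩
  have hd : Continuous (deriv φ) := hφ.continuous_deriv (by simp)
  have hdU : tsupport (deriv φ) ⊆ U := (tsupport_deriv_subset).trans hφU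
  simp only [sub_mul]
  rw [integral_sub (integrable_mul_of_tsupport_subset h.1 hd hφc.deriv hdU)
      (integrable_mul_of_tsupport_subset h'.1 hd hφc.deriv hdU),
    integral_sub (integrable_mul_of_tsupport_subset h.2 hφ.continuous hφc hφU)
      (integrable_mul_of_tsupport_subset h'.2 hφ.continuous hφc hφU),
    h.3 φ hφ hφc hφU, h'.3 φ hφ hφc hφU]
  ring

/-- Du Bois-Reymond's argument. With ρ a fixed bump of integral 1, every test function φ minus (∫φ)ρ
has zero mean, hence is the derivative of a test function supported in U. Therefore ∫ wφ = (∫φ)(∫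
wρ), and the constant is ∫ wρ. The order connectedness of U keeps the support of the primitive in U.
-/
lemma HasWeakDerivative.exists_ae_eq_const {U : Set ℝ} (hU : IsOpen U) (hUc : U.OrdConnected)
    {w : ℝ → ℝ} (h : HasWeakDerivative U w 0) : ∃ c, ∀ᵐ r, r ∈ U → w r = c := by
  rcases U.eq_empty_or_nonempty with rfl | ⟨m, hm⟩
  · exact ⟨0, by simp⟩
  obtain ⟨ε, hε, hball⟩ := Metric.isOpen_iff.1 hU m hm
  let B : ContDiffBump m := ⟨ε / 4, ε / 2, by linarith, by linarith⟩
  set ρ : ℝ → ℝ := B.normed volume with hρdef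
  have hρ : ContDiff ℝ ∞ ρ := B.contDiff_normed
  have hρc : HasCompactSupport ρ := B.hasCompactSupport_normed
  have hρ1 : ∫ x, ρ x = 1 := B.integral_normed
  have hρU : tsupport ρ ⊆ U := by
    rw [hρdef, B.tsupport_normed_eq]
    exact (Metric.closedBall_subset_ball (by show ε / 2 < ε; linarith)).trans hball
  refine ⟨∫ x, w x * ρ x, ?_⟩
  have key := hU.ae_eq_zero_of_integral_contDiff_smul_eq_zero
    (f := fun r => w r - ∫ x, w x * ρ x) (μ := volume) ?_ ?_
  · filter_upwards [key] with r hr hrU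
    exact sub_eq_zero.1 (hr hrU)
  · exact h.1.sub ((continuous_const.locallyIntegrable).locallyIntegrableOn U)
  · intro φ hφ hφc hφU
    have hψ : ContDiff ℝ ∞ (fun x => φ x - (∫ y, φ y) * ρ x) := hφ.sub (contDiff_const.mul hρ)
    have hsub : tsupport (fun x => φ x - (∫ y, φ y) * ρ x) ⊆ tsupport φ ∪ tsupport ρ := by
      refine closure_minimal (fun x hx => ?_) ((isClosed_tsupport _).union (isClosed_tsupport _))
      by_contra hn
      rw [mem_union, not_or] at hn
      refine hx ?_
      show φ x - (∫ y, φ y) * ρ x = 0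
      rw [image_eq_zero_of_notMem_tsupport hn.1, image_eq_zero_of_notMem_tsupport hn.2]
      ring
    have hφi : Integrable φ := hφ.continuous.integrable_of_hasCompactSupport hφc
    have hρi : Integrable ρ := hρ.continuous.integrable_of_hasCompactSupport hρc
    have hint : ∫ x, (φ x - (∫ y, φ y) * ρ x) = 0 := by
      rw [integral_sub hφi (hρi.const_mul _), integral_const_mul, hρ1]; ring
    obtain ⟨s, t, hs, ht, hKst, hstU⟩ := exists_Icc_of_isCompact_subset
      (hφc.union hρc : IsCompact (tsupport φ ∪ tsupport ρ)) hU hUc hm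
      (union_subset hφU hρU)
    obtain ⟨Φ, hΦ, hΦs, hΦd⟩ := exists_smooth_primitive hψ
      (hsub.trans hKst) hint
    have hΦc : HasCompactSupport Φ :=
      isCompact_Icc.of_isClosed_subset (isClosed_tsupport _) hΦs
    have h3 := h.3 Φ hΦ hΦc (hΦs.trans hstU)
    rw [hΦd] at h3
    simp only [Pi.zero_apply, zero_mul, integral_zero, neg_zero] at h3
    have hwφ := integrable_mul_of_tsupport_subset h.1 hφ.continuous hφc hφU
    have hwρ := integrable_mul_of_tsupport_subset h.1 hρ.continuous hρc hρU
    have e1 : ∫ r, w r * (φ r - (∫ y, φ y) * ρ r)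
        = (∫ r, w r * φ r) - (∫ y, φ y) * ∫ r, w r * ρ r := by
      rw [← integral_const_mul, ← integral_sub hwφ (hwρ.const_mul _)]
      congr 1; ext r; ring
    have e2 : ∫ x, φ x • (w x - ∫ x, w x * ρ x)
        = (∫ r, w r * φ r) - (∫ y, φ y) * ∫ r, w r * ρ r := by
      rw [← integral_mul_const, ← integral_sub hwφ (hφi.mul_const _)]
      congr 1; ext r; simp only [smul_eq_mul]; ring
    rw [e2, ← e1, h3]

lemma HasWeakDerivative.exists_ae_eq_primitive {U : Set ℝ} (hU : IsOpen U) (hUc : U.OrdConnected)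
    {v g : ℝ → ℝ} (h : HasWeakDerivative U v g) {m : ℝ} (hm : m ∈ U) :
    ∃ c, ∀ᵐ r, r ∈ U → v r = c + ∫ x in m..r, g x := by
  have h1 := h.sub (hasWeakDerivative_primitive hU hUc h.2 hm)
  have e : (fun r => g r - g r) = 0 := by ext; simp
  rw [e] at h1
  obtain ⟨c, hc⟩ := h1.exists_ae_eq_const hU hUc
  refine ⟨c, ?_⟩
  filter_upwards [hc] with r hr hrU
  linarith [hr hrU]

lemma HasWeakDerivative.mono {U V : Set ℝ} {v g : ℝ → ℝ} (h : HasWeakDerivative U v g)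
    (hVU : V ⊆ U) : HasWeakDerivative V v g :=
  ⟨h.1.mono_set hVU, h.2.mono_set hVU, fun φ hφ hφc hφV => h.3 φ hφ hφc (hφV.trans hVU)⟩

/-- The product with a smooth cut-off function is a weakly differentiable function on the line. -/
lemma HasWeakDerivative.cutoff {U : Set ℝ} {v g χ : ℝ → ℝ} (h : HasWeakDerivative U v g)
    (hχ : ContDiff ℝ ∞ χ) (hχc : HasCompactSupport χ) (hχU : tsupport χ ⊆ U) :
    HasWeakDerivative univ (fun r => v r * χ r) (fun r => v r * deriv χ r + g r * χ r) := by
  have hd : Continuous (deriv χ) := hχ.continuous_deriv (by simp)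
  have hdU : tsupport (deriv χ) ⊆ U := (tsupport_deriv_subset).trans hχU
  have i1 := integrable_mul_of_tsupport_subset h.1 hχ.continuous hχc hχU
  have i2 := integrable_mul_of_tsupport_subset h.1 hd hχc.deriv hdU
  have i3 := integrable_mul_of_tsupport_subset h.2 hχ.continuous hχc hχU
  refine ⟨i1.locallyIntegrable.locallyIntegrableOn _,
    (i2.add i3).locallyIntegrable.locallyIntegrableOn _, fun φ hφ hφc _ => ?_⟩
  have hsub : tsupport (fun r => χ r * φ r) ⊆ U := (tsupport_mul_subset_left).trans hχU
  have h3 := h.3 (fun r => χ r * φ r) (hχ.mul hφ) hχc.mul_right hsub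
  have hder : ∀ r, deriv (fun r => χ r * φ r) r = deriv χ r * φ r + χ r * deriv φ r := fun r =>
    deriv_fun_mul (hχ.differentiable (by simp) r) (hφ.differentiable (by simp) r)
  have hdφ : Continuous (deriv φ) := hφ.continuous_deriv (by simp)
  obtain ⟨C, hC⟩ := hφc.exists_bound_of_continuous hφ.continuous
  obtain ⟨C', hC'⟩ := hφc.deriv.exists_bound_of_continuous hdφ
  have j1 : Integrable (fun r => v r * χ r * deriv φ r) :=
    i1.mul_bdd (c := C') hdφ.aestronglyMeasurable (.of_forall hC')
  have j2 : Integrable (fun r => v r * deriv χ r * φ r) :=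
    i2.mul_bdd (c := C) hφ.continuous.aestronglyMeasurable (.of_forall hC)
  have j3 : Integrable (fun r => g r * χ r * φ r) :=
    i3.mul_bdd (c := C) hφ.continuous.aestronglyMeasurable (.of_forall hC)
  have e1 : ∫ r, v r * deriv (fun r => χ r * φ r) r
      = (∫ r, v r * deriv χ r * φ r) + ∫ r, v r * χ r * deriv φ r := by
    rw [← integral_add j2 j1]
    congr 1; ext r; rw [hder]; ring
  have e2 : ∫ r, (v r * deriv χ r + g r * χ r) * φ r
      = (∫ r, v r * deriv χ r * φ r) + ∫ r, g r * χ r * φ r := by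
    rw [← integral_add j2 j3]
    congr 1; ext r; ring
  have e3 : ∫ r, g r * (χ r * φ r) = ∫ r, g r * χ r * φ r := by
    congr 1; ext r; ring
  rw [e1, e3] at h3
  rw [e2]
  linarith

/-! ### Derivatives of radial functions -/

lemma hasFDerivAt_comp_norm {d : ℕ} {φ : ℝ → ℝ} {y : ℝ} {x : E d} (hx : x ≠ 0)
    (h : HasDerivAt φ y ‖x‖) :
    HasFDerivAt (fun x : E d => φ ‖x‖) ((y * ‖x‖⁻¹) • innerSL ℝ x) x := by
  have h1 : HasFDerivAt (fun x : E d => ‖x‖) (‖x‖⁻¹ • innerSL ℝ x) x := by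
    have h2 := (hasStrictFDerivAt_norm_sq x).hasFDerivAt.sqrt (by simpa using hx)
    have h3 : (fun y : E d => √(‖y‖ ^ 2)) = fun y => ‖y‖ := by
      ext y; exact Real.sqrt_sq (norm_nonneg y)
    rw [h3, Real.sqrt_sq (norm_nonneg x)] at h2
    refine h2.congr_fderiv ?_
    ext z
    have : ‖x‖ ≠ 0 := norm_ne_zero_iff.2 hx
    simp
    field_simp
  have h4 := h.comp_hasFDerivAt x h1
  rw [smul_smul] at h4
  exact h4

lemma eq_of_deriv_eq_zero_Iio {φ : ℝ → ℝ} (hφ : Differentiable ℝ φ) {c : ℝ}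
    (h0 : ∀ r < c, deriv φ r = 0) {x y : ℝ} (hx : x < c) (hy : y < c) : φ x = φ y :=
  isOpen_Iio.is_const_of_deriv_eq_zero isPreconnected_Iio hφ.differentiableOn
    (fun r hr => h0 r hr) hx hy

lemma comp_norm_eventuallyEq {d : ℕ} {φ : ℝ → ℝ} (hφ : Differentiable ℝ φ) {c : ℝ} (hc : 0 < c)
    (h0 : ∀ r < c, deriv φ r = 0) :
    (fun x : E d => φ ‖x‖) =ᶠ[𝓝 0] fun _ => φ 0 := by
  filter_upwards [Metric.ball_mem_nhds (0 : E d) hc] with x hx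
  exact eq_of_deriv_eq_zero_Iio hφ h0 (by simpa using hx) hc

/-- The norm is not differentiable at the origin; φ being constant to the left of c > 0 makes the
composition constant near it. -/
lemma contDiff_comp_norm {d : ℕ} {φ : ℝ → ℝ} (hφ : ContDiff ℝ 1 φ) {c : ℝ} (hc : 0 < c)
    (h0 : ∀ r < c, deriv φ r = 0) : ContDiff ℝ 1 (fun x : E d => φ ‖x‖) := by
  rw [contDiff_iff_contDiffAt]
  intro x
  rcases eq_or_ne x 0 with rfl | hx
  · exact contDiffAt_const.congr_of_eventuallyEq
      (comp_norm_eventuallyEq (hφ.differentiable one_ne_zero) hc h0)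
  · exact hφ.contDiffAt.comp x (contDiffAt_norm ℝ hx)

lemma fderiv_comp_norm {d : ℕ} {φ : ℝ → ℝ} (hφ : Differentiable ℝ φ) {c : ℝ} (hc : 0 < c)
    (h0 : ∀ r < c, deriv φ r = 0) (x : E d) :
    fderiv ℝ (fun x : E d => φ ‖x‖) x = (deriv φ ‖x‖ * ‖x‖⁻¹) • innerSL ℝ x := by
  rcases eq_or_ne x 0 with rfl | hx
  · rw [(comp_norm_eventuallyEq hφ hc h0).fderiv_eq]
    simp
  · exact (hasFDerivAt_comp_norm hx (hφ ‖x‖).hasDerivAt).fderiv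

lemma norm_radial_smul_le {d : ℕ} (y : ℝ) (x : E d) : ‖(y * ‖x‖⁻¹) • x‖ ≤ |y| := by
  rw [norm_smul, Real.norm_eq_abs, abs_mul, abs_inv, abs_norm, mul_assoc]
  rcases eq_or_ne x 0 with rfl | hx
  · simp
  · rw [inv_mul_cancel₀ (norm_ne_zero_iff.2 hx), mul_one]

/-! ### The weak gradient of a radial function -/

lemma norm_primitive_le {H : ℝ → ℝ} (hH : Integrable H) (s t : ℝ) :
    |∫ x in s..t, H x| ≤ ∫ x, |H x| := by
  rw [← Real.norm_eq_abs]
  refine intervalIntegral.norm_integral_le_integral_norm_uIoc.trans ?_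
  exact setIntegral_le_integral hH.norm (.of_forall fun x => norm_nonneg _)

lemma continuous_primitive_comp_norm {d : ℕ} {H : ℝ → ℝ} (hH : Integrable H) :
    Continuous (fun x : E d => ∫ r in (0 : ℝ)..‖x‖, H r) :=
  (intervalIntegral.continuous_primitive (fun _ _ => hH.intervalIntegrable) 0).comp continuous_norm

/-- Integrability and a bound for the radial part of a weak gradient against a test function. -/
lemma integrable_radial_mul {d : ℕ} (hd : 1 ≤ d) {φ : E d → ℝ} (hφ : Continuous φ)
    (hφc : HasCompactSupport φ) (e : E d) :
    ∃ M : ℝ, ∀ H : ℝ → ℝ, Integrable H →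
      Integrable (fun x : E d => inner ℝ ((H ‖x‖ * ‖x‖⁻¹) • x) e * φ x) ∧
      |∫ x : E d, inner ℝ ((H ‖x‖ * ‖x‖⁻¹) • x) e * φ x| ≤ M * ∫ r, |H r| := by
  obtain ⟨C, hC⟩ := hφc.exists_bound_of_continuous hφ
  obtain ⟨R, hR⟩ := hφc.isBounded.subset_closedBall (0 : E d)
  have hC0 : 0 ≤ C := (norm_nonneg _).trans (hC 0)
  set U : Set ℝ := Ioc 0 R with hU
  have hUm : MeasurableSet U := measurableSet_Ioc
  have hU0 : U ⊆ Ioi 0 := fun r hr => hr.1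
  set V : Set (E d) := {x | ‖x‖ ∈ U} with hV
  have hVm : MeasurableSet V := measurableSet_norm_mem hUm
  refine ⟨(sphereArea d).toReal * |R| ^ (d - 1) * (‖e‖ * C), fun H hH => ?_⟩
  have hsupp : Function.support (fun x : E d => inner ℝ ((H ‖x‖ * ‖x‖⁻¹) • x) e * φ x) ⊆ V := by
    intro x hx
    have h1 : x ≠ 0 := by rintro rfl; simp at hx
    have h2 : φ x ≠ 0 := right_ne_zero_of_mul hx
    have h3 := hR (subset_tsupport _ h2)
    exact ⟨norm_pos_iff.2 h1, by simpa using h3⟩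
  have hbound : ∀ x : E d, ‖inner ℝ ((H ‖x‖ * ‖x‖⁻¹) • x) e * φ x‖ ≤ |H ‖x‖| * (‖e‖ * C) := by
    intro x
    rw [norm_mul, ← mul_assoc]
    gcongr
    · exact (norm_inner_le_norm _ _).trans (by gcongr; exact norm_radial_smul_le _ _)
    · exact hC x
  have hHV : IntegrableOn (fun x : E d => H ‖x‖) V :=
    integrableOn_comp_norm hd hUm hU0 (fun r hr => hr.2) hH.integrableOn
  have hHV' : IntegrableOn (fun x : E d => |H ‖x‖| * (‖e‖ * C)) V := hHV.abs.mul_const _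
  have hint : IntegrableOn (fun x : E d => inner ℝ ((H ‖x‖ * ‖x‖⁻¹) • x) e * φ x) V := by
    refine hHV'.mono' ?_ (.of_forall hbound)
    have : AEStronglyMeasurable (fun x : E d => ‖x‖⁻¹) (volume.restrict V) :=
      (measurable_norm.inv).aestronglyMeasurable
    exact (((hHV.1.mul this).smul aestronglyMeasurable_id).inner
      aestronglyMeasurable_const).mul hφ.aestronglyMeasurable
  refine ⟨(integrableOn_iff_integrable_of_support_subset hsupp).1 hint, ?_⟩
  rw [← setIntegral_eq_integral_of_forall_compl_eq_zero (s := V)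
    (fun x hx => Function.notMem_support.1 fun h => hx (hsupp h))]
  have hlin : ∫ x in V, |H ‖x‖| ≤ (sphereArea d).toReal * |R| ^ (d - 1) * ∫ r, |H r| := by
    rw [integral_eq_lintegral_of_nonneg_ae (.of_forall fun _ => abs_nonneg _) hHV.abs.1,
      integral_eq_lintegral_of_nonneg_ae (.of_forall fun _ => abs_nonneg _) hH.abs.1]
    have h1 := setLIntegral_comp_norm hd hUm hU0 (f := fun r => ENNReal.ofReal |H r|)
      (hH.abs.1.aemeasurable.ennreal_ofReal.restrict)
    have hfin : ∫⁻ r, ENNReal.ofReal |H r| ≠ ⊤ := by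
      have := hH.2
      rw [hasFiniteIntegral_iff_norm] at this
      exact this.ne
    have h2 : ∫⁻ x in V, ENNReal.ofReal |H ‖x‖|
        ≤ sphereArea d * (ENNReal.ofReal (|R| ^ (d - 1)) * ∫⁻ r, ENNReal.ofReal |H r|) := by
      rw [h1]
      gcongr
      rw [← lintegral_const_mul' _ _ ENNReal.ofReal_ne_top]
      calc ∫⁻ r in U, ENNReal.ofReal (r ^ (d - 1)) * ENNReal.ofReal |H r|
          ≤ ∫⁻ r in U, ENNReal.ofReal (|R| ^ (d - 1)) * ENNReal.ofReal |H r| := by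
            refine setLIntegral_mono' hUm fun r hr => ?_
            have h3 : 0 ≤ r := hr.1.le
            have h4 : r ≤ |R| := hr.2.trans (le_abs_self R)
            gcongr
        _ ≤ _ := setLIntegral_le_lintegral _ _
    have h3 := ENNReal.toReal_mono (ENNReal.mul_ne_top (sphereArea_ne_top d)
      (ENNReal.mul_ne_top ENNReal.ofReal_ne_top hfin)) h2
    rw [ENNReal.toReal_mul, ENNReal.toReal_mul, ENNReal.toReal_ofReal (by positivity),
      ← mul_assoc] at h3
    exact h3
  calc |∫ x in V, inner ℝ ((H ‖x‖ * ‖x‖⁻¹) • x) e * φ x|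
      ≤ ∫ x in V, ‖inner ℝ ((H ‖x‖ * ‖x‖⁻¹) • x) e * φ x‖ := by
        rw [← Real.norm_eq_abs]; exact norm_integral_le_integral_norm _
    _ ≤ ∫ x in V, |H ‖x‖| * (‖e‖ * C) := integral_mono hint.norm hHV' hbound
    _ = (∫ x in V, |H ‖x‖|) * (‖e‖ * C) := integral_mul_const _ _
    _ ≤ ((sphereArea d).toReal * |R| ^ (d - 1) * ∫ r, |H r|) * (‖e‖ * C) := by gcongr
    _ = _ := by ring

lemma integral_radial_primitive_of_continuous {d : ℕ} (hd : 1 ≤ d) {G : ℝ → ℝ}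
    (hG : Continuous G) (hGi : Integrable G) {c : ℝ} (hc : 0 < c) (hG0 : ∀ r < c, G r = 0) (c₀ : ℝ)
    {φ : E d → ℝ} (hφ : ContDiff ℝ 1 φ) (hφc : HasCompactSupport φ) (e : E d) :
    ∫ x, (c₀ + ∫ r in (0 : ℝ)..‖x‖, G r) * fderiv ℝ φ x e
      = -∫ x, inner ℝ ((G ‖x‖ * ‖x‖⁻¹) • x) e * φ x := by
  set P : ℝ → ℝ := fun t => c₀ + ∫ r in (0 : ℝ)..t, G r with hP
  have hPd : ∀ t, HasDerivAt P (G t) t := fun t =>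
    ((hG.integral_hasStrictDerivAt 0 t).hasDerivAt).const_add _
  have hPder : deriv P = G := funext fun t => (hPd t).deriv
  have hPdiff : Differentiable ℝ P := fun t => (hPd t).differentiableAt
  have hP1 : ContDiff ℝ 1 P := contDiff_one_iff_deriv.2 ⟨hPdiff, by rwa [hPder]⟩
  have h0 : ∀ r < c, deriv P r = 0 := by rwa [hPder]
  have hPE : ContDiff ℝ 1 (fun x : E d => P ‖x‖) := contDiff_comp_norm hP1 hc h0
  have hfd : ∀ x : E d, fderiv ℝ (fun x : E d => P ‖x‖) x e
      = inner ℝ ((G ‖x‖ * ‖x‖⁻¹) • x) e := by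
    intro x
    rw [fderiv_comp_norm hPdiff hc h0, hPder, real_inner_smul_left]
    simp
  obtain ⟨M, hM⟩ := integrable_radial_mul hd hφ.continuous hφc e
  have hφ' : Continuous (fun x => fderiv ℝ φ x e) :=
    (hφ.continuous_fderiv one_ne_zero).clm_apply continuous_const
  have hφ'c : HasCompactSupport (fun x => fderiv ℝ φ x e) := hφc.fderiv_apply ℝ e
  have key := integral_mul_fderiv_eq_neg_fderiv_mul_of_integrable (μ := (volume : Measure (E d)))
    (f := fun x : E d => P ‖x‖) (g := φ) (v := e) ?_ ?_ ?_
    (fun x _ => hPE.differentiable one_ne_zero x) (fun x _ => hφ.differentiable one_ne_zero x)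
  · simp only [hfd] at key
    exact key
  · simp only [hfd]
    exact (hM G hGi).1
  · exact (hPE.continuous.mul hφ').integrable_of_hasCompactSupport hφ'c.mul_left
  · exact (hPE.continuous.mul hφ.continuous).integrable_of_hasCompactSupport hφc.mul_left

/-- By linearity and density. The difference of the two sides is linear in G (with c₀ cancelling),
bounded by the L^1 norm of G, and zero for continuous G vanishing near 0. Multiplying the continuous
approximants by a cut-off equal to 1 on [s,t] makes them vanish near 0 and does not increase the L^1
error. -/
lemma integral_radial_primitive {d : ℕ} (hd : 1 ≤ d) {G : ℝ → ℝ} (hGi : Integrable G)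
    {s t : ℝ} (hs : 0 < s) (hG0 : ∀ r, r ∉ Icc s t → G r = 0) (c₀ : ℝ)
    {φ : E d → ℝ} (hφ : ContDiff ℝ 1 φ) (hφc : HasCompactSupport φ) (e : E d) :
    ∫ x, (c₀ + ∫ r in (0 : ℝ)..‖x‖, G r) * fderiv ℝ φ x e
      = -∫ x, inner ℝ ((G ‖x‖ * ‖x‖⁻¹) • x) e * φ x := by
  obtain ⟨M, hM⟩ := integrable_radial_mul hd hφ.continuous hφc e
  have hφ' : Continuous (fun x => fderiv ℝ φ x e) :=
    (hφ.continuous_fderiv one_ne_zero).clm_apply continuous_const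
  have hφ'c : HasCompactSupport (fun x => fderiv ℝ φ x e) := hφc.fderiv_apply ℝ e
  have hφ'i : Integrable (fun x => fderiv ℝ φ x e) := hφ'.integrable_of_hasCompactSupport hφ'c
  have hPi : ∀ H : ℝ → ℝ, Integrable H → ∀ c₀ : ℝ,
      Integrable (fun x : E d => (c₀ + ∫ r in (0 : ℝ)..‖x‖, H r) * fderiv ℝ φ x e) :=
    fun H hH c₀ => ((continuous_const.add (continuous_primitive_comp_norm hH)).mul
      hφ').integrable_of_hasCompactSupport hφ'c.mul_left
  obtain ⟨χ, hχ, hχc, hχU, hχ1, hχ01⟩ := exists_smooth_cutoff (isCompact_Icc : IsCompact (Icc s t))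
    (isOpen_Ioo : IsOpen (Ioo (s / 2) (t + 1)))
    (fun r hr => ⟨by linarith [hr.1], by linarith [hr.2]⟩)
  set A : ℝ := (∫ x, (c₀ + ∫ r in (0 : ℝ)..‖x‖, G r) * fderiv ℝ φ x e)
      + ∫ x, inner ℝ ((G ‖x‖ * ‖x‖⁻¹) • x) e * φ x with hA
  suffices hA0 : A = 0 by linarith
  set N : ℝ := ∫ x, |fderiv ℝ φ x e| with hN
  have hN0 : 0 ≤ N := integral_nonneg fun _ => abs_nonneg _
  have hle : ∀ ε > 0, |A| ≤ (N + |M|) * ε := by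
    intro ε hε
    obtain ⟨k, -, hkε, hkc, hki⟩ := hGi.exists_hasCompactSupport_integral_sub_le hε
    have hχk : Continuous (fun r => χ r * k r) := hχ.continuous.mul hkc
    have hχki : Integrable (fun r => χ r * k r) := by
      refine hki.bdd_mul (c := 1) hχ.continuous.aestronglyMeasurable (.of_forall fun r => ?_)
      rw [Real.norm_eq_abs, abs_le]
      exact ⟨by linarith [(hχ01 r).1], (hχ01 r).2⟩
    have hz : ∀ r < s / 2, χ r * k r = 0 := fun r hr => by
      rw [image_eq_zero_of_notMem_tsupport fun h => absurd (hχU h).1 (not_lt.2 hr.le), zero_mul]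
    have hχG : ∀ r, χ r * G r = G r := by
      intro r
      by_cases hr : r ∈ Icc s t
      · have : χ r = 1 := (hχ1.self_of_nhdsSet) r hr
        rw [this, one_mul]
      · rw [hG0 r hr, mul_zero]
    have hHi : Integrable (fun r => G r - χ r * k r) := hGi.sub hχki
    have hHε : ∫ r, |G r - χ r * k r| ≤ ε := by
      refine (integral_mono hHi.abs (hGi.sub hki).norm fun r => ?_).trans hkε
      show |G r - χ r * k r| ≤ |G r - k r|
      rw [← hχG r, ← mul_sub, abs_mul, abs_of_nonneg (hχ01 r).1]
      rw [hχG r]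
      exact mul_le_of_le_one_left (abs_nonneg _) (hχ01 r).2
    have e0 := integral_radial_primitive_of_continuous hd hχk hχki (half_pos hs) hz c₀ hφ hφc e
    -- The defect of the continuous approximant is zero, so the defect of G is that of the small
    -- difference.
    have e1 : A = (∫ x, (0 + ∫ r in (0 : ℝ)..‖x‖, (G r - χ r * k r)) * fderiv ℝ φ x e)
        + ∫ x, inner ℝ (((G ‖x‖ - χ ‖x‖ * k ‖x‖) * ‖x‖⁻¹) • x) e * φ x := by
      have e2 : ∫ x : E d, inner ℝ (((G ‖x‖ - χ ‖x‖ * k ‖x‖) * ‖x‖⁻¹) • x) e * φ x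
          = (∫ x, inner ℝ ((G ‖x‖ * ‖x‖⁻¹) • x) e * φ x)
            - ∫ x, inner ℝ ((χ ‖x‖ * k ‖x‖ * ‖x‖⁻¹) • x) e * φ x := by
        rw [← integral_sub (hM _ hGi).1 (hM _ hχki).1]
        congr 1; ext x
        simp only [real_inner_smul_left]; ring
      have e3 : ∫ x, (0 + ∫ r in (0 : ℝ)..‖x‖, (G r - χ r * k r)) * fderiv ℝ φ x e
          = (∫ x, (c₀ + ∫ r in (0 : ℝ)..‖x‖, G r) * fderiv ℝ φ x e)
            - ∫ x, (c₀ + ∫ r in (0 : ℝ)..‖x‖, χ r * k r) * fderiv ℝ φ x e := by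
        rw [← integral_sub (hPi _ hGi c₀) (hPi _ hχki c₀)]
        congr 1; ext x
        rw [intervalIntegral.integral_sub hGi.intervalIntegrable hχki.intervalIntegrable]
        ring
      rw [e2, e3, e0, hA]; ring
    have b1 : |∫ x, (0 + ∫ r in (0 : ℝ)..‖x‖, (G r - χ r * k r)) * fderiv ℝ φ x e| ≤ N * ε := by
      calc |∫ x, (0 + ∫ r in (0 : ℝ)..‖x‖, (G r - χ r * k r)) * fderiv ℝ φ x e|
          ≤ ∫ x, ‖(0 + ∫ r in (0 : ℝ)..‖x‖, (G r - χ r * k r)) * fderiv ℝ φ x e‖ := by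
            rw [← Real.norm_eq_abs]; exact norm_integral_le_integral_norm _
        _ ≤ ∫ x, ε * |fderiv ℝ φ x e| := by
            refine integral_mono (hPi _ hHi 0).norm (hφ'i.abs.const_mul _) fun x => ?_
            show ‖_‖ ≤ _
            rw [norm_mul, zero_add]
            exact mul_le_mul_of_nonneg_right ((norm_primitive_le hHi _ _).trans hHε) (norm_nonneg _)
        _ = N * ε := by rw [integral_const_mul, mul_comm]
    have b2 : |∫ x : E d, inner ℝ (((G ‖x‖ - χ ‖x‖ * k ‖x‖) * ‖x‖⁻¹) • x) e * φ x| ≤ |M| * ε := by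
      refine ((hM _ hHi).2).trans ?_
      have hnn : 0 ≤ ∫ r, |G r - χ r * k r| := integral_nonneg fun _ => abs_nonneg _
      exact mul_le_mul (le_abs_self M) hHε hnn (abs_nonneg M)
    rw [e1]
    refine (abs_add_le _ _).trans ?_
    linarith
  have hlim : Tendsto (fun ε : ℝ => (N + |M|) * ε) (𝓝[>] 0) (𝓝 0) := by
    have : Tendsto (fun ε : ℝ => (N + |M|) * ε) (𝓝 0) (𝓝 ((N + |M|) * 0)) :=
      tendsto_id.const_mul _
    rw [mul_zero] at this
    exact this.mono_left nhdsWithin_le_nhds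
  have : |A| ≤ 0 := ge_of_tendsto hlim (eventually_nhdsWithin_of_forall fun ε hε => hle ε hε)
  exact abs_eq_zero.1 (le_antisymm this (abs_nonneg _))

/-- If `v` is weakly differentiable, so is the radial function `x ↦ v(|x|)`. -/
lemma HasWeakDerivative.hasWeakGradient {d : ℕ} (hd : 1 ≤ d) {U : Set ℝ} (hU : IsOpen U)
    (hU0 : U ⊆ Ioi 0) {v g : ℝ → ℝ} (h : HasWeakDerivative U v g) :
    HasWeakGradient {x : E d | ‖x‖ ∈ U} (fun x => v ‖x‖) (fun x => (g ‖x‖ * ‖x‖⁻¹) • x) := by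
  have hV : IsOpen {x : E d | ‖x‖ ∈ U} := hU.preimage continuous_norm
  refine ⟨locallyIntegrableOn_comp_norm hd hU hU0 h.1, ?_, fun φ hφ hφc hφV e => ?_⟩
  · have h1 := locallyIntegrableOn_comp_norm hd hU hU0 h.2
    have h2 : ContinuousOn (fun x : E d => ‖x‖⁻¹ • x) {x : E d | ‖x‖ ∈ U} := by
      refine ContinuousOn.smul (continuous_norm.continuousOn.inv₀ fun x hx => ?_) continuousOn_id
      exact (hU0 hx).ne'
    have h3 := LocallyIntegrableOn.smul_continuousOn hV.isLocallyClosed h1 h2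
    simpa only [smul_smul] using h3
  · set K : Set ℝ := (fun x : E d => ‖x‖) '' tsupport φ with hKdef
    have hK : IsCompact K := IsCompact.image hφc continuous_norm
    have hKU : K ⊆ U := by rintro _ ⟨x, hx, rfl⟩; exact hφV hx
    -- Since χ = 1 near the radii met by the support of φ, v may be replaced by vχ. This product has
    -- an integrable weak derivative on the whole line, supported in a compact part of (0,∞), so it
    -- is a primitive almost everywhere.
    obtain ⟨χ, hχ, hχc, hχU, hχ1, -⟩ := exists_smooth_cutoff hK hU hKU
    have hcut := h.cutoff hχ hχc hχU
    obtain ⟨c₀, hc₀⟩ := hcut.exists_ae_eq_primitive isOpen_univ ordConnected_univ (mem_univ 0)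
    obtain ⟨s, t, hs1, ht1, hst, hst0⟩ := exists_Icc_of_isCompact_subset hχc isOpen_Ioi
      ordConnected_Ioi (mem_Ioi.2 one_pos) (hχU.trans hU0)
    have hd' : Continuous (deriv χ) := hχ.continuous_deriv (by simp)
    have hGi : Integrable (fun r => v r * deriv χ r + g r * χ r) :=
      (integrable_mul_of_tsupport_subset h.1 hd' hχc.deriv
        (tsupport_deriv_subset.trans hχU)).add
      (integrable_mul_of_tsupport_subset h.2 hχ.continuous hχc hχU)
    have hG0 : ∀ r, r ∉ Icc s t → v r * deriv χ r + g r * χ r = 0 := by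
      intro r hr
      have hr' : r ∉ tsupport χ := fun hm => hr (Ioo_subset_Icc_self (hst hm))
      rw [image_eq_zero_of_notMem_tsupport hr', image_eq_zero_of_notMem_tsupport
        (fun hm => hr' (tsupport_deriv_subset hm))]
      ring
    have key := integral_radial_primitive hd hGi
      (mem_Ioi.1 (hst0 (left_mem_Icc.2 (hs1.trans ht1).le))) hG0 c₀ (hφ.of_le (by simp)) hφc e
    have e1 : ∫ x, v ‖x‖ * fderiv ℝ φ x e
        = ∫ x, (c₀ + ∫ r in (0 : ℝ)..‖x‖, (v r * deriv χ r + g r * χ r)) * fderiv ℝ φ x e := by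
      refine integral_congr_ae ?_
      have hae : ∀ᵐ r ∂volume.restrict (Ioi (0 : ℝ)),
          v r * χ r = c₀ + ∫ x in (0 : ℝ)..r, (v x * deriv χ x + g x * χ x) := by
        refine ae_restrict_of_ae ?_
        filter_upwards [hc₀] with r hr using hr (mem_univ r)
      filter_upwards [(quasiMeasurePreserving_norm hd).ae hae] with x hx
      by_cases hxs : x ∈ tsupport φ
      · have h1 : χ ‖x‖ = 1 := (hχ1.self_of_nhdsSet) _ ⟨x, hxs, rfl⟩
        rw [← hx, h1, mul_one]
      · have : fderiv ℝ φ x = 0 := image_eq_zero_of_notMem_tsupport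
          fun hm => hxs (tsupport_fderiv_subset ℝ hm)
        simp [this]
    rw [e1, key]
    congr 2
    ext x
    by_cases hxs : x ∈ tsupport φ
    · have hev : ∀ᶠ r in 𝓝 ‖x‖, χ r = 1 := 
        hχ1.filter_mono (nhds_le_nhdsSet (mem_image_of_mem _ hxs))
      have h1 : χ ‖x‖ = 1 := hev.self_of_nhds
      have h2 : deriv χ ‖x‖ = 0 := by
        have : χ =ᶠ[𝓝 ‖x‖] fun _ => 1 := hev
        rw [this.deriv_eq, deriv_const]
      rw [h1, h2, mul_zero, zero_add, mul_one]
    · rw [image_eq_zero_of_notMem_tsupport hxs, mul_zero, mul_zero]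

/-! ### Cheap jumps where the dual weight is not summable -/

/-- If `η ^ (-1/(p-1))` is not summable on `J`, a unit jump can be made inside `J` at
arbitrarily small cost. -/
lemma exists_cheap_jump {p : ℝ} (hp : 1 < p) {η : ℝ → ℝ} {J : Set ℝ} (hJ : MeasurableSet J)
    (hJfin : volume J ≠ ⊤) (hη : AEMeasurable η (volume.restrict J))
    (hdiv : ∫⁻ s in J, ENNReal.ofReal (η s) ^ (-(1 / (p - 1))) = ⊤) {ε : ℝ≥0∞} (hε : ε ≠ 0) :
    ∃ ψ : ℝ → ℝ, Measurable ψ ∧ (∃ C, ∀ r, |ψ r| ≤ C) ∧ (∀ r, r ∉ J → ψ r = 0) ∧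
      ∫ r, ψ r = 1 ∧ ∫⁻ r in J, ‖ψ r‖ₑ ^ p * ENNReal.ofReal (η r) < ε := by
  have hp1 : 0 < p - 1 := by linarith
  set q : ℝ := 1 / (p - 1) with hq
  set m : ℝ → ℝ := hη.mk η with hm
  have hmη : η =ᵐ[volume.restrict J] m := hη.ae_eq_mk
  have hmm : Measurable m := hη.measurable_mk
  set σ : ℝ → ℝ≥0∞ := fun r => ENNReal.ofReal (m r) ^ (-q) with hσ
  have hσm : Measurable σ := hmm.ennreal_ofReal.pow_const _
  have hdiv' : ∫⁻ s in J, σ s = ⊤ := by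
    rw [← hdiv]
    refine lintegral_congr_ae ?_
    filter_upwards [hmη] with r hr
    rw [hσ, hr]
  -- Monotone convergence: the truncated integrals are finite but exceed any bound.
  have hlim : Tendsto (fun n : ℕ => ∫⁻ s in J, min (σ s) n) atTop (𝓝 ⊤) := by
    rw [← hdiv']
    refine lintegral_tendsto_of_tendsto_of_monotone (fun n => (hσm.min measurable_const).aemeasurable)
      (.of_forall fun r i j hij => by dsimp only; gcongr) (.of_forall fun r => ?_)
    have := (tendsto_const_nhds (x := σ r)).min ENNReal.tendsto_nat_nhds_top
    simpa using this
  -- The second condition is A^{p-1} > 1/ε for A = ∫ min(σ,n), since the cost of the jump will be at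
  -- most A^{1-p}. The first only serves to make A nonzero.
  obtain ⟨n, hn1, hn2⟩ : ∃ n : ℕ, 1 < ∫⁻ s in J, min (σ s) n ∧
      (ε⁻¹) ^ q < ∫⁻ s in J, min (σ s) n := by
    have h1 : (ε⁻¹) ^ q < ⊤ := ENNReal.rpow_lt_top_of_nonneg (by positivity) (by simpa using hε)
    exact ((hlim.eventually (lt_mem_nhds ENNReal.one_lt_top)).and
      (hlim.eventually (lt_mem_nhds h1))).exists
  set A : ℝ≥0∞ := ∫⁻ s in J, min (σ s) n with hA
  have hAtop : A ≠ ⊤ := by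
    refine ne_top_of_le_ne_top (b := n * volume J) (ENNReal.mul_ne_top (by simp) hJfin) ?_
    rw [hA, ← setLIntegral_const]
    exact lintegral_mono fun r => min_le_right _ _
  have hA0 : A ≠ 0 := (zero_lt_one.trans hn1).ne'
  set θ : ℝ → ℝ≥0∞ := J.indicator (fun r => min (σ r) n / A) with hθ
  have hθm : Measurable θ := ((hσm.min measurable_const).div_const _).indicator hJ
  have hθtop : ∀ r, θ r ≤ n / A := by
    intro r
    by_cases hr : r ∈ J
    · rw [hθ, indicator_of_mem hr]; gcongr; exact min_le_right _ _
    · rw [hθ, indicator_of_notMem hr]; exact zero_le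
  have hnA : (n : ℝ≥0∞) / A ≠ ⊤ := ENNReal.div_ne_top (by simp) hA0
  have hθtop' : ∀ r, θ r ≠ ⊤ := fun r => ne_top_of_le_ne_top hnA (hθtop r)
  have henorm : ∀ r, ‖(θ r).toReal‖ₑ = θ r := fun r => by
    rw [Real.enorm_of_nonneg ENNReal.toReal_nonneg, ENNReal.ofReal_toReal (hθtop' r)]
  refine ⟨fun r => (θ r).toReal, hθm.ennreal_toReal, ⟨(n / A).toReal, fun r => ?_⟩, fun r hr => ?_,
    ?_, ?_⟩
  · rw [abs_of_nonneg ENNReal.toReal_nonneg]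
    exact ENNReal.toReal_mono hnA (hθtop r)
  · show (θ r).toReal = 0
    rw [hθ, indicator_of_notMem hr, ENNReal.toReal_zero]
  · rw [integral_toReal hθm.aemeasurable (.of_forall fun r => (hθtop' r).lt_top), hθ,
      lintegral_indicator hJ]
    simp_rw [div_eq_mul_inv]
    rw [lintegral_mul_const _ (hσm.min measurable_const), ← hA, ENNReal.mul_inv_cancel hA0 hAtop,
      ENNReal.toReal_one]
  -- One factor min(σ,n) is kept and the remaining power is bounded by σ^{p-1}, the inverse of the
  -- weight. The inequality form of the cancellation covers the points where the weight is 0 and σ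
  -- is infinite.
  · have hpt : ∀ r, min (σ r) n ^ p * ENNReal.ofReal (m r) ≤ min (σ r) n := by
      intro r
      calc min (σ r) n ^ p * ENNReal.ofReal (m r)
          = min (σ r) n ^ (1 + (p - 1)) * ENNReal.ofReal (m r) := by congr 2; ring
        _ = min (σ r) n * (min (σ r) n ^ (p - 1) * ENNReal.ofReal (m r)) := by
            rw [ENNReal.rpow_add_of_nonneg _ _ zero_le_one hp1.le, ENNReal.rpow_one, mul_assoc]
        _ ≤ min (σ r) n * (σ r ^ (p - 1) * ENNReal.ofReal (m r)) := by
            gcongr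
            exact min_le_left _ _
        _ = min (σ r) n * ((ENNReal.ofReal (m r))⁻¹ * ENNReal.ofReal (m r)) := by
            congr 2
            rw [hσ, ← ENNReal.rpow_mul, hq, ← ENNReal.rpow_neg_one]
            congr 1
            field_simp
        _ ≤ min (σ r) n * 1 := by
            gcongr
            exact ENNReal.inv_mul_le_one _
        _ = _ := mul_one _
    have h1 : ∫⁻ r in J, ‖(θ r).toReal‖ₑ ^ p * ENNReal.ofReal (η r)
        ≤ ∫⁻ r in J, (A⁻¹) ^ p * min (σ r) n := by
      refine lintegral_mono_ae ?_
      filter_upwards [hmη, ae_restrict_mem hJ] with r hr hrJ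
      rw [henorm, hθ, indicator_of_mem hrJ, hr, div_eq_mul_inv,
        ENNReal.mul_rpow_of_nonneg _ _ (by linarith), mul_right_comm, mul_comm]
      gcongr
      exact hpt r
    refine h1.trans_lt ?_
    rw [lintegral_const_mul _ (hσm.min measurable_const), ← hA]
    have h2 : (A⁻¹) ^ p * A = (A ^ (p - 1))⁻¹ := by
      rw [ENNReal.inv_rpow, ← ENNReal.rpow_neg, ← ENNReal.rpow_neg]
      nth_rw 2 [← ENNReal.rpow_one A]
      rw [← ENNReal.rpow_add _ _ hA0 hAtop]
      congr 1; ring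
    rw [h2, ENNReal.inv_lt_iff_inv_lt]
    have h3 : ((ε⁻¹) ^ q) ^ (p - 1) < A ^ (p - 1) := ENNReal.rpow_lt_rpow hn2 hp1
    rwa [← ENNReal.rpow_mul, hq, one_div_mul_cancel hp1.ne', ENNReal.rpow_one] at h3

/-! ### The weighted space on the radii -/

/-- The measure `r^{d-1} η(r) dr` on `(a, b)`. -/
noncomputable def radialMeasure (d : ℕ) (a b : ℝ) (η : ℝ → ℝ) : Measure ℝ :=
  (volume.restrict (Ioo a b)).withDensity
    fun r => ENNReal.ofReal (r ^ (d - 1)) * ENNReal.ofReal (η r)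

lemma aemeasurable_restrict_of_locallyIntegrableOn {η : ℝ → ℝ}
    (hη : LocallyIntegrableOn η (Ici 0)) {U : Set ℝ} (hU : U ⊆ Ici 0) :
    AEMeasurable η (volume.restrict U) :=
  (hη.aestronglyMeasurable.mono_measure (Measure.restrict_mono hU le_rfl)).aemeasurable

lemma aemeasurable_radialDensity (d : ℕ) {η : ℝ → ℝ}
    (hη : LocallyIntegrableOn η (Ici 0)) {U : Set ℝ} (hU : U ⊆ Ici 0) :
    AEMeasurable (fun r => ENNReal.ofReal (r ^ (d - 1)) * ENNReal.ofReal (η r))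
      (volume.restrict U) :=
  (((measurable_id.pow_const (d - 1)).ennreal_ofReal).aemeasurable).mul
    (aemeasurable_restrict_of_locallyIntegrableOn hη hU).ennreal_ofReal

lemma lintegral_radialMeasure {d : ℕ} {a b : ℝ} (ha : 0 ≤ a) {η : ℝ → ℝ}
    (hη : LocallyIntegrableOn η (Ici 0)) (f : ℝ → ℝ≥0∞) :
    ∫⁻ r, f r ∂radialMeasure d a b η
      = ∫⁻ r in Ioo a b, ENNReal.ofReal (r ^ (d - 1)) * f r * ENNReal.ofReal (η r) := by
  have hU : Ioo a b ⊆ Ici 0 := fun r hr => ha.trans hr.1.le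
  rw [radialMeasure, lintegral_withDensity_eq_lintegral_mul_non_measurable₀ _
    (aemeasurable_radialDensity d hη hU)
    (.of_forall fun r => ENNReal.mul_lt_top ENNReal.ofReal_lt_top ENNReal.ofReal_lt_top)]
  refine lintegral_congr fun r => ?_
  simp only [Pi.mul_apply]
  ring

lemma isFiniteMeasure_radialMeasure (d : ℕ) {a b : ℝ} (ha : 0 ≤ a) {η : ℝ → ℝ}
    (hη : LocallyIntegrableOn η (Ici 0)) : IsFiniteMeasure (radialMeasure d a b η) := by
  refine isFiniteMeasure_withDensity ?_
  have hi : IntegrableOn η (Icc 0 b) :=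
    hη.integrableOn_compact_subset (fun r hr => hr.1) isCompact_Icc
  have h1 : ∫⁻ r in Ioo a b, ENNReal.ofReal (r ^ (d - 1)) * ENNReal.ofReal (η r)
      ≤ ∫⁻ r in Ioo a b, ENNReal.ofReal (b ^ (d - 1)) * ‖η r‖ₑ := by
    refine setLIntegral_mono' measurableSet_Ioo fun r hr => ?_
    have h2 : 0 ≤ r := ha.trans hr.1.le
    have h3 : r ≤ b := hr.2.le
    gcongr
    exact Real.ofReal_le_enorm _
  refine (h1.trans_lt ?_).ne
  rw [lintegral_const_mul' _ _ ENNReal.ofReal_ne_top]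
  refine ENNReal.mul_lt_top ENNReal.ofReal_lt_top ?_
  refine (lintegral_mono_set fun r hr => ?_).trans_lt hi.2
  exact ⟨ha.trans hr.1.le, hr.2.le⟩

lemma eLpNorm_ofReal {X F : Type*} [MeasurableSpace X] [NormedAddCommGroup F] {p : ℝ} (hp : 1 < p)
    (μ : Measure X) (f : X → F) :
    eLpNorm f (ENNReal.ofReal p) μ = (∫⁻ x, ‖f x‖ₑ ^ p ∂μ) ^ (1 / p) := by
  have hp0 : 0 < p := by linarith
  rw [eLpNorm_eq_lintegral_rpow_enorm_toReal (by simpa using hp0) ENNReal.ofReal_ne_top,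
    ENNReal.toReal_ofReal hp0.le]

lemma eLpNorm_ofReal_rpow {X F : Type*} [MeasurableSpace X] [NormedAddCommGroup F] {p : ℝ}
    (hp : 1 < p) (μ : Measure X) (f : X → F) :
    eLpNorm f (ENNReal.ofReal p) μ ^ p = ∫⁻ x, ‖f x‖ₑ ^ p ∂μ := by
  rw [eLpNorm_ofReal hp, ← ENNReal.rpow_mul, one_div_mul_cancel (by linarith), ENNReal.rpow_one]

/-! ### Bounded functions supported away from the end points -/

/-- Bounded measurable functions which vanish outside a compact subinterval of `(a, b)`. -/
structure IsBoundedSupported (a b : ℝ) (h : ℝ → ℝ) : Prop where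
  measurable : Measurable h
  bound : ∃ C, ∀ r, |h r| ≤ C
  supp : ∃ s t, a < s ∧ s < t ∧ t < b ∧ ∀ r, r ∉ Icc s t → h r = 0

namespace IsBoundedSupported

variable {a b : ℝ} {h k : ℝ → ℝ}

lemma zero (hab : a < b) : IsBoundedSupported a b 0 :=
  ⟨measurable_zero, ⟨0, by simp⟩, ⟨(2 * a + b) / 3, (a + 2 * b) / 3, by linarith, by linarith,
    by linarith, by simp⟩⟩

lemma add (hh : IsBoundedSupported a b h) (hk : IsBoundedSupported a b k) :
    IsBoundedSupported a b (h + k) := by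
  obtain ⟨hm, ⟨C, hC⟩, s, t, has, hst, htb, h0⟩ := hh
  obtain ⟨km, ⟨D, hD⟩, s', t', has', hst', htb', k0⟩ := hk
  refine ⟨hm.add km, ⟨C + D, fun r => (abs_add_le _ _).trans (add_le_add (hC r) (hD r))⟩,
    min s s', max t t', lt_min has has', ?_, max_lt htb htb', fun r hr => ?_⟩
  · exact (min_le_left _ _).trans_lt (hst.trans_le (le_max_left _ _))
  · rw [Pi.add_apply, h0 r, k0 r, add_zero]
    · exact fun hr' => hr ⟨(min_le_right _ _).trans hr'.1, hr'.2.trans (le_max_right _ _)⟩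
    · exact fun hr' => hr ⟨(min_le_left _ _).trans hr'.1, hr'.2.trans (le_max_left _ _)⟩

lemma const_smul (hh : IsBoundedSupported a b h) (c : ℝ) : IsBoundedSupported a b (c • h) := by
  obtain ⟨hm, ⟨C, hC⟩, s, t, has, hst, htb, h0⟩ := hh
  refine ⟨hm.const_smul c, ⟨|c| * C, fun r => ?_⟩, s, t, has, hst, htb, fun r hr => ?_⟩
  · rw [Pi.smul_apply, smul_eq_mul, abs_mul]; gcongr; exact hC r
  · rw [Pi.smul_apply, h0 r hr, smul_zero]

lemma sub (hh : IsBoundedSupported a b h) (hk : IsBoundedSupported a b k) :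
    IsBoundedSupported a b (h - k) := by
  have := hh.add (hk.const_smul (-1))
  rwa [neg_one_smul, ← sub_eq_add_neg] at this

lemma sum {ι : Type*} (hab : a < b) (S : Finset ι) {f : ι → ℝ → ℝ}
    (hf : ∀ i ∈ S, IsBoundedSupported a b (f i)) : IsBoundedSupported a b (∑ i ∈ S, f i) := by
  classical
  induction S using Finset.induction_on with
  | empty => simpa using zero hab
  | insert i S hi ih =>
    rw [Finset.sum_insert hi]
    exact (hf i (Finset.mem_insert_self _ _)).add
      (ih fun j hj => hf j (Finset.mem_insert_of_mem hj))

lemma integrable (hh : IsBoundedSupported a b h) : Integrable h := by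
  obtain ⟨hm, ⟨C, hC⟩, s, t, has, hst, htb, h0⟩ := hh
  have : IntegrableOn h (Icc s t) :=
    Measure.integrableOn_of_bounded (M := C) measure_Icc_lt_top.ne hm.aestronglyMeasurable
      (.of_forall hC)
  rwa [integrableOn_iff_integrable_of_support_subset] at this
  intro r hr
  by_contra hn
  exact hr (h0 r hn)

lemma memLp (hh : IsBoundedSupported a b h) (q : ℝ≥0∞) (μ : Measure ℝ) [IsFiniteMeasure μ] :
    MemLp h q μ := by
  obtain ⟨hm, ⟨C, hC⟩, -⟩ := hh
  exact MemLp.of_bound hm.aestronglyMeasurable C (.of_forall hC)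

end IsBoundedSupported

/-! ### Cheap steps at degenerate radii -/

section Approximation

variable {d : ℕ} {p a b : ℝ} {η : ℝ → ℝ}

lemma setLIntegral_dual_eq_top_of_notMem_goodRadii {r : ℝ} (hr : r ∈ Ioo a b)
    (hbad : r ∉ goodRadii p a b η) {ε : ℝ} (hε : 0 < ε) :
    ∫⁻ s in Ioo (r - ε) (r + ε), ENNReal.ofReal (η s) ^ (-(1 / (p - 1))) = ⊤ := by
  by_contra h
  exact hbad ⟨hr, ε, hε, lt_top_iff_ne_top.2 h⟩

/-- A cheap jump from `0` to `1` at a radius where the weight is degenerate. -/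
lemma exists_cheap_step (hp : 1 < p) (ha : 0 ≤ a) (hab : a < b)
    (hη : LocallyIntegrableOn η (Ici 0)) {r₀ : ℝ} (hr₀ : r₀ ∈ Icc a b)
    (hbad : r₀ ∉ goodRadii p a b η) {F : Set ℝ} (hF : F.Finite)
    (hFm : ∀ m ∈ F, m ∈ Ioo a b ∧ m ≠ r₀) {ε : ℝ≥0∞} (hε : ε ≠ 0) :
    ∃ (h : ℝ → ℝ) (c : ℝ), IsBoundedSupported a b h ∧
      (∀ m ∈ F, c + ∫ x in a..m, h x = if r₀ < m then 1 else 0) ∧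
      eLpNorm h (ENNReal.ofReal p) (radialMeasure d a b η) ≤ ε := by
  -- At the end radii a and b no jump is needed: all points of F lie on the same side, and the
  -- constant 1, respectively 0, will do.
  rcases eq_or_lt_of_le hr₀.1 with rfl | har
  · refine ⟨0, 1, .zero hab, fun m hm => ?_, by simp⟩
    simp [(hFm m hm).1.1]
  rcases eq_or_lt_of_le hr₀.2 with rfl | hrb
  · refine ⟨0, 0, .zero hab, fun m hm => ?_, by simp⟩
    simp [not_lt.2 (hFm m hm).1.2.le]
  have hopen : IsOpen (Ioo a b ∩ Fᶜ) := isOpen_Ioo.inter hF.isClosed.isOpen_compl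
  have hmem : r₀ ∈ Ioo a b ∩ Fᶜ := ⟨⟨har, hrb⟩, fun h => (hFm r₀ h).2 rfl⟩
  -- No point of F is within δ of r₀, so a jump supported within δ/2 is complete or not yet begun at
  -- each of them.
  obtain ⟨δ, hδ, hball⟩ := Metric.isOpen_iff.1 hopen r₀ hmem
  have hsub : ∀ r, r₀ - δ < r → r < r₀ + δ → r ∈ Ioo a b ∩ Fᶜ := fun r h1 h2 =>
    hball (by rw [Metric.mem_ball, Real.dist_eq, abs_lt]; constructor <;> linarith)
  set J : Set ℝ := Ioo (r₀ - δ / 2) (r₀ + δ / 2) with hJ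
  have hJab : J ⊆ Ioo a b := fun r hr => (hsub r (by linarith [hr.1]) (by linarith [hr.2])).1
  have hJ0 : J ⊆ Ici 0 := fun r hr => ha.trans (hJab hr).1.le
  have hB : ENNReal.ofReal (b ^ (d - 1)) + 1 ≠ ⊤ := by simp
  -- The divisor absorbs the bound r^{d-1} ≤ b^{d-1}; adding 1 spares the question whether it
  -- vanishes.
  have hε' : ε ^ p / (ENNReal.ofReal (b ^ (d - 1)) + 1) ≠ 0 := by
    refine ENNReal.div_ne_zero.2 ⟨?_, hB⟩
    rw [Ne, ENNReal.rpow_eq_zero_iff]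
    rintro (⟨h, -⟩ | ⟨-, h⟩)
    · exact hε h
    · linarith
  obtain ⟨ψ, hψm, hψb, hψ0, hψ1, hψε⟩ := exists_cheap_jump hp measurableSet_Ioo
    measure_Ioo_lt_top.ne (aemeasurable_restrict_of_locallyIntegrableOn hη hJ0)
    (setLIntegral_dual_eq_top_of_notMem_goodRadii ⟨har, hrb⟩ hbad (half_pos hδ)) hε'
  refine ⟨ψ, 0, ⟨hψm, hψb, r₀ - δ / 2, r₀ + δ / 2, ?_, by linarith, ?_, fun r hr => ?_⟩,
    fun m hm => ?_, ?_⟩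
  · exact (hsub (r₀ - δ / 2) (by linarith) (by linarith)).1.1
  · exact (hsub (r₀ + δ / 2) (by linarith) (by linarith)).1.2
  · exact hψ0 r fun h => hr (Ioo_subset_Icc_self h)
  · rw [zero_add]
    have hm' : m ≤ r₀ - δ ∨ r₀ + δ ≤ m := by
      by_contra! hn
      exact (hsub m hn.1 hn.2).2 hm
    rcases hm' with hm' | hm'
    · rw [if_neg (by linarith), intervalIntegral.integral_congr (g := fun _ => 0)]
      · simp
      · intro r hr
        rw [uIcc_of_le (hFm m hm).1.1.le] at hr
        refine hψ0 r fun h => ?_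
        have := h.1
        linarith [hr.2]
    · rw [if_pos (by linarith), intervalIntegral.integral_eq_integral_of_support_subset, hψ1]
      intro r hr
      have hrJ : r ∈ J := by
        by_contra hn
        exact hr (hψ0 r hn)
      exact ⟨(hJab hrJ).1, by linarith [hrJ.2]⟩
  · have hp0 : 0 < p := by linarith
    rw [← ENNReal.rpow_le_rpow_iff hp0, eLpNorm_ofReal_rpow hp, lintegral_radialMeasure ha hη]
    have h1 : ∫⁻ r in Ioo a b, ENNReal.ofReal (r ^ (d - 1)) * ‖ψ r‖ₑ ^ p * ENNReal.ofReal (η r)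
        ≤ ∫⁻ r in Ioo a b, J.indicator
          (fun r => ENNReal.ofReal (b ^ (d - 1)) * (‖ψ r‖ₑ ^ p * ENNReal.ofReal (η r))) r := by
      refine setLIntegral_mono' measurableSet_Ioo fun r hr => ?_
      by_cases hrJ : r ∈ J
      · rw [indicator_of_mem hrJ, ← mul_assoc]
        have h2 : 0 ≤ r := ha.trans hr.1.le
        have h3 : r ≤ b := hr.2.le
        gcongr
      · rw [indicator_of_notMem hrJ, hψ0 r hrJ]
        simp [hp0]
    refine h1.trans ?_
    rw [lintegral_indicator measurableSet_Ioo, Measure.restrict_restrict measurableSet_Ioo,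
      inter_eq_left.2 hJab, lintegral_const_mul' _ _ ENNReal.ofReal_ne_top]
    calc ENNReal.ofReal (b ^ (d - 1)) * ∫⁻ r in J, ‖ψ r‖ₑ ^ p * ENNReal.ofReal (η r)
        ≤ (ENNReal.ofReal (b ^ (d - 1)) + 1) * (ε ^ p / (ENNReal.ofReal (b ^ (d - 1)) + 1)) := by
          gcongr
          exact le_self_add
      _ ≤ ε ^ p := ENNReal.mul_div_le

lemma goodRadii_subset : goodRadii p a b η ⊆ Ioo a b := fun _ hr => hr.1

lemma isOpen_goodRadii {N : ℕ} {α β : Fin N → ℝ}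
    (hI : IsIntervalDecomposition (goodRadii p a b η) α β) : IsOpen (goodRadii p a b η) := by
  rw [hI.union]
  exact isOpen_iUnion fun _ => isOpen_Ioo

/-! ### Components of the set of good radii -/

section Decomposition

variable {N : ℕ} {α β : Fin N → ℝ} {I : Set ℝ}

lemma IsIntervalDecomposition.Ioo_subset (hI : IsIntervalDecomposition I α β) (i : Fin N) :
    Ioo (α i) (β i) ⊆ I := by
  rw [hI.union]; exact subset_iUnion (fun i => Ioo (α i) (β i)) i

/-- If α i were inside another component, the two components would overlap just to the right of α i.
This is what makes jumps at the end points cheap. -/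
lemma IsIntervalDecomposition.left_notMem (hI : IsIntervalDecomposition I α β) (i : Fin N) :
    α i ∉ I := by
  rw [hI.union, mem_iUnion]
  rintro ⟨j, hj⟩
  have hij : i ≠ j := by rintro rfl; exact lt_irrefl _ hj.1
  have hx : (α i + min (β i) (β j)) / 2 ∈ Ioo (α i) (β i) := by
    have h1 := hI.lt i
    have h2 := min_le_left (β i) (β j)
    have h3 : α i < min (β i) (β j) := lt_min h1 hj.2
    constructor <;> linarith
  have hx' : (α i + min (β i) (β j)) / 2 ∈ Ioo (α j) (β j) := by
    have h2 := min_le_right (β i) (β j)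
    have h3 : α i < min (β i) (β j) := lt_min (hI.lt i) hj.2
    have h4 := hj.1
    constructor <;> linarith
  exact disjoint_left.1 (hI.disjoint i j hij) hx hx'

lemma IsIntervalDecomposition.right_notMem (hI : IsIntervalDecomposition I α β) (i : Fin N) :
    β i ∉ I := by
  rw [hI.union, mem_iUnion]
  rintro ⟨j, hj⟩
  have hij : i ≠ j := by rintro rfl; exact lt_irrefl _ hj.2
  have hx : (max (α i) (α j) + β i) / 2 ∈ Ioo (α i) (β i) := by
    have h2 := le_max_left (α i) (α j)
    have h3 : max (α i) (α j) < β i := max_lt (hI.lt i) hj.1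
    constructor <;> linarith
  have hx' : (max (α i) (α j) + β i) / 2 ∈ Ioo (α j) (β j) := by
    have h2 := le_max_right (α i) (α j)
    have h3 : max (α i) (α j) < β i := max_lt (hI.lt i) hj.1
    have h4 := hj.2
    constructor <;> linarith
  exact disjoint_left.1 (hI.disjoint i j hij) hx hx'

lemma IsIntervalDecomposition.mid_mem (hI : IsIntervalDecomposition I α β) (i : Fin N) :
    (α i + β i) / 2 ∈ Ioo (α i) (β i) := by
  have := hI.lt i
  constructor <;> linarith

lemma IsIntervalDecomposition.bounds (hI : IsIntervalDecomposition I α β) {a b : ℝ}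
    (h : I ⊆ Ioo a b) (i : Fin N) : a ≤ α i ∧ β i ≤ b := by
  have h1 : Icc (α i) (β i) ⊆ Icc a b := by
    rw [← closure_Ioo (hI.lt i).ne]
    exact closure_minimal (((hI.Ioo_subset i).trans h).trans Ioo_subset_Icc_self) isClosed_Icc
  exact ⟨(h1 (left_mem_Icc.2 (hI.lt i).le)).1, (h1 (right_mem_Icc.2 (hI.lt i).le)).2⟩

end Decomposition

/-! ### Approximation of derivatives with prescribed values at the midpoints -/

variable {N : ℕ} {α β : Fin N → ℝ}

/-- Cheap functions equal to `1` at the middle of one component of `I_p` and to `0` at the middle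
of the others. -/
lemma exists_cheap_bump (hp : 1 < p) (ha : 0 ≤ a) (hab : a < b)
    (hη : LocallyIntegrableOn η (Ici 0)) (hI : IsIntervalDecomposition (goodRadii p a b η) α β)
    (i : Fin N) {ε : ℝ≥0∞} (hε : ε ≠ 0) :
    ∃ (h : ℝ → ℝ) (c : ℝ), IsBoundedSupported a b h ∧
      (∀ j, c + ∫ x in a..(α j + β j) / 2, h x = if j = i then 1 else 0) ∧
      eLpNorm h (ENNReal.ofReal p) (radialMeasure d a b η) ≤ ε := by
  have hbd := hI.bounds goodRadii_subset i
  have hlt := hI.lt i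
  have hfin : (range fun j => (α j + β j) / 2).Finite := finite_range _
  have hmid : ∀ j, (α j + β j) / 2 ∈ goodRadii p a b η := fun j =>
    hI.Ioo_subset j (hI.mid_mem j)
  have hε2 : ε / 2 ≠ 0 := by simpa using hε
  obtain ⟨h₁, c₁, hb₁, hv₁, hε₁⟩ := exists_cheap_step (d := d) hp ha hab hη
    (r₀ := α i) ⟨hbd.1, hlt.le.trans hbd.2⟩ (hI.left_notMem i) hfin
    (by rintro _ ⟨j, rfl⟩
        exact ⟨(hmid j).1, fun h => hI.left_notMem i (h ▸ hmid j)⟩) hε2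
  obtain ⟨h₂, c₂, hb₂, hv₂, hε₂⟩ := exists_cheap_step (d := d) hp ha hab hη
    (r₀ := β i) ⟨hbd.1.trans hlt.le, hbd.2⟩ (hI.right_notMem i) hfin
    (by rintro _ ⟨j, rfl⟩
        exact ⟨(hmid j).1, fun h => hI.right_notMem i (h ▸ hmid j)⟩) hε2
  -- A step up at α i minus a step up at β i. A midpoint of another component cannot lie between the
  -- two, by disjointness.
  refine ⟨h₁ - h₂, c₁ - c₂, hb₁.sub hb₂, fun j => ?_, ?_⟩
  · have e1 : ∫ x in a..(α j + β j) / 2, (h₁ - h₂) x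
        = (∫ x in a..(α j + β j) / 2, h₁ x) - ∫ x in a..(α j + β j) / 2, h₂ x :=
      intervalIntegral.integral_sub hb₁.integrable.intervalIntegrable
        hb₂.integrable.intervalIntegrable
    have e2 := hv₁ _ (mem_range_self j)
    have e3 := hv₂ _ (mem_range_self j)
    have e4 : c₁ - c₂ + ∫ x in a..(α j + β j) / 2, (h₁ - h₂) x
        = (if α i < (α j + β j) / 2 then 1 else 0) - (if β i < (α j + β j) / 2 then 1 else 0) := by
      rw [e1, ← e2, ← e3]; ring
    rw [e4]
    by_cases hji : j = i
    · subst hji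
      rw [if_pos (hI.mid_mem j).1, if_neg (not_lt.2 (hI.mid_mem j).2.le), if_pos rfl, sub_zero]
    · rw [if_neg hji]
      by_cases h1 : α i < (α j + β j) / 2
      · by_cases h2 : β i < (α j + β j) / 2
        · rw [if_pos h1, if_pos h2, sub_self]
        · exfalso
          have h3 : (α j + β j) / 2 ≠ β i := fun h => hI.right_notMem i (h ▸ hmid j)
          exact disjoint_left.1 (hI.disjoint j i hji) (hI.mid_mem j)
            ⟨h1, lt_of_le_of_ne (not_lt.1 h2) h3⟩
      · rw [if_neg h1, if_neg (fun h2 => h1 (hlt.trans h2)), sub_self]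
  · refine (eLpNorm_sub_le hb₁.measurable.aestronglyMeasurable hb₂.measurable.aestronglyMeasurable
      (by simpa using hp.le)).trans ?_
    exact (add_le_add hε₁ hε₂).trans (ENNReal.add_halves ε).le

lemma radialMeasure_compl_Ioo : radialMeasure d a b η (Ioo a b)ᶜ = 0 := by
  refine (withDensity_absolutelyContinuous _ _) ?_
  rw [Measure.restrict_apply measurableSet_Ioo.compl]
  simp

/-- Compactly supported continuous functions are dense in L^p of this finite measure. Such a
function is bounded by some C, so restricting it to an interval [s,t] that carries almost all the
mass of (a,b) changes its norm by at most C times the p-th root of the lost mass. -/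
lemma exists_isBoundedSupported_eLpNorm_sub_le (hp : 1 < p) (ha : 0 ≤ a) (hab : a < b)
    (hη : LocallyIntegrableOn η (Ici 0)) {g : ℝ → ℝ}
    (hg : MemLp g (ENNReal.ofReal p) (radialMeasure d a b η)) {ε : ℝ≥0∞} (hε : ε ≠ 0) :
    ∃ h, IsBoundedSupported a b h ∧
      eLpNorm (g - h) (ENNReal.ofReal p) (radialMeasure d a b η) ≤ ε := by
  set κ := radialMeasure d a b η with hκ
  have : IsFiniteMeasure κ := isFiniteMeasure_radialMeasure d ha hη
  have hp0 : 0 < p := by linarith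
  have hε2 : ε / 2 ≠ 0 := by simpa using hε
  obtain ⟨k, hkc, hkε, hk, hkL⟩ :=
    hg.exists_hasCompactSupport_eLpNorm_sub_le ENNReal.ofReal_ne_top hε2
  obtain ⟨C, hC⟩ := hkc.exists_bound_of_continuous hk
  have hC1 : (ENNReal.ofReal C + 1) ≠ ⊤ := by simp
  have hδ : (ε / 2 / (ENNReal.ofReal C + 1)) ^ p ≠ 0 := by
    rw [Ne, ENNReal.rpow_eq_zero_iff]
    rintro (⟨h, -⟩ | ⟨-, h⟩)
    · exact ENNReal.div_ne_zero.2 ⟨hε2, hC1⟩ h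
    · linarith
  obtain ⟨K, hKab, hK, hKδ⟩ := (measurableSet_Ioo : MeasurableSet (Ioo a b)).exists_isCompact_sdiff_lt
    (measure_ne_top κ _) hδ
  obtain ⟨s, t, hs, ht, hKst, hst⟩ := exists_Icc_of_isCompact_subset hK isOpen_Ioo ordConnected_Ioo
    (m := (a + b) / 2) ⟨by linarith, by linarith⟩ hKab
  have hst' := (hs.trans ht).le
  refine ⟨(Icc s t).indicator k, ⟨hk.measurable.indicator measurableSet_Icc, ⟨C, fun r => ?_⟩,
    s, t, (hst (left_mem_Icc.2 hst')).1, hs.trans ht, (hst (right_mem_Icc.2 hst')).2,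
    fun r hr => indicator_of_notMem hr _⟩, ?_⟩
  · exact (norm_indicator_le_norm_self k r).trans (hC r)
  · have e : g - (Icc s t).indicator k = (g - k) + (Icc s t)ᶜ.indicator k := by
      ext r
      by_cases hr : r ∈ Icc s t <;> simp [hr]
    rw [e]
    refine (eLpNorm_add_le (hg.1.sub hk.aestronglyMeasurable)
      (hk.aestronglyMeasurable.indicator measurableSet_Icc.compl) (by simpa using hp.le)).trans ?_
    refine (add_le_add hkε ?_).trans (ENNReal.add_halves ε).le
    rw [eLpNorm_indicator_eq_eLpNorm_restrict measurableSet_Icc.compl]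
    refine (eLpNorm_le_of_ae_bound (C := C) (.of_forall hC)).trans ?_
    rw [Measure.restrict_apply_univ, ENNReal.toReal_ofReal hp0.le]
    have h1 : κ (Icc s t)ᶜ ≤ (ε / 2 / (ENNReal.ofReal C + 1)) ^ p := by
      calc κ (Icc s t)ᶜ ≤ κ ((Ioo a b \ K) ∪ (Ioo a b)ᶜ) := by
            refine measure_mono fun r hr => ?_
            by_cases hrab : r ∈ Ioo a b
            · exact Or.inl ⟨hrab, fun hrK => hr (Ioo_subset_Icc_self (hKst hrK))⟩
            · exact Or.inr hrab
        _ ≤ κ (Ioo a b \ K) + κ (Ioo a b)ᶜ := measure_union_le _ _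
        _ = κ (Ioo a b \ K) := by rw [hκ, radialMeasure_compl_Ioo, add_zero]
        _ ≤ _ := hKδ.le
    calc κ (Icc s t)ᶜ ^ p⁻¹ * ENNReal.ofReal C
        ≤ ((ε / 2 / (ENNReal.ofReal C + 1)) ^ p) ^ p⁻¹ * (ENNReal.ofReal C + 1) := by
          gcongr
          exact le_self_add
      _ = (ε / 2 / (ENNReal.ofReal C + 1)) * (ENNReal.ofReal C + 1) := by
          rw [← ENNReal.rpow_mul, mul_inv_cancel₀ hp0.ne', ENNReal.rpow_one]
      _ ≤ ε / 2 := by rw [mul_comm]; exact ENNReal.mul_div_le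

/-- The weighted norm does not control the values at the midpoints. An approximant h₀ is therefore
chosen first, and its errors Y i at the midpoints are then corrected by bumps whose cost is small
compared with the sum of the errors. -/
lemma exists_isBoundedSupported_interpolating (hp : 1 < p) (ha : 0 ≤ a) (hab : a < b)
    (hη : LocallyIntegrableOn η (Ici 0)) (hI : IsIntervalDecomposition (goodRadii p a b η) α β)
    {g : ℝ → ℝ} (hg : MemLp g (ENNReal.ofReal p) (radialMeasure d a b η)) (y : Fin N → ℝ)
    {ε : ℝ≥0∞} (hε : ε ≠ 0) :
    ∃ (h : ℝ → ℝ) (c : ℝ), IsBoundedSupported a b h ∧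
      eLpNorm (g - h) (ENNReal.ofReal p) (radialMeasure d a b η) ≤ ε ∧
      ∀ j, c + ∫ x in a..(α j + β j) / 2, h x = y j := by
  have hp' : 1 ≤ ENNReal.ofReal p := by simpa using hp.le
  have hε2 : ε / 2 ≠ 0 := by simpa using hε
  obtain ⟨h₀, hb₀, hε₀⟩ := exists_isBoundedSupported_eLpNorm_sub_le hp ha hab hη hg hε2
  set Y : Fin N → ℝ := fun j => y j - ∫ x in a..(α j + β j) / 2, h₀ x with hY
  set S : ℝ≥0∞ := ∑ i, ‖Y i‖ₑ with hS
  have hStop : S + 1 ≠ ⊤ := by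
    rw [hS]
    exact ENNReal.add_ne_top.2 ⟨ENNReal.sum_ne_top.2 fun i _ => enorm_ne_top, ENNReal.one_ne_top⟩
  have hδ : ε / 2 / (S + 1) ≠ 0 := ENNReal.div_ne_zero.2 ⟨hε2, hStop⟩
  choose f c hf hv hfε using fun i => exists_cheap_bump (d := d) hp ha hab hη hI i hδ
  refine ⟨h₀ + ∑ i, Y i • f i, ∑ i, Y i * c i,
    hb₀.add (.sum hab _ fun i _ => (hf i).const_smul _), ?_, fun j => ?_⟩
  · rw [← sub_sub]
    refine (eLpNorm_sub_le (hg.1.sub hb₀.measurable.aestronglyMeasurable)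
      (IsBoundedSupported.sum hab Finset.univ fun i _ =>
        (hf i).const_smul (Y i)).measurable.aestronglyMeasurable hp').trans ?_
    refine (add_le_add hε₀ ?_).trans (ENNReal.add_halves ε).le
    refine (eLpNorm_sum_le (fun i _ =>
      ((hf i).const_smul (Y i)).measurable.aestronglyMeasurable) hp').trans ?_
    calc ∑ i, eLpNorm (Y i • f i) (ENNReal.ofReal p) (radialMeasure d a b η)
        ≤ ∑ i, ‖Y i‖ₑ * (ε / 2 / (S + 1)) := by
          refine Finset.sum_le_sum fun i _ => ?_
          rw [eLpNorm_const_smul]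
          gcongr
          exact hfε i
      _ = S * (ε / 2 / (S + 1)) := by rw [hS, Finset.sum_mul]
      _ ≤ (S + 1) * (ε / 2 / (S + 1)) := by gcongr; exact le_self_add
      _ ≤ ε / 2 := ENNReal.mul_div_le
  · have e1 : ∫ x in a..(α j + β j) / 2, (h₀ + ∑ i, Y i • f i) x
        = (∫ x in a..(α j + β j) / 2, h₀ x)
          + ∑ i, Y i * ∫ x in a..(α j + β j) / 2, f i x := by
      have e2 : (fun x => (h₀ + ∑ i, Y i • f i) x) = fun x => h₀ x + ∑ i, Y i * f i x := by
        ext x; simp [Finset.sum_apply]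
      rw [e2, intervalIntegral.integral_add hb₀.integrable.intervalIntegrable,
        intervalIntegral.integral_finsetSum]
      · simp only [intervalIntegral.integral_const_mul]
      · exact fun i _ => ((hf i).integrable.const_mul _).intervalIntegrable
      · exact (integrable_finsetSum _ fun i _ => (hf i).integrable.const_mul _).intervalIntegrable
    have e3 : ∑ i, Y i * c i + ∑ i, Y i * ∫ x in a..(α j + β j) / 2, f i x = Y j := by
      rw [← Finset.sum_add_distrib]
      simp_rw [← mul_add, hv]
      simp
    rw [e1]
    have : Y j = y j - ∫ x in a..(α j + β j) / 2, h₀ x := rfl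
    linarith

/-- Approximating in L^p of the sum of the radial measure and Lebesgue measure gives both estimates
at once. The L^1 bound, from Hölder's inequality on the bounded interval, controls the primitives at
the midpoints. The cut-off restores the support in (a,b) without increasing the error. -/
lemma exists_continuous_approx (hp : 1 < p) (ha : 0 ≤ a)
    (hη : LocallyIntegrableOn η (Ici 0)) {h : ℝ → ℝ} (hh : IsBoundedSupported a b h)
    {ε : ℝ≥0∞} (hε : ε ≠ 0) :
    ∃ k : ℝ → ℝ, Continuous k ∧ IsBoundedSupported a b k ∧
      eLpNorm (h - k) (ENNReal.ofReal p) (radialMeasure d a b η) ≤ ε ∧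
      ∫⁻ r in Ioo a b, ‖h r - k r‖ₑ ≤ ε := by
  have hp' : 1 ≤ ENNReal.ofReal p := by simpa using hp.le
  set κ := radialMeasure d a b η with hκ
  have : IsFiniteMeasure κ := isFiniteMeasure_radialMeasure d ha hη
  set V : ℝ≥0∞ := volume (Ioo a b) ^ (1 / (1 : ℝ≥0∞).toReal - 1 / (ENNReal.ofReal p).toReal)
    with hV
  have hp0 : 0 < p := by linarith
  have hVtop : V + 1 ≠ ⊤ := by
    refine ENNReal.add_ne_top.2 ⟨ENNReal.rpow_ne_top_of_nonneg ?_ measure_Ioo_lt_top.ne,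
      ENNReal.one_ne_top⟩
    rw [ENNReal.toReal_ofReal hp0.le, ENNReal.toReal_one, sub_nonneg, div_le_div_iff₀ hp0 one_pos]
    linarith
  have hδ : ε / (V + 1) ≠ 0 := ENNReal.div_ne_zero.2 ⟨hε, hVtop⟩
  have hδε : ε / (V + 1) ≤ ε := ENNReal.div_le_of_le_mul (le_mul_of_one_le_right' le_add_self)
  obtain ⟨k, hkc, hkε, hk, -⟩ := (hh.memLp (ENNReal.ofReal p)
    (κ + volume.restrict (Ioo a b))).exists_hasCompactSupport_eLpNorm_sub_le
    ENNReal.ofReal_ne_top hδ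
  obtain ⟨s, t, has, hst, htb, h0⟩ := hh.supp
  obtain ⟨χ, hχ, hχc, hχU, hχ1, hχ01⟩ := exists_smooth_cutoff (isCompact_Icc : IsCompact (Icc s t))
    (isOpen_Ioo : IsOpen (Ioo ((a + s) / 2) ((t + b) / 2)))
    (fun r hr => ⟨by linarith [hr.1], by linarith [hr.2]⟩)
  obtain ⟨C, hC⟩ := hkc.exists_bound_of_continuous hk
  have hcont : Continuous (fun r => χ r * k r) := hχ.continuous.mul hk
  have hle : ∀ r, ‖(h - fun r => χ r * k r) r‖ ≤ ‖(h - k) r‖ := by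
    intro r
    have e : h r = χ r * h r := by
      by_cases hr : r ∈ Icc s t
      · rw [hχ1.self_of_nhdsSet r hr, one_mul]
      · rw [h0 r hr, mul_zero]
    show ‖h r - χ r * k r‖ ≤ ‖h r - k r‖
    rw [e, ← mul_sub, norm_mul, ← e, Real.norm_of_nonneg (hχ01 r).1]
    exact mul_le_of_le_one_left (norm_nonneg _) (hχ01 r).2
  have hkε' : eLpNorm (h - fun r => χ r * k r) (ENNReal.ofReal p) (κ + volume.restrict (Ioo a b))
      ≤ ε / (V + 1) := (eLpNorm_mono hle).trans hkε
  refine ⟨fun r => χ r * k r, hcont, ⟨hcont.measurable, ⟨C, fun r => ?_⟩, (a + s) / 2,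
    (t + b) / 2, by linarith, by linarith, by linarith, fun r hr => ?_⟩, ?_, ?_⟩
  · rw [abs_mul, abs_of_nonneg (hχ01 r).1]
    exact (mul_le_of_le_one_left (abs_nonneg _) (hχ01 r).2).trans (hC r)
  · rw [image_eq_zero_of_notMem_tsupport fun hm => hr (Ioo_subset_Icc_self (hχU hm)), zero_mul]
  · exact (eLpNorm_mono_measure _ (Measure.le_add_right le_rfl)).trans (hkε'.trans hδε)
  · have h1 : ∫⁻ r in Ioo a b, ‖h r - χ r * k r‖ₑ
        = eLpNorm (h - fun r => χ r * k r) 1 (volume.restrict (Ioo a b)) := by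
      rw [eLpNorm_one_eq_lintegral_enorm]; rfl
    rw [h1]
    refine (eLpNorm_le_eLpNorm_mul_rpow_measure_univ hp'
      (hh.measurable.sub hcont.measurable).aestronglyMeasurable).trans ?_
    rw [Measure.restrict_apply_univ, ← hV]
    calc eLpNorm (h - fun r => χ r * k r) (ENNReal.ofReal p) (volume.restrict (Ioo a b)) * V
        ≤ ε / (V + 1) * (V + 1) := by
          gcongr
          · exact (eLpNorm_mono_measure _ (Measure.le_add_left le_rfl)).trans hkε'
          · exact le_self_add
      _ ≤ ε := by rw [mul_comm]; exact ENNReal.mul_div_le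

/-- Functions with derivative in the weighted space `L^p` and given values at the middle of each
component of `I_p` can be approximated by functions of class `C^1` with compactly supported
derivative. -/
lemma exists_contDiff_approx (hp : 1 < p) (ha : 0 ≤ a) (hab : a < b)
    (hη : LocallyIntegrableOn η (Ici 0)) (hI : IsIntervalDecomposition (goodRadii p a b η) α β)
    {g : ℝ → ℝ} (hg : MemLp g (ENNReal.ofReal p) (radialMeasure d a b η)) (y : Fin N → ℝ)
    {ε : ℝ≥0∞} (hε : ε ≠ 0) :
    ∃ φ : ℝ → ℝ, ContDiff ℝ 1 φ ∧ IsBoundedSupported a b (deriv φ) ∧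
      eLpNorm (g - deriv φ) (ENNReal.ofReal p) (radialMeasure d a b η) ≤ ε ∧
      ∀ j, ‖y j - φ ((α j + β j) / 2)‖ₑ ≤ ε := by
  have hε2 : ε / 2 ≠ 0 := by simpa using hε
  obtain ⟨h, c, hh, hhε, hhy⟩ := exists_isBoundedSupported_interpolating hp ha hab hη hI hg y hε2
  obtain ⟨k, hk, hkb, hkε, hk1⟩ := exists_continuous_approx (d := d) hp ha hη hh hε2
  have hd : ∀ t, HasDerivAt (fun t => c + ∫ x in a..t, k x) (k t) t := fun t =>
    ((hk.integral_hasStrictDerivAt a t).hasDerivAt).const_add _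
  have hder : deriv (fun t => c + ∫ x in a..t, k x) = k := funext fun t => (hd t).deriv
  refine ⟨fun t => c + ∫ x in a..t, k x, ?_, ?_, ?_, fun j => ?_⟩
  · exact contDiff_one_iff_deriv.2 ⟨fun t => (hd t).differentiableAt, by rwa [hder]⟩
  · rwa [hder]
  · rw [hder]
    have e : g - k = (g - h) + (h - k) := by ring
    rw [e]
    refine (eLpNorm_add_le (hg.1.sub hh.measurable.aestronglyMeasurable)
      (hh.measurable.sub hk.measurable).aestronglyMeasurable (by simpa using hp.le)).trans ?_
    exact (add_le_add hhε hkε).trans (ENNReal.add_halves ε).le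
  · have hm : (α j + β j) / 2 ∈ Ioo a b := (hI.Ioo_subset j (hI.mid_mem j)).1
    have e : y j - (c + ∫ x in a..(α j + β j) / 2, k x)
        = ∫ x in a..(α j + β j) / 2, (h x - k x) := by
      rw [intervalIntegral.integral_sub hh.integrable.intervalIntegrable
        hkb.integrable.intervalIntegrable, ← hhy j]
      ring
    rw [e, intervalIntegral.integral_of_le hm.1.le]
    refine (enorm_integral_le_lintegral_enorm _).trans ?_
    refine (lintegral_mono_set (t := Ioo a b) fun r hr => ⟨hr.1, hr.2.trans_lt hm.2⟩).trans ?_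
    exact hk1.trans ENNReal.half_le_self

end Approximation

section Hardy

/-! ### Properties of the auxiliary weight -/

variable {d : ℕ} {p a b : ℝ} {η : ℝ → ℝ} {Ω : Set (E d)} {N : ℕ} {α β : Fin N → ℝ}

lemma mem_domain_of_norm_mem (hΩ : Ω = {x | ‖x‖ < b} ∨ Ω = {x | a < ‖x‖ ∧ ‖x‖ < b}) {x : E d}
    (hx : ‖x‖ ∈ Ioo a b) : x ∈ Ω := by
  rcases hΩ with rfl | rfl
  · exact hx.2
  · exact hx

lemma isOpen_domain (hΩ : Ω = {x | ‖x‖ < b} ∨ Ω = {x | a < ‖x‖ ∧ ‖x‖ < b}) : IsOpen Ω := by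
  rcases hΩ with rfl | rfl
  · exact isOpen_lt continuous_norm continuous_const
  · exact (isOpen_lt continuous_const continuous_norm).inter
      (isOpen_lt continuous_norm continuous_const)

lemma domain_subset_ball (hΩ : Ω = {x | ‖x‖ < b} ∨ Ω = {x | a < ‖x‖ ∧ ‖x‖ < b}) :
    Ω ⊆ Metric.ball 0 b := by
  rcases hΩ with rfl | rfl
  · intro x hx; simpa using hx
  · intro x hx; simpa using hx.2

lemma volume_domain_ne_top (hΩ : Ω = {x | ‖x‖ < b} ∨ Ω = {x | a < ‖x‖ ∧ ‖x‖ < b}) :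
    volume Ω ≠ ⊤ :=
  ((measure_mono (domain_subset_ball hΩ)).trans_lt measure_ball_lt_top).ne

lemma goodSet_eq (hΩ : Ω = {x | ‖x‖ < b} ∨ Ω = {x | a < ‖x‖ ∧ ‖x‖ < b}) :
    goodSet p a b η Ω = {x | ‖x‖ ∈ goodRadii p a b η} :=
  Set.ext fun _ => ⟨fun h => h.2, fun h => ⟨mem_domain_of_norm_mem hΩ h.1, h⟩⟩

lemma goodRadii_subset_Ioi (ha : 0 ≤ a) : goodRadii p a b η ⊆ Ioi 0 :=
  fun _ hr => ha.trans_lt hr.1.1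

lemma mul_rpow_neg_of_ne {x y : ℝ≥0∞} (hx0 : x ≠ 0) (hx : x ≠ ⊤) {q : ℝ} (hq : 0 ≤ q) :
    (x * y) ^ (-q) = x ^ (-q) * y ^ (-q) := by
  rw [ENNReal.rpow_neg, ENNReal.mul_rpow_of_nonneg _ _ hq, ENNReal.mul_inv, ENNReal.rpow_neg,
    ENNReal.rpow_neg]
  · left
    rw [Ne, ENNReal.rpow_eq_zero_iff]
    rintro (⟨h, -⟩ | ⟨h, -⟩)
    · exact hx0 h
    · exact hx h
  · left
    exact ENNReal.rpow_ne_top_of_nonneg hq hx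

/-- With q = 1/(p-1) one has 1 - pq = -q. The Jacobian r^{d-1} thus turns the dual of |y|^{(d-1)p} w
into the dual of the radial density r^{d-1} η, the one that Hölder's inequality requires. -/
lemma shellDensity_eq (hp : 1 < p) (hd : 1 ≤ d) {r : ℝ} (hr : 0 < r) (e : ℝ≥0∞) :
    ENNReal.ofReal (r ^ (d - 1)) *
      (ENNReal.ofReal (r ^ (((d : ℝ) - 1) * p)) * e) ^ (-(1 / (p - 1)))
      = (ENNReal.ofReal (r ^ (d - 1)) * e) ^ (-(1 / (p - 1))) := by
  have hp1 : 0 < p - 1 := by linarith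
  set A : ℝ≥0∞ := ENNReal.ofReal (r ^ (d - 1)) with hA
  have hA0 : A ≠ 0 := by simpa [hA] using pow_pos hr _
  have hAt : A ≠ ⊤ := ENNReal.ofReal_ne_top
  have hAp : ENNReal.ofReal (r ^ (((d : ℝ) - 1) * p)) = A ^ p := by
    rw [Real.rpow_mul hr.le, ← Nat.cast_one, ← Nat.cast_sub hd, Real.rpow_natCast, hA,
      ENNReal.ofReal_rpow_of_pos (pow_pos hr _)]
  have hAp0 : A ^ p ≠ 0 := by
    rw [← hAp]; simpa using Real.rpow_pos_of_pos hr _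
  have hApt : A ^ p ≠ ⊤ := by rw [← hAp]; exact ENNReal.ofReal_ne_top
  rw [hAp, mul_rpow_neg_of_ne hAp0 hApt (by positivity), mul_rpow_neg_of_ne hA0 hAt (by positivity),
    ← mul_assoc, ← ENNReal.rpow_mul]
  congr 1
  nth_rw 1 [← ENNReal.rpow_one A]
  rw [← ENNReal.rpow_add _ _ hA0 hAt]
  congr 1
  field_simp
  ring

lemma shellIntegral_eq (hp : 1 < p) (hd : 1 ≤ d) (ha : 0 ≤ a)
    (hΩ : Ω = {x | ‖x‖ < b} ∨ Ω = {x | a < ‖x‖ ∧ ‖x‖ < b})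
    (hη : LocallyIntegrableOn η (Ici 0)) {s t : ℝ} (hst : Ioo s t ⊆ goodRadii p a b η) :
    shellIntegral p a b η Ω s t = sphereArea d *
      ∫⁻ r in Ioo s t,
        (ENNReal.ofReal (r ^ (d - 1)) * ENNReal.ofReal (η r)) ^ (-(1 / (p - 1))) := by
  have h0 : Ioo s t ⊆ Ioi 0 := hst.trans (goodRadii_subset_Ioi ha)
  have hset : {y | y ∈ goodSet p a b η Ω ∧ s < ‖y‖ ∧ ‖y‖ < t} = {y : E d | ‖y‖ ∈ Ioo s t} := by
    rw [goodSet_eq hΩ]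
    exact Set.ext fun x => ⟨fun h => h.2, fun h => ⟨hst h, h⟩⟩
  have hm : AEMeasurable (fun r => (ENNReal.ofReal (r ^ (((d : ℝ) - 1) * p)) *
      ENNReal.ofReal (η r)) ^ (-(1 / (p - 1)))) (volume.restrict (Ioo s t)) :=
    AEMeasurable.pow_const (((measurable_id.pow_const _).ennreal_ofReal).aemeasurable.mul
      (aemeasurable_restrict_of_locallyIntegrableOn hη
        (h0.trans Ioi_subset_Ici_self)).ennreal_ofReal) _
  rw [shellIntegral, hset]
  simp only [weight]
  rw [setLIntegral_comp_norm hd measurableSet_Ioo h0 hm]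
  congr 1
  refine setLIntegral_congr_fun measurableSet_Ioo fun r hr => ?_
  exact shellDensity_eq hp hd (h0 hr) _

/-- Every point of the compact interval has a neighbourhood where the dual of η is summable, and
finitely many of these cover it. The factor r^{d-1} is bounded below by s^{d-1} > 0. -/
lemma lintegral_dual_lt_top (hp : 1 < p) (ha : 0 ≤ a) {s t : ℝ}
    (hst : Icc s t ⊆ goodRadii p a b η) :
    ∫⁻ r in Ioo s t, (ENNReal.ofReal (r ^ (d - 1)) * ENNReal.ofReal (η r)) ^ (-(1 / (p - 1)))
      < ⊤ := by
  rcases lt_or_ge t s with hts | hle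
  · simp [Ioo_eq_empty (not_lt.2 hts.le)]
  have hq : 0 ≤ 1 / (p - 1) := by have : 0 < p - 1 := by linarith
                                  positivity
  have hs : 0 < s := goodRadii_subset_Ioi ha (hst (left_mem_Icc.2 hle))
  have h1 : ∫⁻ r in Icc s t, ENNReal.ofReal (η r) ^ (-(1 / (p - 1))) < ⊤ := by
    refine (isCompact_Icc : IsCompact (Icc s t)).induction_on
      (p := fun K => ∫⁻ r in K, ENNReal.ofReal (η r) ^ (-(1 / (p - 1))) < ⊤)
      (by simp) (fun K L hKL hL => (lintegral_mono_set hKL).trans_lt hL)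
      (fun K L hK hL => (lintegral_union_le _ _ _).trans_lt (ENNReal.add_lt_top.2 ⟨hK, hL⟩))
      fun r hr => ?_
    obtain ⟨-, ε, hε, hfin⟩ := hst hr
    exact ⟨Ioo (r - ε) (r + ε), mem_nhdsWithin_of_mem_nhds
      (Ioo_mem_nhds (by linarith) (by linarith)), hfin⟩
  have hA0 : ENNReal.ofReal (s ^ (d - 1)) ≠ 0 := by simpa using pow_pos hs _
  calc ∫⁻ r in Ioo s t, (ENNReal.ofReal (r ^ (d - 1)) * ENNReal.ofReal (η r)) ^ (-(1 / (p - 1)))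
      ≤ ∫⁻ r in Ioo s t, ENNReal.ofReal (s ^ (d - 1)) ^ (-(1 / (p - 1))) *
          ENNReal.ofReal (η r) ^ (-(1 / (p - 1))) := by
        refine setLIntegral_mono' measurableSet_Ioo fun r hr => ?_
        rw [← mul_rpow_neg_of_ne hA0 ENNReal.ofReal_ne_top hq, ENNReal.rpow_neg, ENNReal.rpow_neg,
          ENNReal.inv_le_inv]
        have : s ≤ r := hr.1.le
        gcongr
    _ = ENNReal.ofReal (s ^ (d - 1)) ^ (-(1 / (p - 1))) *
          ∫⁻ r in Ioo s t, ENNReal.ofReal (η r) ^ (-(1 / (p - 1))) := by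
        rw [lintegral_const_mul']
        exact ENNReal.rpow_ne_top_of_ne_zero hA0 ENNReal.ofReal_ne_top
    _ < ⊤ := by
        refine ENNReal.mul_lt_top
          (ENNReal.rpow_ne_top_of_ne_zero hA0 ENNReal.ofReal_ne_top).lt_top ?_
        exact (lintegral_mono_set Ioo_subset_Icc_self).trans_lt h1

/-- A negative power vanishes only where its base is infinite, and r^{d-1} η(r) never is. -/
lemma lintegral_dual_ne_zero (hp : 1 < p) (hη : LocallyIntegrableOn η (Ici 0)) {s t : ℝ}
    (hs : 0 ≤ s) (hst : s < t) :
    ∫⁻ r in Ioo s t, (ENNReal.ofReal (r ^ (d - 1)) * ENNReal.ofReal (η r)) ^ (-(1 / (p - 1)))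
      ≠ 0 := by
  have h0 : Ioo s t ⊆ Ici 0 := fun r hr => hs.trans hr.1.le
  have hq : 0 < 1 / (p - 1) := by have : 0 < p - 1 := by linarith
                                  positivity
  intro h
  rw [lintegral_eq_zero_iff' ((aemeasurable_radialDensity d hη h0).pow_const _)] at h
  have h1 : ∀ᵐ r ∂volume.restrict (Ioo s t), False := by
    filter_upwards [h] with r hr
    rw [Pi.zero_apply, ENNReal.rpow_eq_zero_iff] at hr
    rcases hr with ⟨-, hr⟩ | ⟨hr, -⟩
    · linarith
    · exact ENNReal.mul_ne_top ENNReal.ofReal_ne_top ENNReal.ofReal_ne_top hr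
  rw [ae_iff] at h1
  simp only [not_false_eq_true, ofPred_true, Measure.restrict_apply_univ, Real.volume_Ioo,
    ENNReal.ofReal_eq_zero] at h1
  linarith

/-- Hölder's inequality with a weight and its dual weight. -/
lemma lintegral_rpow_le_mul_dual (hp : 1 < p) {U : Set ℝ} {ρ : ℝ → ℝ≥0∞} {k : ℝ → ℝ}
    (hρ : AEMeasurable ρ (volume.restrict U)) (hρt : ∀ r, ρ r ≠ ⊤)
    (hk : AEMeasurable k (volume.restrict U))
    (hfin : ∫⁻ r in U, ρ r ^ (-(1 / (p - 1))) ≠ ⊤) :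
    (∫⁻ r in U, ‖k r‖ₑ) ^ p
      ≤ (∫⁻ r in U, ‖k r‖ₑ ^ p * ρ r) * (∫⁻ r in U, ρ r ^ (-(1 / (p - 1)))) ^ (p - 1) := by
  have hp0 : 0 < p := by linarith
  have hp1 : 0 < p - 1 := by linarith
  have hpq : p.HolderConjugate (p / (p - 1)) := Real.HolderConjugate.conjExponent hp
  -- Where ρ = 0 the dual weight is infinite, so this set is null. Hence k = (k ρ^{1/p}) ρ^{-1/p}
  -- almost everywhere.
  have hpos : ∀ᵐ r ∂volume.restrict U, ρ r ≠ 0 := by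
    filter_upwards [ae_lt_top' (hρ.pow_const _) hfin] with r hr h0
    rw [h0, ENNReal.zero_rpow_of_neg (by rw [neg_lt_zero]; positivity)] at hr
    exact lt_irrefl _ hr
  have h1 : ∫⁻ r in U, ‖k r‖ₑ
      = ∫⁻ r in U, ((fun r => ‖k r‖ₑ * ρ r ^ (1 / p)) * fun r => ρ r ^ (-(1 / p))) r := by
    refine lintegral_congr_ae ?_
    filter_upwards [hpos] with r hr
    simp only [Pi.mul_apply]
    rw [mul_assoc, ← ENNReal.rpow_add _ _ hr (hρt r), add_neg_cancel, ENNReal.rpow_zero, mul_one]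
  have h2 := ENNReal.lintegral_mul_le_Lp_mul_Lq (volume.restrict U) hpq
    (f := fun r => ‖k r‖ₑ * ρ r ^ (1 / p)) (g := fun r => ρ r ^ (-(1 / p)))
    (hk.enorm.mul (hρ.pow_const _)) (hρ.pow_const _)
  rw [← h1] at h2
  have e1 : ∀ r, (‖k r‖ₑ * ρ r ^ (1 / p)) ^ p = ‖k r‖ₑ ^ p * ρ r := fun r => by
    rw [ENNReal.mul_rpow_of_nonneg _ _ hp0.le, ← ENNReal.rpow_mul, one_div_mul_cancel hp0.ne',
      ENNReal.rpow_one]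
  have e2 : ∀ r, (ρ r ^ (-(1 / p))) ^ (p / (p - 1)) = ρ r ^ (-(1 / (p - 1))) := fun r => by
    rw [← ENNReal.rpow_mul]; congr 1; field_simp
  simp only [e1, e2] at h2
  calc (∫⁻ r in U, ‖k r‖ₑ) ^ p
      ≤ ((∫⁻ r in U, ‖k r‖ₑ ^ p * ρ r) ^ (1 / p) *
          (∫⁻ r in U, ρ r ^ (-(1 / (p - 1)))) ^ (1 / (p / (p - 1)))) ^ p := by gcongr
    _ = _ := by
        rw [ENNReal.mul_rpow_of_nonneg _ _ hp0.le, ← ENNReal.rpow_mul, ← ENNReal.rpow_mul,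
          one_div_mul_cancel hp0.ne', ENNReal.rpow_one]
        congr 2
        field_simp

/-- The one-dimensional Hardy-type estimate which the auxiliary weight is made for. -/
lemma enorm_primitive_rpow_mul_le (hp : 1 < p) (hd : 1 ≤ d) (ha : 0 ≤ a)
    (hΩ : Ω = {x | ‖x‖ < b} ∨ Ω = {x | a < ‖x‖ ∧ ‖x‖ < b})
    (hη : LocallyIntegrableOn η (Ici 0)) {s t : ℝ} (hst : Icc s t ⊆ goodRadii p a b η)
    {k : ℝ → ℝ} (hk : LocallyIntegrableOn k (goodRadii p a b η)) {m r : ℝ}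
    (hmr : uIoc m r ⊆ Ioc s t) :
    ‖∫ x in m..r, k x‖ₑ ^ p * (shellIntegral p a b η Ω s t)⁻¹ ^ (p - 1)
      ≤ (sphereArea d)⁻¹ ^ (p - 1) * ∫⁻ x in goodRadii p a b η,
        ENNReal.ofReal (x ^ (d - 1)) * ‖k x‖ₑ ^ p * ENNReal.ofReal (η x) := by
  have hp0 : 0 < p := by linarith
  have hp1 : 0 < p - 1 := by linarith
  have hsub : Ioo s t ⊆ goodRadii p a b η := Ioo_subset_Icc_self.trans hst
  have h0 : Ioo s t ⊆ Ici 0 :=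
    (hsub.trans (goodRadii_subset_Ioi ha)).trans Ioi_subset_Ici_self
  set T : ℝ≥0∞ := ∫⁻ r in Ioo s t,
    (ENNReal.ofReal (r ^ (d - 1)) * ENNReal.ofReal (η r)) ^ (-(1 / (p - 1))) with hT
  have hkm : AEMeasurable k (volume.restrict (Ioo s t)) :=
    ((hk.integrableOn_compact_subset hst isCompact_Icc).mono_set
      Ioo_subset_Icc_self).1.aemeasurable
  have hH := lintegral_rpow_le_mul_dual hp (aemeasurable_radialDensity d hη h0)
    (fun r => ENNReal.mul_ne_top ENNReal.ofReal_ne_top ENNReal.ofReal_ne_top) hkm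
    (lintegral_dual_lt_top hp ha hst).ne
  have h1 : ‖∫ x in m..r, k x‖ₑ ≤ ∫⁻ x in Ioo s t, ‖k x‖ₑ := by
    have : ‖∫ x in m..r, k x‖ₑ = ‖∫ x in uIoc m r, k x‖ₑ := by
      rw [← ofReal_norm, intervalIntegral.norm_intervalIntegral_eq, ofReal_norm]
    rw [this]
    refine (enorm_integral_le_lintegral_enorm _).trans ((lintegral_mono_set hmr).trans ?_)
    exact (setLIntegral_congr Ioo_ae_eq_Ioc).ge
  -- The factor T^{p-1} from Hölder's inequality cancels against the shell integral, which is the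
  -- area of the sphere times T.
  have h2 : T * (sphereArea d * T)⁻¹ ≤ (sphereArea d)⁻¹ := by
    rw [ENNReal.mul_inv (Or.inl (sphereArea_ne_zero hd)) (Or.inl (sphereArea_ne_top d)),
      mul_left_comm]
    exact mul_le_of_le_one_right' (ENNReal.mul_inv_le_one T)
  rw [shellIntegral_eq hp hd ha hΩ hη hsub, ← hT]
  calc ‖∫ x in m..r, k x‖ₑ ^ p * (sphereArea d * T)⁻¹ ^ (p - 1)
      ≤ ((∫⁻ x in Ioo s t, ‖k x‖ₑ ^ p *
          (ENNReal.ofReal (x ^ (d - 1)) * ENNReal.ofReal (η x))) * T ^ (p - 1)) *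
          (sphereArea d * T)⁻¹ ^ (p - 1) := by
        gcongr
        exact (ENNReal.rpow_le_rpow h1 hp0.le).trans hH
    _ = (∫⁻ x in Ioo s t, ‖k x‖ₑ ^ p *
          (ENNReal.ofReal (x ^ (d - 1)) * ENNReal.ofReal (η x))) *
          (T * (sphereArea d * T)⁻¹) ^ (p - 1) := by
        rw [ENNReal.mul_rpow_of_nonneg _ _ hp1.le, mul_assoc]
    _ ≤ (∫⁻ x in goodRadii p a b η, ‖k x‖ₑ ^ p *
          (ENNReal.ofReal (x ^ (d - 1)) * ENNReal.ofReal (η x))) *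
          (sphereArea d)⁻¹ ^ (p - 1) := by
        gcongr
    _ = _ := by
        rw [mul_comm]
        congr 1
        refine lintegral_congr fun x => ?_
        ring

/-! ### Measurability and boundedness of the auxiliary weight -/

lemma shellIntegral_mono {s s' t t' : ℝ} (hs : s' ≤ s) (ht : t ≤ t') :
    shellIntegral p a b η Ω s t ≤ shellIntegral p a b η Ω s' t' :=
  lintegral_mono_set fun _ hy => ⟨hy.1, hs.trans_lt hy.2.1, hy.2.2.trans_le ht⟩

/-- As a function of one end radius the shell integral is monotone, hence measurable without any
continuity argument. -/
lemma measurable_hatWeightOn (A B : ℝ) :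
    Measurable (hatWeightOn (d := d) p a b η Ω A B) := by
  have h1 : Measurable fun r => shellIntegral p a b η Ω r ((A + B) / 2) :=
    Antitone.measurable fun r s h => shellIntegral_mono h le_rfl
  have h2 : Measurable fun r => shellIntegral p a b η Ω ((A + B) / 2) r :=
    Monotone.measurable fun r s h => shellIntegral_mono le_rfl h
  unfold hatWeightOn
  refine Measurable.ite (measurableSet_le measurable_norm measurable_const)
    (h1.comp measurable_norm).inv ?_
  exact Measurable.ite (measurableSet_le measurable_norm measurable_const) measurable_const
    (h2.comp measurable_norm).inv

lemma measurable_hatWeight (hΩ : MeasurableSet Ω) :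
    Measurable (hatWeight (d := d) p a b η Ω α β) := by
  unfold hatWeight
  refine Finset.measurable_fun_sum _ fun i _ => ?_
  exact Measurable.ite (hΩ.inter (measurable_norm measurableSet_Ioo)) (measurable_hatWeightOn _ _)
    measurable_const

lemma hatWeight_eq {I : Set ℝ} (hI : IsIntervalDecomposition I α β) {i : Fin N} {x : E d}
    (hxΩ : x ∈ Ω) (hx : ‖x‖ ∈ Ioo (α i) (β i)) :
    hatWeight p a b η Ω α β x = hatWeightOn p a b η Ω (α i) (β i) x := by
  unfold hatWeight
  rw [Finset.sum_eq_single i]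
  · rw [if_pos ⟨hxΩ, hx⟩]
  · intro j _ hji
    exact if_neg fun h => disjoint_left.1 (hI.disjoint j i hji) h.2 hx
  · simp

lemma hatWeight_eq_zero {I : Set ℝ} (hI : IsIntervalDecomposition I α β) {x : E d}
    (hx : ‖x‖ ∉ I) : hatWeight p a b η Ω α β x = 0 := by
  unfold hatWeight
  exact Finset.sum_eq_zero fun i _ => if_neg fun h => hx (hI.Ioo_subset i h.2)

lemma shellIntegral_ne_zero (hp : 1 < p) (hd : 1 ≤ d) (ha : 0 ≤ a)
    (hΩ : Ω = {x | ‖x‖ < b} ∨ Ω = {x | a < ‖x‖ ∧ ‖x‖ < b})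
    (hη : LocallyIntegrableOn η (Ici 0)) {s t : ℝ} (hst : s < t)
    (hsub : Ioo s t ⊆ goodRadii p a b η) : shellIntegral p a b η Ω s t ≠ 0 := by
  rw [shellIntegral_eq hp hd ha hΩ hη hsub]
  refine mul_ne_zero (sphereArea_ne_zero hd) (lintegral_dual_ne_zero hp hη ?_ hst)
  have h1 : Icc s t ⊆ Ici 0 := by
    rw [← closure_Ioo hst.ne]
    exact closure_minimal ((hsub.trans (goodRadii_subset_Ioi ha)).trans Ioi_subset_Ici_self)
      isClosed_Ici
  exact h1 (left_mem_Icc.2 hst.le)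

/-- In each of the three zones of a component, the shell defining the weight contains a fixed
nonempty shell, whose integral is positive. The reciprocals of these fixed integrals bound the
weight, and there are finitely many components. -/
lemma hatWeight_bounded (hp : 1 < p) (hd : 1 ≤ d) (ha : 0 ≤ a)
    (hΩ : Ω = {x | ‖x‖ < b} ∨ Ω = {x | a < ‖x‖ ∧ ‖x‖ < b})
    (hη : LocallyIntegrableOn η (Ici 0)) (hI : IsIntervalDecomposition (goodRadii p a b η) α β) :
    ∃ D : ℝ≥0∞, D ≠ ⊤ ∧ ∀ x, hatWeight p a b η Ω α β x ≤ D := by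
  set D : Fin N → ℝ≥0∞ := fun i =>
    (shellIntegral p a b η Ω ((3 * α i + β i) / 4) ((α i + β i) / 2))⁻¹ +
    (shellIntegral p a b η Ω ((3 * α i + β i) / 4) ((α i + 3 * β i) / 4))⁻¹ +
    (shellIntegral p a b η Ω ((α i + β i) / 2) ((α i + 3 * β i) / 4))⁻¹ with hD
  have hle : ∀ i x, hatWeightOn p a b η Ω (α i) (β i) x ≤ D i := by
    intro i x
    unfold hatWeightOn
    split_ifs with h1 h2
    · exact (ENNReal.inv_le_inv.2 (shellIntegral_mono h1 le_rfl)).trans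
        (le_self_add.trans le_self_add)
    · exact le_add_self.trans le_self_add
    · exact (ENNReal.inv_le_inv.2 (shellIntegral_mono le_rfl (not_le.1 h2).le)).trans le_add_self
  refine ⟨∑ i, D i, ENNReal.sum_ne_top.2 fun i _ => ?_, fun x => ?_⟩
  · have hlt := hI.lt i
    have hsub : ∀ s t, α i ≤ s → t ≤ β i → Ioo s t ⊆ goodRadii p a b η := fun s t hs ht =>
      (Ioo_subset_Ioo hs ht).trans (hI.Ioo_subset i)
    refine ENNReal.add_ne_top.2 ⟨ENNReal.add_ne_top.2 ⟨?_, ?_⟩, ?_⟩ <;>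
    · refine ENNReal.inv_ne_top.2 (shellIntegral_ne_zero hp hd ha hΩ hη (by linarith)
        (hsub _ _ (by linarith) (by linarith)))
  · unfold hatWeight
    refine Finset.sum_le_sum fun i _ => ?_
    split_ifs
    · exact hle i x
    · exact zero_le

/-- The density is finite everywhere, so f need not be measurable. -/
lemma lintegral_hatMeasure (hp : 1 < p) (hΩ : MeasurableSet Ω) (f : E d → ℝ≥0∞)
    (hfin : ∀ x, hatWeight p a b η Ω α β x ≠ ⊤) :
    ∫⁻ x, f x ∂hatMeasure p a b η Ω α β
      = ∫⁻ x in Ω, hatWeight p a b η Ω α β x ^ (p - 1) * f x := by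
  rw [hatMeasure, lintegral_withDensity_eq_lintegral_mul_non_measurable _
    ((measurable_hatWeight hΩ).pow_const _)]
  · rfl
  · exact .of_forall fun x => ENNReal.rpow_lt_top_of_nonneg (by linarith) (hfin x)

lemma isFiniteMeasure_hatMeasure (hp : 1 < p) (hd : 1 ≤ d) (ha : 0 ≤ a)
    (hΩ : Ω = {x | ‖x‖ < b} ∨ Ω = {x | a < ‖x‖ ∧ ‖x‖ < b})
    (hη : LocallyIntegrableOn η (Ici 0)) (hI : IsIntervalDecomposition (goodRadii p a b η) α β) :
    IsFiniteMeasure (hatMeasure p a b η Ω α β) := by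
  obtain ⟨D, hD, hle⟩ := hatWeight_bounded hp hd ha hΩ hη hI
  refine isFiniteMeasure_withDensity ?_
  have h1 : ∫⁻ x in Ω, hatWeight p a b η Ω α β x ^ (p - 1) ≤ ∫⁻ x in Ω, D ^ (p - 1) :=
    lintegral_mono fun x => ENNReal.rpow_le_rpow (hle x) (by linarith)
  refine ne_top_of_le_ne_top ?_ h1
  rw [setLIntegral_const]
  exact ENNReal.mul_ne_top (ENNReal.rpow_ne_top_of_nonneg (by linarith) hD)
    (volume_domain_ne_top hΩ)

/-- Hardy-type estimate for radial functions in terms of the auxiliary weight. -/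
lemma lintegral_hatMeasure_le (hp : 1 < p) (hd : 1 ≤ d) (ha : 0 ≤ a)
    (hΩ : Ω = {x | ‖x‖ < b} ∨ Ω = {x | a < ‖x‖ ∧ ‖x‖ < b})
    (hη : LocallyIntegrableOn η (Ici 0)) (hI : IsIntervalDecomposition (goodRadii p a b η) α β) :
    ∃ C : ℝ≥0∞, C ≠ ⊤ ∧ ∀ (f : E d → ℝ) (k : ℝ → ℝ) (y : Fin N → ℝ),
      LocallyIntegrableOn k (goodRadii p a b η) →
      (∀ i, ∀ᵐ x : E d, ‖x‖ ∈ Ioo (α i) (β i) →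
        f x = y i + ∫ r in (α i + β i) / 2..‖x‖, k r) →
      ∫⁻ x, ‖f x‖ₑ ^ p ∂hatMeasure p a b η Ω α β ≤ C * (∑ i, ‖y i‖ₑ ^ p +
        ∫⁻ r in goodRadii p a b η,
          ENNReal.ofReal (r ^ (d - 1)) * ‖k r‖ₑ ^ p * ENNReal.ofReal (η r)) := by
  have hp0 : 0 < p := by linarith
  have hp1 : 0 < p - 1 := by linarith
  obtain ⟨D, hD, hle⟩ := hatWeight_bounded hp hd ha hΩ hη hI
  -- The factor 2^{p-1} comes from (s+t)^p ≤ 2^{p-1}(s^p+t^p), the bound D serves the constants y i,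
  -- and the power of the sphere area serves the primitives.
  set C₁ : ℝ≥0∞ := 2 ^ (p - 1) * (D ^ (p - 1) + (sphereArea d)⁻¹ ^ (p - 1)) with hC₁
  have hC₁t : C₁ ≠ ⊤ := by
    refine ENNReal.mul_ne_top (ENNReal.rpow_ne_top_of_nonneg hp1.le (by simp))
      (ENNReal.add_ne_top.2 ⟨ENNReal.rpow_ne_top_of_nonneg hp1.le hD,
        ENNReal.rpow_ne_top_of_nonneg hp1.le (ENNReal.inv_ne_top.2 (sphereArea_ne_zero hd))⟩)
  refine ⟨C₁ * volume Ω, ENNReal.mul_ne_top hC₁t (volume_domain_ne_top hΩ),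
    fun f k y hk hf => ?_⟩
  set K : ℝ≥0∞ := ∫⁻ r in goodRadii p a b η,
    ENNReal.ofReal (r ^ (d - 1)) * ‖k r‖ₑ ^ p * ENNReal.ofReal (η r) with hK
  set Y : ℝ≥0∞ := ∑ i, ‖y i‖ₑ ^ p with hY
  have hmeas := (isOpen_domain hΩ).measurableSet
  have hpt : ∀ᵐ x ∂volume.restrict Ω,
      hatWeight p a b η Ω α β x ^ (p - 1) * ‖f x‖ₑ ^ p ≤ C₁ * (Y + K) := by
    filter_upwards [ae_restrict_of_ae (ae_all_iff.2 hf), ae_restrict_mem hmeas] with x hx hxΩ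
    by_cases hxI : ‖x‖ ∈ goodRadii p a b η
    · have hxI' := hxI
      rw [hI.union, mem_iUnion] at hxI'
      obtain ⟨i, hi⟩ := hxI'
      have hlt := hI.lt i
      have hsub : ∀ s t, α i < s → t < β i → Icc s t ⊆ goodRadii p a b η := fun s t hs ht r hr =>
        hI.Ioo_subset i ⟨hs.trans_le hr.1, hr.2.trans_lt ht⟩
      -- In each zone the shell used for the weight contains the path from the midpoint to |x| and
      -- its closure stays inside the component.
      have hprim : ‖∫ r in (α i + β i) / 2..‖x‖, k r‖ₑ ^ p *
          hatWeight p a b η Ω α β x ^ (p - 1) ≤ (sphereArea d)⁻¹ ^ (p - 1) * K := by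
        rw [hatWeight_eq hI hxΩ hi]
        unfold hatWeightOn
        split_ifs with h1 h2
        · refine enorm_primitive_rpow_mul_le hp hd ha hΩ hη (hsub _ _ hi.1 (by linarith)) hk ?_
          rw [uIoc_of_ge (by linarith)]
        · rw [not_le] at h1
          refine enorm_primitive_rpow_mul_le hp hd ha hΩ hη (hsub _ _ (by linarith) (by linarith))
            hk ?_
          exact Ioc_subset_Ioc (le_min (by linarith) h1.le) (max_le (by linarith) h2)
        · rw [not_le] at h2
          refine enorm_primitive_rpow_mul_le hp hd ha hΩ hη (hsub _ _ (by linarith) hi.2) hk ?_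
          rw [uIoc_of_le (by linarith)]
      calc hatWeight p a b η Ω α β x ^ (p - 1) * ‖f x‖ₑ ^ p
          ≤ hatWeight p a b η Ω α β x ^ (p - 1) * (2 ^ (p - 1) *
              (‖y i‖ₑ ^ p + ‖∫ r in (α i + β i) / 2..‖x‖, k r‖ₑ ^ p)) := by
            gcongr
            rw [hx i hi]
            exact (ENNReal.rpow_le_rpow (enorm_add_le _ _) hp0.le).trans
              (ENNReal.rpow_add_le_mul_rpow_add_rpow _ _ hp.le)
        _ = 2 ^ (p - 1) * (hatWeight p a b η Ω α β x ^ (p - 1) * ‖y i‖ₑ ^ p +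
              ‖∫ r in (α i + β i) / 2..‖x‖, k r‖ₑ ^ p *
                hatWeight p a b η Ω α β x ^ (p - 1)) := by ring
        _ ≤ 2 ^ (p - 1) * (D ^ (p - 1) * Y + (sphereArea d)⁻¹ ^ (p - 1) * K) := by
            gcongr
            · exact hle x
            · exact Finset.single_le_sum (f := fun i => ‖y i‖ₑ ^ p) (fun _ _ => zero_le)
                (Finset.mem_univ i)
        _ ≤ 2 ^ (p - 1) * ((D ^ (p - 1) + (sphereArea d)⁻¹ ^ (p - 1)) * Y +
              (D ^ (p - 1) + (sphereArea d)⁻¹ ^ (p - 1)) * K) := by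
            gcongr
            · exact le_self_add
            · exact le_add_self
        _ = C₁ * (Y + K) := by rw [hC₁]; ring
    · rw [hatWeight_eq_zero hI hxI, ENNReal.zero_rpow_of_pos hp1, zero_mul]
      exact zero_le
  rw [lintegral_hatMeasure hp hmeas _ fun x => ne_top_of_le_ne_top hD (hle x)]
  refine (lintegral_mono_ae hpt).trans ?_
  rw [setLIntegral_const]
  exact (by ring : C₁ * (Y + K) * volume Ω = C₁ * volume Ω * (Y + K)).le

end Hardy

section Inclusions

/-! ### Relations between the classes of functions -/

variable {d : ℕ} {p a b : ℝ} {η : ℝ → ℝ} {Ω : Set (E d)} {N : ℕ} {α β : Fin N → ℝ}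

lemma locallyIntegrableOn_congr {X F : Type*} [TopologicalSpace X] [MeasurableSpace X]
    [OpensMeasurableSpace X] [T2Space X] [LocallyCompactSpace X] [NormedAddCommGroup F]
    {μ : Measure X} {U : Set X} (hU : IsOpen U) {f g : X → F} (hf : LocallyIntegrableOn f U μ)
    (h : EqOn f g U) : LocallyIntegrableOn g U μ := by
  rw [locallyIntegrableOn_iff hU.isLocallyClosed] at hf ⊢
  exact fun K hKU hK => (hf K hKU hK).congr_fun (h.mono hKU) hK.measurableSet

lemma HasWeakGradient.congr {U : Set (E d)} (hU : IsOpen U) {u u' : E d → ℝ} {G : E d → E d}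
    (h : HasWeakGradient U u G) (huu' : EqOn u u' U) : HasWeakGradient U u' G := by
  refine ⟨locallyIntegrableOn_congr hU h.1 huu', h.2, fun φ hφ hφc hφU e => ?_⟩
  rw [← h.3 φ hφ hφc hφU e]
  congr 1
  ext x
  by_cases hx : x ∈ tsupport φ
  · rw [huu' (hφU hx)]
  · have : fderiv ℝ φ x = 0 := image_eq_zero_of_notMem_tsupport
      fun hm => hx (tsupport_fderiv_subset ℝ hm)
    simp [this]

lemma locallyIntegrableOn_of_intervalIntegrable (hab : a ≤ b) {f : ℝ → ℝ} {U : Set ℝ}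
    (hf : IntervalIntegrable f volume a b) (hU : U ⊆ Ioo a b) : LocallyIntegrableOn f U :=
  (((intervalIntegrable_iff_integrableOn_Ioo_of_le hab).1 hf).mono_set hU).locallyIntegrableOn

/-- The pointwise derivative of an absolutely continuous function is its weak derivative. -/
lemma hasWeakDerivative_of_absolutelyContinuous (hab : a ≤ b) {v : ℝ → ℝ}
    (hv : AbsolutelyContinuousOnInterval v a b) {U : Set ℝ} (hU : U ⊆ Ioo a b) :
    HasWeakDerivative U v (deriv v) := by
  refine ⟨?_, locallyIntegrableOn_of_intervalIntegrable hab hv.intervalIntegrable_deriv hU,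
    fun φ hφ _ hφU => ?_⟩
  · exact locallyIntegrableOn_of_intervalIntegrable hab hv.continuousOn.intervalIntegrable hU
  · exact integral_mul_deriv_eq_neg_of_absolutelyContinuous hab hv (.of_forall fun _ _ => rfl)
      (hφ.of_le (by simp)) (hφU.trans hU)

lemma isOpen_goodSet (hΩ : Ω = {x | ‖x‖ < b} ∨ Ω = {x | a < ‖x‖ ∧ ‖x‖ < b})
    (hI : IsIntervalDecomposition (goodRadii p a b η) α β) : IsOpen (goodSet p a b η Ω) := by
  rw [goodSet_eq hΩ]
  exact (isOpen_goodRadii hI).preimage continuous_norm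

lemma HasWeakDerivative.hasWeakGradient_goodSet (hd : 1 ≤ d) (ha : 0 ≤ a)
    (hΩ : Ω = {x | ‖x‖ < b} ∨ Ω = {x | a < ‖x‖ ∧ ‖x‖ < b})
    (hI : IsIntervalDecomposition (goodRadii p a b η) α β) {v g : ℝ → ℝ}
    (h : HasWeakDerivative (goodRadii p a b η) v g) {u : E d → ℝ}
    (hu : ∀ x ∈ goodSet p a b η Ω, u x = v ‖x‖) :
    HasWeakGradient (goodSet p a b η Ω) u (fun x => (g ‖x‖ * ‖x‖⁻¹) • x) := by
  have h1 := h.hasWeakGradient hd (isOpen_goodRadii hI) (goodRadii_subset_Ioi ha)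
  rw [← goodSet_eq hΩ] at h1
  exact h1.congr (isOpen_goodSet hΩ hI) fun x hx => (hu x hx).symm

lemma measurable_domRestrict_of_continuousOn {u : E d → ℝ} (hu : ContinuousOn u Ω) :
    Measurable (Ω.domRestrict u) :=
  (continuousOn_iff_continuous_domRestrict.1 hu).measurable

lemma mem_ACRadial (hd : 1 ≤ d) (ha : 0 ≤ a) (hab : a < b)
    (hΩ : Ω = {x | ‖x‖ < b} ∨ Ω = {x | a < ‖x‖ ∧ ‖x‖ < b})
    (hI : IsIntervalDecomposition (goodRadii p a b η) α β) {u : E d → ℝ} (hu : ContinuousOn u Ω)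
    {v : ℝ → ℝ} {K : NNReal} (hv : LipschitzOnWith K v (Icc a b))
    (huv : ∀ x ∈ goodSet p a b η Ω, u x = v ‖x‖) : u ∈ ACRadial p a b η Ω := by
  have hac : AbsolutelyContinuousOnInterval v a b :=
    LipschitzOnWith.absolutelyContinuousOnInterval (by rwa [uIcc_of_le hab.le])
  exact ⟨measurable_domRestrict_of_continuousOn hu,
    ⟨_, (hasWeakDerivative_of_absolutelyContinuous hab.le hac
      goodRadii_subset).hasWeakGradient_goodSet hd ha hΩ hI huv⟩, v, hac, huv⟩

lemma exists_unit_vector (hd : 1 ≤ d) : ∃ e : E d, ‖e‖ = 1 := by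
  have := nontrivial_E hd
  exact exists_norm_eq (E d) zero_le_one

lemma norm_smul_unit {e : E d} (he : ‖e‖ = 1) {r : ℝ} (hr : 0 ≤ r) : ‖r • e‖ = r := by
  rw [norm_smul, he, mul_one, Real.norm_of_nonneg hr]

lemma smul_unit_mem_domain (ha : 0 ≤ a)
    (hΩ : Ω = {x | ‖x‖ < b} ∨ Ω = {x | a < ‖x‖ ∧ ‖x‖ < b}) {e : E d} (he : ‖e‖ = 1) {r : ℝ}
    (hr : r ∈ Ioo a b) : r • e ∈ Ω :=
  mem_domain_of_norm_mem hΩ (by rwa [norm_smul_unit he (ha.trans hr.1.le)])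

lemma norm_smul_unit_mem_domain
    (hΩ : Ω = {x | ‖x‖ < b} ∨ Ω = {x | a < ‖x‖ ∧ ‖x‖ < b}) {e : E d} (he : ‖e‖ = 1) {x : E d}
    (hx : x ∈ Ω) : ‖x‖ • e ∈ Ω := by
  rcases hΩ with rfl | rfl
  · simpa [norm_smul_unit he (norm_nonneg x)] using hx
  · simpa [norm_smul_unit he (norm_nonneg x)] using hx

lemma smul_unit_mem_closure (ha : 0 ≤ a) (hab : a < b)
    (hΩ : Ω = {x | ‖x‖ < b} ∨ Ω = {x | a < ‖x‖ ∧ ‖x‖ < b}) {e : E d} (he : ‖e‖ = 1) {r : ℝ}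
    (hr : r ∈ Icc a b) : r • e ∈ closure Ω := by
  rw [← closure_Ioo hab.ne] at hr
  exact map_mem_closure (f := fun s : ℝ => s • e) (by fun_prop) hr
    fun s hs => smul_unit_mem_domain ha hΩ he hs

lemma isCompact_closure_domain (hΩ : Ω = {x | ‖x‖ < b} ∨ Ω = {x | a < ‖x‖ ∧ ‖x‖ < b}) :
    IsCompact (closure Ω) :=
  (Metric.isBounded_ball.subset (domain_subset_ball hΩ)).isCompact_closure

lemma RadialOn.eq_profile (hΩ : Ω = {x | ‖x‖ < b} ∨ Ω = {x | a < ‖x‖ ∧ ‖x‖ < b}) {u : E d → ℝ}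
    (hu : RadialOn Ω u) {e : E d} (he : ‖e‖ = 1) {x : E d} (hx : x ∈ Ω) : u x = u (‖x‖ • e) :=
  hu x hx _ (norm_smul_unit_mem_domain hΩ he hx) (norm_smul_unit he (norm_nonneg x)).symm

lemma lipschitzOnWith_profile (ha : 0 ≤ a) (hab : a < b)
    (hΩ : Ω = {x | ‖x‖ < b} ∨ Ω = {x | a < ‖x‖ ∧ ‖x‖ < b}) {u : E d → ℝ} {K : NNReal}
    (hu : LipschitzOnWith K u (closure Ω)) {e : E d} (he : ‖e‖ = 1) :
    LipschitzOnWith K (fun r : ℝ => u (r • e)) (Icc a b) := by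
  refine LipschitzOnWith.of_dist_le_mul fun r hr s hs => ?_
  refine (hu.dist_le_mul _ (smul_unit_mem_closure ha hab hΩ he hr) _
    (smul_unit_mem_closure ha hab hΩ he hs)).trans_eq ?_
  rw [dist_eq_norm, ← sub_smul, norm_smul, he, mul_one, dist_eq_norm]

lemma LipRadial_subset_ACRadial (hd : 1 ≤ d) (ha : 0 ≤ a) (hab : a < b)
    (hΩ : Ω = {x | ‖x‖ < b} ∨ Ω = {x | a < ‖x‖ ∧ ‖x‖ < b})
    (hI : IsIntervalDecomposition (goodRadii p a b η) α β) :
    LipRadial Ω ⊆ ACRadial p a b η Ω := by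
  rintro u ⟨hrad, K, hK⟩
  obtain ⟨e, he⟩ := exists_unit_vector hd
  exact mem_ACRadial hd ha hab hΩ hI (hK.continuousOn.mono subset_closure)
    (lipschitzOnWith_profile ha hab hΩ hK he) fun x hx => hrad.eq_profile hΩ he hx.1

/-- The gradient extends continuously to the compact closure, so it is bounded and the profile along
a ray is Lipschitz on (a,b). Continuity of u up to the boundary extends this to [a,b]. -/
lemma C1Radial_subset_ACRadial (hd : 1 ≤ d) (ha : 0 ≤ a) (hab : a < b)
    (hΩ : Ω = {x | ‖x‖ < b} ∨ Ω = {x | a < ‖x‖ ∧ ‖x‖ < b})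
    (hI : IsIntervalDecomposition (goodRadii p a b η) α β) :
    C1Radial Ω ⊆ ACRadial p a b η Ω := by
  rintro u ⟨hrad, hC1, hcont, G, hG, hGe⟩
  obtain ⟨e, he⟩ := exists_unit_vector hd
  obtain ⟨C, hC⟩ := (isCompact_closure_domain hΩ).exists_bound_of_continuousOn hG
  have hopen := isOpen_domain hΩ
  have hline : ∀ r : ℝ, HasDerivAt (fun r : ℝ => r • e) e r := fun r => by
    simpa using (hasDerivAt_id r).smul_const e
  have hder : ∀ r ∈ Ioo a b, HasDerivAt (fun r : ℝ => u (r • e)) (fderiv ℝ u (r • e) e) r := by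
    intro r hr
    have hm := smul_unit_mem_domain ha hΩ he hr
    have h1 : DifferentiableAt ℝ u (r • e) :=
      (hC1.differentiableOn one_ne_zero).differentiableAt (hopen.mem_nhds hm)
    exact h1.hasFDerivAt.comp_hasDerivAt r (hline r)
  have hlip : LipschitzOnWith (Real.toNNReal C) (fun r : ℝ => u (r • e)) (Ioo a b) := by
    refine (convex_Ioo a b).lipschitzOnWith_of_nnnorm_hasDerivWithin_le
      (f' := fun r => fderiv ℝ u (r • e) e) (fun r hr => (hder r hr).hasDerivWithinAt)
      fun r hr => ?_
    have hm := smul_unit_mem_domain ha hΩ he hr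
    refine NNReal.le_toNNReal_of_coe_le ?_
    rw [coe_nnnorm]
    refine ((fderiv ℝ u (r • e)).le_opNorm e).trans ?_
    rw [he, mul_one, hGe hm]
    exact hC _ (subset_closure hm)
  have hcl : ContinuousOn (fun r : ℝ => u (r • e)) (closure (Ioo a b)) := by
    rw [closure_Ioo hab.ne]
    exact hcont.comp (by fun_prop) fun r hr => smul_unit_mem_closure ha hab hΩ he hr
  have hlip' := hlip.closure hcl
  rw [closure_Ioo hab.ne] at hlip'
  exact mem_ACRadial hd ha hab hΩ hI hC1.continuousOn hlip'
    fun x hx => hrad.eq_profile hΩ he hx.1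

lemma memLp_hatMeasure_of_continuousOn (hp : 1 < p) (hd : 1 ≤ d) (ha : 0 ≤ a)
    (hΩ : Ω = {x | ‖x‖ < b} ∨ Ω = {x | a < ‖x‖ ∧ ‖x‖ < b})
    (hη : LocallyIntegrableOn η (Ici 0)) (hI : IsIntervalDecomposition (goodRadii p a b η) α β)
    {u : E d → ℝ} (hu : ContinuousOn u (closure Ω)) :
    MemLp u (ENNReal.ofReal p) (hatMeasure p a b η Ω α β) := by
  have := isFiniteMeasure_hatMeasure hp hd ha hΩ hη hI
  have hac : hatMeasure p a b η Ω α β ≪ volume.restrict Ω := withDensity_absolutelyContinuous _ _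
  have hmeas := (isOpen_domain hΩ).measurableSet
  obtain ⟨C, hC⟩ := (isCompact_closure_domain hΩ).exists_bound_of_continuousOn hu
  refine MemLp.of_bound (((hu.mono subset_closure).aestronglyMeasurable hmeas).mono_ac hac) C ?_
  refine hac.ae_le ?_
  filter_upwards [ae_restrict_mem hmeas] with x hx using hC x (subset_closure hx)

lemma LipRadial_subset_W (hp : 1 < p) (hd : 1 ≤ d) (ha : 0 ≤ a) (hab : a < b)
    (hΩ : Ω = {x | ‖x‖ < b} ∨ Ω = {x | a < ‖x‖ ∧ ‖x‖ < b})
    (hη : LocallyIntegrableOn η (Ici 0)) (hI : IsIntervalDecomposition (goodRadii p a b η) α β) :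
    LipRadial Ω ⊆ W p a b η Ω α β := by
  rintro u ⟨hrad, K, hK⟩
  obtain ⟨e, he⟩ := exists_unit_vector hd
  have hlip := lipschitzOnWith_profile ha hab hΩ hK he
  have hac : AbsolutelyContinuousOnInterval (fun r : ℝ => u (r • e)) a b :=
    LipschitzOnWith.absolutelyContinuousOnInterval (by rwa [uIcc_of_le hab.le])
  refine ⟨⟨measurable_domRestrict_of_continuousOn (hK.continuousOn.mono subset_closure),
    fun r => u (r • e), ⟨deriv fun r => u (r • e),
      hasWeakDerivative_of_absolutelyContinuous hab.le hac goodRadii_subset, ?_⟩,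
    fun x hx => hrad.eq_profile hΩ he hx⟩,
    memLp_hatMeasure_of_continuousOn hp hd ha hΩ hη hI hK.continuousOn⟩
  have := isFiniteMeasure_radialMeasure d (b := b) ha hη
  have hU : Ioo a b ⊆ Ici 0 := fun r hr => ha.trans hr.1.le
  calc ∫⁻ r in goodRadii p a b η, ENNReal.ofReal (r ^ (d - 1)) *
          ‖deriv (fun r => u (r • e)) r‖ₑ ^ p * ENNReal.ofReal (η r)
      ≤ ∫⁻ r in Ioo a b, ENNReal.ofReal (r ^ (d - 1)) *
          ‖deriv (fun r => u (r • e)) r‖ₑ ^ p * ENNReal.ofReal (η r) :=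
        lintegral_mono_set goodRadii_subset
    _ ≤ ∫⁻ r in Ioo a b, ENNReal.ofReal (r ^ (d - 1)) * (K : ℝ≥0∞) ^ p *
          ENNReal.ofReal (η r) := by
        refine setLIntegral_mono' measurableSet_Ioo fun r hr => ?_
        have h1 := norm_deriv_le_of_lipschitzOn (Icc_mem_nhds hr.1 hr.2) hlip
        have h2 : ‖deriv (fun r => u (r • e)) r‖ₑ ≤ K := by
          rw [enorm_eq_nnnorm]; exact_mod_cast h1
        gcongr
    _ = (K : ℝ≥0∞) ^ p * radialMeasure d a b η univ := by
        rw [← lintegral_radialMeasure ha hη fun _ => (K : ℝ≥0∞) ^ p, lintegral_const]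
    _ < ⊤ := ENNReal.mul_lt_top (ENNReal.rpow_lt_top_of_nonneg (by linarith) (by simp))
        (measure_lt_top _ _)

/-! ### Radial functions with compactly supported derivative -/

lemma IsBoundedSupported.exists_pos_Iio (ha : 0 ≤ a) {h : ℝ → ℝ} (hh : IsBoundedSupported a b h) :
    ∃ c, 0 < c ∧ ∀ r < c, h r = 0 := by
  obtain ⟨s, t, has, -, -, h0⟩ := hh.supp
  exact ⟨s, ha.trans_lt has, fun r hr => h0 r fun hm => absurd hm.1 (not_le.2 hr)⟩

variable {φ : ℝ → ℝ}

lemma norm_fderiv_comp_norm_le (ha : 0 ≤ a) (hφ : ContDiff ℝ 1 φ)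
    (hφs : IsBoundedSupported a b (deriv φ)) (x : E d) :
    ‖fderiv ℝ (fun x : E d => φ ‖x‖) x‖ ≤ |deriv φ ‖x‖| := by
  obtain ⟨c, hc, h0⟩ := hφs.exists_pos_Iio ha
  rw [fderiv_comp_norm (hφ.differentiable one_ne_zero) hc h0, ← map_smul, innerSL_apply_norm]
  exact norm_radial_smul_le _ _

lemma comp_norm_mem_LipRadial (hφ : ContDiff ℝ 1 φ)
    (hφs : IsBoundedSupported a b (deriv φ)) : (fun x : E d => φ ‖x‖) ∈ LipRadial Ω := by
  obtain ⟨C, hC⟩ := hφs.bound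
  have h1 : LipschitzWith (Real.toNNReal C) φ :=
    lipschitzWith_of_nnnorm_deriv_le (hφ.differentiable one_ne_zero) fun r =>
      NNReal.le_toNNReal_of_coe_le (by simpa using hC r)
  exact ⟨fun x _ y _ hxy => by simp only [hxy], _,
    (h1.comp lipschitzWith_one_norm).lipschitzOnWith⟩

lemma comp_norm_mem_C1Radial (ha : 0 ≤ a) (hφ : ContDiff ℝ 1 φ)
    (hφs : IsBoundedSupported a b (deriv φ)) : (fun x : E d => φ ‖x‖) ∈ C1Radial Ω := by
  obtain ⟨c, hc, h0⟩ := hφs.exists_pos_Iio ha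
  have h1 : ContDiff ℝ 1 (fun x : E d => φ ‖x‖) := contDiff_comp_norm hφ hc h0
  exact ⟨fun x _ y _ hxy => by simp only [hxy], h1.contDiffOn, h1.continuous.continuousOn,
    _, (h1.continuous_fderiv one_ne_zero).continuousOn, fun _ _ => rfl⟩

lemma comp_norm_mem_SobolevRadial (hd : 1 ≤ d) (ha : 0 ≤ a) (hab : a < b)
    (hΩ : Ω = {x | ‖x‖ < b} ∨ Ω = {x | a < ‖x‖ ∧ ‖x‖ < b})
    (hI : IsIntervalDecomposition (goodRadii p a b η) α β) (hφ : ContDiff ℝ 1 φ)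
    (hφs : IsBoundedSupported a b (deriv φ)) :
    (fun x : E d => φ ‖x‖) ∈ SobolevRadial p a b η Ω := by
  obtain ⟨c, hc, h0⟩ := hφs.exists_pos_Iio ha
  obtain ⟨C, hC⟩ := hφs.bound
  have h1 : ContDiff ℝ 1 (fun x : E d => φ ‖x‖) := contDiff_comp_norm hφ hc h0
  have : IsFiniteMeasure (volume.restrict Ω) :=
    ⟨by rw [Measure.restrict_apply_univ]; exact (volume_domain_ne_top hΩ).lt_top⟩
  exact ⟨LipRadial_subset_ACRadial hd ha hab hΩ hI (comp_norm_mem_LipRadial hφ hφs),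
    .of_forall fun x => h1.differentiable one_ne_zero x,
    MemLp.of_bound (h1.continuous_fderiv one_ne_zero).aestronglyMeasurable C
      (.of_forall fun x => (norm_fderiv_comp_norm_le ha hφ hφs x).trans (hC _))⟩

/-- The set Ω may contain points with |x| ≤ a, but the derivative of φ vanishes there, so only the
shell a < |x| < b contributes. -/
lemma energy_comp_norm_le (hp : 1 < p) (hd : 1 ≤ d) (ha : 0 ≤ a)
    (hη : LocallyIntegrableOn η (Ici 0)) (hφ : ContDiff ℝ 1 φ)
    (hφs : IsBoundedSupported a b (deriv φ)) :
    energy p η Ω (fun x : E d => φ ‖x‖) ≤ sphereArea d *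
      eLpNorm (deriv φ) (ENNReal.ofReal p) (radialMeasure d a b η) ^ p := by
  obtain ⟨c, hc, h0⟩ := hφs.exists_pos_Iio ha
  have hp0 : 0 < p := by linarith
  have h1 : ContDiff ℝ 1 (fun x : E d => φ ‖x‖) := contDiff_comp_norm hφ hc h0
  have hU : Ioo a b ⊆ Ioi 0 := fun r hr => ha.trans_lt hr.1
  have hm : AEMeasurable (fun r => ‖deriv φ r‖ₑ ^ p * ENNReal.ofReal (η r))
      (volume.restrict (Ioo a b)) :=
    (hφs.measurable.enorm.pow_const p).aemeasurable.mul
      (aemeasurable_restrict_of_locallyIntegrableOn hη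
        (hU.trans Ioi_subset_Ici_self)).ennreal_ofReal
  rw [energy, if_pos (.of_forall fun x => h1.differentiable one_ne_zero x),
    eLpNorm_ofReal_rpow hp, lintegral_radialMeasure ha hη]
  have hsupp : ∀ r, r ∉ Ioo a b → deriv φ r = 0 := by
    obtain ⟨s, t, has, -, htb, hz⟩ := hφs.supp
    exact fun r hr => hz r fun hm => hr ⟨has.trans_le hm.1, hm.2.trans_lt htb⟩
  calc ∫⁻ x in Ω, ‖fderiv ℝ (fun x : E d => φ ‖x‖) x‖ₑ ^ p * weight η x
      ≤ ∫⁻ x in Ω, ‖deriv φ ‖x‖‖ₑ ^ p * ENNReal.ofReal (η ‖x‖) := by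
        refine lintegral_mono fun x => ?_
        have h2 : ‖fderiv ℝ (fun x : E d => φ ‖x‖) x‖ₑ ≤ ‖deriv φ ‖x‖‖ₑ :=
          enorm_le_iff_norm_le.2 (norm_fderiv_comp_norm_le ha hφ hφs x)
        unfold weight
        gcongr
    _ ≤ ∫⁻ x, ‖deriv φ ‖x‖‖ₑ ^ p * ENNReal.ofReal (η ‖x‖) := setLIntegral_le_lintegral _ _
    _ = ∫⁻ x in {x : E d | ‖x‖ ∈ Ioo a b}, ‖deriv φ ‖x‖‖ₑ ^ p * ENNReal.ofReal (η ‖x‖) := by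
        rw [← lintegral_indicator (measurableSet_norm_mem measurableSet_Ioo)]
        refine lintegral_congr fun x => ?_
        by_cases hx : ‖x‖ ∈ Ioo a b
        · rw [indicator_of_mem (show x ∈ {x : E d | ‖x‖ ∈ Ioo a b} from hx)]
        · rw [indicator_of_notMem (show x ∉ {x : E d | ‖x‖ ∈ Ioo a b} from hx), hsupp _ hx]
          simp [hp0]
    _ = _ := by
        rw [setLIntegral_comp_norm hd measurableSet_Ioo hU hm]
        congr 1
        refine lintegral_congr fun r => ?_
        ring

/-- The energy of a function in `AC_r^d(Ω)` controls that of its radial profile. -/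
lemma lintegral_deriv_profile_le_energy (hd : 1 ≤ d) (ha : 0 ≤ a)
    (hΩ : Ω = {x | ‖x‖ < b} ∨ Ω = {x | a < ‖x‖ ∧ ‖x‖ < b})
    (hη : LocallyIntegrableOn η (Ici 0)) (hI : IsIntervalDecomposition (goodRadii p a b η) α β)
    (hp : 1 < p) {u : E d → ℝ} {v : ℝ → ℝ}
    (huv : ∀ x ∈ goodSet p a b η Ω, u x = v ‖x‖) :
    sphereArea d * ∫⁻ r in goodRadii p a b η,
      ENNReal.ofReal (r ^ (d - 1)) * ‖deriv v r‖ₑ ^ p * ENNReal.ofReal (η r)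
        ≤ energy p η Ω u := by
  have hp0 : 0 < p := by linarith
  unfold energy
  split_ifs with hdiff
  swap
  · exact le_top
  have hIm : MeasurableSet (goodRadii p a b η) := (isOpen_goodRadii hI).measurableSet
  have hU := goodRadii_subset_Ioi (p := p) (b := b) (η := η) ha
  have hm : AEMeasurable (fun r => ‖deriv v r‖ₑ ^ p * ENNReal.ofReal (η r))
      (volume.restrict (goodRadii p a b η)) :=
    ((measurable_deriv v).enorm.pow_const p).aemeasurable.mul
      (aemeasurable_restrict_of_locallyIntegrableOn hη
        (hU.trans Ioi_subset_Ici_self)).ennreal_ofReal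
  have h1 := setLIntegral_comp_norm hd hIm hU hm
  have h2 : ∫⁻ r in goodRadii p a b η,
      ENNReal.ofReal (r ^ (d - 1)) * ‖deriv v r‖ₑ ^ p * ENNReal.ofReal (η r)
      = ∫⁻ r in goodRadii p a b η,
        ENNReal.ofReal (r ^ (d - 1)) * (‖deriv v r‖ₑ ^ p * ENNReal.ofReal (η r)) :=
    lintegral_congr fun r => by ring
  have hgood := isOpen_goodSet (d := d) hΩ hI
  have hgΩ : goodSet p a b η Ω ⊆ Ω := fun x hx => hx.1
  rw [h2, ← h1, ← goodSet_eq hΩ]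
  refine (setLIntegral_mono_ae' hgood.measurableSet ?_).trans (lintegral_mono_set hgΩ)
  have hdiff' := (ae_restrict_iff' (isOpen_domain hΩ).measurableSet).1 hdiff
  filter_upwards [hdiff'] with x hx hxg
  have hxpos : 0 < ‖x‖ := hU hxg.2
  have hle : ‖deriv v ‖x‖‖ ≤ ‖fderiv ℝ u x‖ := by
    -- The profile agrees near |x| with the restriction of u to the ray through x, since the good
    -- radii form an open set. It is thus differentiable wherever u is, with derivative the
    -- component of the gradient along a unit vector.
    set e : E d := ‖x‖⁻¹ • x with he
    have he1 : ‖e‖ = 1 := by rw [he, norm_smul, norm_inv, norm_norm, inv_mul_cancel₀ hxpos.ne']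
    have hxe : ‖x‖ • e = x := by rw [he, smul_smul, mul_inv_cancel₀ hxpos.ne', one_smul]
    have hline : HasDerivAt (fun r : ℝ => r • e) e ‖x‖ := by
      simpa using (hasDerivAt_id ‖x‖).smul_const e
    have h3 : HasDerivAt (fun r : ℝ => u (r • e)) (fderiv ℝ u x e) ‖x‖ := by
      have h4 : HasFDerivAt u (fderiv ℝ u x) (‖x‖ • e) := by
        rw [hxe]; exact (hx hxg.1).hasFDerivAt
      exact h4.comp_hasDerivAt _ hline
    have h5 : v =ᶠ[𝓝 ‖x‖] fun r : ℝ => u (r • e) := by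
      filter_upwards [(isOpen_goodRadii hI).mem_nhds hxg.2] with r hr
      have hr0 : 0 ≤ r := (hU hr).le
      rw [huv (r • e), norm_smul_unit he1 hr0]
      rw [goodSet_eq hΩ]
      show ‖r • e‖ ∈ goodRadii p a b η
      rwa [norm_smul_unit he1 hr0]
    rw [h5.deriv_eq, h3.deriv]
    refine ((fderiv ℝ u x).le_opNorm e).trans ?_
    rw [he1, mul_one]
  have hle' : ‖deriv v ‖x‖‖ₑ ≤ ‖fderiv ℝ u x‖ₑ := enorm_le_iff_norm_le.2 hle
  unfold weight
  gcongr

end Inclusions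

section Main

/-! ### Density of regular functions and the relaxations -/

variable {d : ℕ} {p a b : ℝ} {η : ℝ → ℝ} {Ω : Set (E d)} {N : ℕ} {α β : Fin N → ℝ}

lemma setLIntegral_goodRadii_le_eLpNorm (hp : 1 < p) (ha : 0 ≤ a)
    (hη : LocallyIntegrableOn η (Ici 0)) (hI : IsIntervalDecomposition (goodRadii p a b η) α β)
    (k h : ℝ → ℝ) (hkh : EqOn k h (goodRadii p a b η)) :
    ∫⁻ r in goodRadii p a b η, ENNReal.ofReal (r ^ (d - 1)) * ‖k r‖ₑ ^ p * ENNReal.ofReal (η r)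
      ≤ eLpNorm h (ENNReal.ofReal p) (radialMeasure d a b η) ^ p := by
  rw [eLpNorm_ofReal_rpow hp, lintegral_radialMeasure ha hη]
  calc ∫⁻ r in goodRadii p a b η,
        ENNReal.ofReal (r ^ (d - 1)) * ‖k r‖ₑ ^ p * ENNReal.ofReal (η r)
      = ∫⁻ r in goodRadii p a b η,
        ENNReal.ofReal (r ^ (d - 1)) * ‖h r‖ₑ ^ p * ENNReal.ofReal (η r) :=
        setLIntegral_congr_fun (isOpen_goodRadii hI).measurableSet fun r hr => by
          simp only [hkh hr]
    _ ≤ _ := lintegral_mono_set goodRadii_subset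

lemma eLpNorm_indicator_goodRadii (hp : 1 < p) (ha : 0 ≤ a)
    (hη : LocallyIntegrableOn η (Ici 0)) (hI : IsIntervalDecomposition (goodRadii p a b η) α β)
    (g : ℝ → ℝ) :
    eLpNorm ((goodRadii p a b η).indicator g) (ENNReal.ofReal p) (radialMeasure d a b η) ^ p
      = ∫⁻ r in goodRadii p a b η,
        ENNReal.ofReal (r ^ (d - 1)) * ‖g r‖ₑ ^ p * ENNReal.ofReal (η r) := by
  have hp0 : 0 < p := by linarith
  have hm := (isOpen_goodRadii hI).measurableSet
  have hr : volume.restrict (goodRadii p a b η)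
      = (volume.restrict (Ioo a b)).restrict (goodRadii p a b η) := by
    rw [Measure.restrict_restrict hm, inter_eq_left.2 goodRadii_subset]
  rw [eLpNorm_ofReal_rpow hp, lintegral_radialMeasure ha hη, hr, ← lintegral_indicator hm]
  refine lintegral_congr fun r => ?_
  by_cases hr : r ∈ goodRadii p a b η
  · simp [hr]
  · simp [hr, hp0]

lemma memLp_indicator_goodRadii (hp : 1 < p) (ha : 0 ≤ a)
    (hη : LocallyIntegrableOn η (Ici 0)) (hI : IsIntervalDecomposition (goodRadii p a b η) α β)
    {g : ℝ → ℝ} (hg : LocallyIntegrableOn g (goodRadii p a b η))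
    (hfin : ∫⁻ r in goodRadii p a b η,
      ENNReal.ofReal (r ^ (d - 1)) * ‖g r‖ₑ ^ p * ENNReal.ofReal (η r) < ⊤) :
    MemLp ((goodRadii p a b η).indicator g) (ENNReal.ofReal p) (radialMeasure d a b η) := by
  have hp0 : 0 < p := by linarith
  have hac : radialMeasure d a b η ≪ volume :=
    (withDensity_absolutelyContinuous _ _).trans Measure.restrict_le_self.absolutelyContinuous
  refine ⟨((aestronglyMeasurable_indicator_iff (isOpen_goodRadii hI).measurableSet).2
    hg.aestronglyMeasurable).mono_ac hac, ?_⟩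
  rw [← eLpNorm_indicator_goodRadii hp ha hη hI] at hfin
  by_contra hn
  rw [not_lt, top_le_iff] at hn
  rw [hn, ENNReal.top_rpow_of_pos hp0] at hfin
  exact lt_irrefl _ hfin

/-- Radial functions with profile of finite weighted energy on `I_p` are approximated by radial
functions of class `C^1`, with convergence of the derivatives also outside `I_p`. -/
lemma exists_radial_approx (hp : 1 < p) (hd : 1 ≤ d) (ha : 0 ≤ a) (hab : a < b)
    (hΩ : Ω = {x | ‖x‖ < b} ∨ Ω = {x | a < ‖x‖ ∧ ‖x‖ < b})
    (hη : LocallyIntegrableOn η (Ici 0)) (hI : IsIntervalDecomposition (goodRadii p a b η) α β)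
    {f : E d → ℝ} {g : ℝ → ℝ} {y : Fin N → ℝ} (hg : LocallyIntegrableOn g (goodRadii p a b η))
    (hf : ∀ i, ∀ᵐ x : E d, ‖x‖ ∈ Ioo (α i) (β i) →
      f x = y i + ∫ r in (α i + β i) / 2..‖x‖, g r)
    (hfin : ∫⁻ r in goodRadii p a b η,
      ENNReal.ofReal (r ^ (d - 1)) * ‖g r‖ₑ ^ p * ENNReal.ofReal (η r) < ⊤)
    {ε : ℝ≥0∞} (hε : ε ≠ 0) :
    ∃ φ : ℝ → ℝ, ContDiff ℝ 1 φ ∧ IsBoundedSupported a b (deriv φ) ∧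
      eLpNorm ((goodRadii p a b η).indicator g - deriv φ) (ENNReal.ofReal p)
        (radialMeasure d a b η) ≤ ε ∧
      eLpNorm (fun x => f x - φ ‖x‖) (ENNReal.ofReal p) (hatMeasure p a b η Ω α β) ≤ ε := by
  have hp0 : 0 < p := by linarith
  obtain ⟨C, hC, hCle⟩ := lintegral_hatMeasure_le hp hd ha hΩ hη hI
  have hC1 : (C * (N + 1) + 1) ≠ ⊤ := by
    refine ENNReal.add_ne_top.2 ⟨ENNReal.mul_ne_top hC ?_, ENNReal.one_ne_top⟩
    exact ENNReal.add_ne_top.2 ⟨by simp, ENNReal.one_ne_top⟩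
  -- Chosen so that C (N+1) δ^p ≤ ε^p: the Hardy estimate has N midpoint terms and one derivative
  -- term, each at most δ^p.
  set δ : ℝ≥0∞ := min ε (ε / (C * (N + 1) + 1) ^ (1 / p)) with hδ
  have hCp : (C * (N + 1) + 1) ^ (1 / p) ≠ ⊤ := ENNReal.rpow_ne_top_of_nonneg (by positivity) hC1
  have hδ0 : δ ≠ 0 := by
    rw [hδ, Ne, min_eq_iff]
    rintro (⟨h, -⟩ | ⟨h, -⟩)
    · exact hε h
    · exact ENNReal.div_ne_zero.2 ⟨hε, hCp⟩ h
  obtain ⟨φ, hφ, hφs, hφδ, hφy⟩ := exists_contDiff_approx hp ha hab hη hI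
    (memLp_indicator_goodRadii (d := d) hp ha hη hI hg hfin) y hδ0
  refine ⟨φ, hφ, hφs, hφδ.trans (min_le_left _ _), ?_⟩
  have hφc : Continuous (deriv φ) := hφ.continuous_deriv le_rfl
  have hk : LocallyIntegrableOn (fun r => g r - deriv φ r) (goodRadii p a b η) :=
    hg.sub (hφc.locallyIntegrable.locallyIntegrableOn _)
  have hsub : ∀ i, ∀ r ∈ Ioo (α i) (β i), uIcc ((α i + β i) / 2) r ⊆ goodRadii p a b η :=
    fun i r hr => (ordConnected_Ioo.uIcc_subset (hI.mid_mem i) hr).trans (hI.Ioo_subset i)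
  -- On each component the difference is its midpoint value plus the primitive of g - φ' from the
  -- midpoint.
  have h1 := hCle (fun x => f x - φ ‖x‖) (fun r => g r - deriv φ r)
    (fun i => y i - φ ((α i + β i) / 2)) hk fun i => by
      filter_upwards [hf i] with x hx hxi
      rw [hx hxi, intervalIntegral.integral_sub
        (intervalIntegrable_of_locallyIntegrableOn hg (hsub i _ hxi))
        (hφc.intervalIntegrable _ _),
        intervalIntegral.integral_deriv_eq_sub
          (fun r _ => hφ.differentiable one_ne_zero r) (hφc.intervalIntegrable _ _)]
      ring
  have h2 := setLIntegral_goodRadii_le_eLpNorm (d := d) hp ha hη hI (fun r => g r - deriv φ r)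
    ((goodRadii p a b η).indicator g - deriv φ) fun r hr => by simp [hr]
  rw [← ENNReal.rpow_le_rpow_iff hp0, eLpNorm_ofReal_rpow hp]
  calc ∫⁻ x, ‖f x - φ ‖x‖‖ₑ ^ p ∂hatMeasure p a b η Ω α β
      ≤ C * (∑ i, ‖y i - φ ((α i + β i) / 2)‖ₑ ^ p + _) := h1
    _ ≤ C * (∑ i : Fin N, δ ^ p + δ ^ p) := by
        gcongr with i
        · exact hφy i
        · exact h2.trans (ENNReal.rpow_le_rpow hφδ hp0.le)
    _ = C * (N + 1) * δ ^ p := by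
        rw [Finset.sum_const, Finset.card_univ, Fintype.card_fin, nsmul_eq_mul]; ring
    _ ≤ (C * (N + 1) + 1) * (ε / (C * (N + 1) + 1) ^ (1 / p)) ^ p := by
        gcongr
        · exact le_self_add
        · exact min_le_right _ _
    _ = (C * (N + 1) + 1) * (ε ^ p / (C * (N + 1) + 1)) := by
        rw [ENNReal.div_rpow_of_nonneg _ _ hp0.le, ← ENNReal.rpow_mul, one_div_mul_cancel hp0.ne',
          ENNReal.rpow_one]
    _ ≤ ε ^ p := ENNReal.mul_div_le

lemma normW_comp_norm_sub_le (hp : 1 < p) (hd : 1 ≤ d) (ha : 0 ≤ a) (hab : a < b)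
    (hΩ : Ω = {x | ‖x‖ < b} ∨ Ω = {x | a < ‖x‖ ∧ ‖x‖ < b})
    (hη : LocallyIntegrableOn η (Ici 0)) (hI : IsIntervalDecomposition (goodRadii p a b η) α β)
    {u : E d → ℝ} {v g φ : ℝ → ℝ} (hv : HasWeakDerivative (goodRadii p a b η) v g)
    (huv : ∀ x ∈ Ω, u x = v ‖x‖) (hφ : ContDiff ℝ 1 φ) {ε : ℝ≥0∞}
    (h1 : eLpNorm ((goodRadii p a b η).indicator g - deriv φ) (ENNReal.ofReal p)
      (radialMeasure d a b η) ≤ ε)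
    (h2 : eLpNorm (fun x => u x - φ ‖x‖) (ENNReal.ofReal p) (hatMeasure p a b η Ω α β) ≤ ε) :
    normW p a b η Ω α β (fun x => u x - φ ‖x‖) ≤ (1 + sphereArea d) ^ (1 / p) * ε := by
  have hp0 : 0 < p := by linarith
  have hac : AbsolutelyContinuousOnInterval φ a b := hφ.contDiffOn.absolutelyContinuousOnInterval
  have hweak := (hv.sub (hasWeakDerivative_of_absolutelyContinuous hab.le hac
    (goodRadii_subset (p := p) (η := η))))
  have hgrad := hweak.hasWeakGradient_goodSet hd ha hΩ hI (u := fun x : E d => u x - φ ‖x‖)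
    fun x hx => by rw [huv x hx.1]
  -- The explicit radial weak gradient bounds the infimum defining the norm.
  refine (iInf₂_le _ hgrad).trans ?_
  have hgood := (isOpen_goodSet (d := d) hΩ hI).measurableSet
  obtain ⟨D, hD, hDle⟩ := hatWeight_bounded hp hd ha hΩ hη hI
  have e1 : ∫⁻ x in goodSet p a b η Ω, ‖u x - φ ‖x‖‖ₑ ^ p * hatWeight p a b η Ω α β x ^ (p - 1)
      ≤ ε ^ p := by
    calc ∫⁻ x in goodSet p a b η Ω, ‖u x - φ ‖x‖‖ₑ ^ p * hatWeight p a b η Ω α β x ^ (p - 1)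
        ≤ ∫⁻ x in Ω, ‖u x - φ ‖x‖‖ₑ ^ p * hatWeight p a b η Ω α β x ^ (p - 1) :=
          lintegral_mono_set fun x hx => hx.1
      _ = ∫⁻ x, ‖u x - φ ‖x‖‖ₑ ^ p ∂hatMeasure p a b η Ω α β := by
          rw [lintegral_hatMeasure hp (isOpen_domain hΩ).measurableSet _
            fun x => ne_top_of_le_ne_top hD (hDle x)]
          exact lintegral_congr fun x => mul_comm _ _
      _ ≤ ε ^ p := by
          rw [← eLpNorm_ofReal_rpow hp]
          gcongr
  have e2 : ∫⁻ x in goodSet p a b η Ω,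
      ‖((g ‖x‖ - deriv φ ‖x‖) * ‖x‖⁻¹) • x‖ₑ ^ p * weight η x ≤ sphereArea d * ε ^ p := by
    have hm : AEMeasurable (fun r => ‖g r - deriv φ r‖ₑ ^ p * ENNReal.ofReal (η r))
        (volume.restrict (goodRadii p a b η)) :=
      (hweak.2.aestronglyMeasurable.aemeasurable.enorm.pow_const p).mul
        (aemeasurable_restrict_of_locallyIntegrableOn hη
          ((goodRadii_subset_Ioi ha).trans Ioi_subset_Ici_self)).ennreal_ofReal
    calc ∫⁻ x in goodSet p a b η Ω, ‖((g ‖x‖ - deriv φ ‖x‖) * ‖x‖⁻¹) • x‖ₑ ^ p * weight η x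
        ≤ ∫⁻ x in goodSet p a b η Ω, ‖g ‖x‖ - deriv φ ‖x‖‖ₑ ^ p * ENNReal.ofReal (η ‖x‖) := by
          refine lintegral_mono fun x => ?_
          have : ‖((g ‖x‖ - deriv φ ‖x‖) * ‖x‖⁻¹) • x‖ₑ ≤ ‖g ‖x‖ - deriv φ ‖x‖‖ₑ :=
            enorm_le_iff_norm_le.2 (norm_radial_smul_le _ _)
          unfold weight
          gcongr
      _ = sphereArea d * ∫⁻ r in goodRadii p a b η,
            ENNReal.ofReal (r ^ (d - 1)) * (‖g r - deriv φ r‖ₑ ^ p * ENNReal.ofReal (η r)) := by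
          rw [goodSet_eq hΩ, setLIntegral_comp_norm hd (isOpen_goodRadii hI).measurableSet
            (goodRadii_subset_Ioi ha) hm]
      _ ≤ sphereArea d * ε ^ p := by
          gcongr
          simp_rw [← mul_assoc]
          exact (setLIntegral_goodRadii_le_eLpNorm (d := d) hp ha hη hI
            (fun r => g r - deriv φ r) ((goodRadii p a b η).indicator g - deriv φ)
            fun r hr => by simp [hr]).trans (ENNReal.rpow_le_rpow h1 hp0.le)
  calc _ ≤ (ε ^ p + sphereArea d * ε ^ p) ^ (1 / p) :=
        ENNReal.rpow_le_rpow (add_le_add e1 e2) (by positivity)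
    _ = ((1 + sphereArea d) * ε ^ p) ^ (1 / p) := by ring_nf
    _ = (1 + sphereArea d) ^ (1 / p) * ε := by
        rw [ENNReal.mul_rpow_of_nonneg _ _ (by positivity), ← ENNReal.rpow_mul,
          mul_one_div_cancel hp0.ne', ENNReal.rpow_one]

/-- Only density needs proof. On each component, which is an interval, the profile is almost
everywhere a constant plus the primitive of its weak derivative, which is the form required by
`exists_radial_approx`. -/
lemma closureInW_LipRadial (hp : 1 < p) (hd : 1 ≤ d) (ha : 0 ≤ a) (hab : a < b)
    (hΩ : Ω = {x | ‖x‖ < b} ∨ Ω = {x | a < ‖x‖ ∧ ‖x‖ < b})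
    (hη : LocallyIntegrableOn η (Ici 0)) (hI : IsIntervalDecomposition (goodRadii p a b η) α β) :
    closureInW p a b η Ω α β (LipRadial Ω) = W p a b η Ω α β := by
  refine Subset.antisymm (fun u hu => hu.1) fun u hu => ⟨hu, fun ε hε => ?_⟩
  obtain ⟨⟨-, v, ⟨g, hvg, hfin⟩, huv⟩, -⟩ := hu
  have hp0 : 0 < p := by linarith
  have hprim : ∀ i, ∃ c, ∀ᵐ r, r ∈ Ioo (α i) (β i) →
      v r = c + ∫ x in (α i + β i) / 2..r, g x := fun i =>
    (hvg.mono (hI.Ioo_subset i)).exists_ae_eq_primitive isOpen_Ioo ordConnected_Ioo (hI.mid_mem i)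
  choose y hy using hprim
  have hf : ∀ i, ∀ᵐ x : E d, ‖x‖ ∈ Ioo (α i) (β i) →
      u x = y i + ∫ r in (α i + β i) / 2..‖x‖, g r := by
    intro i
    filter_upwards [(quasiMeasurePreserving_norm hd).ae (ae_restrict_of_ae (hy i))] with x hx hxi
    rw [huv x (mem_domain_of_norm_mem hΩ (goodRadii_subset (hI.Ioo_subset i hxi))), hx hxi]
  set M : ℝ≥0∞ := (1 + sphereArea d) ^ (1 / p) with hM
  have hMt : M ≠ ⊤ := ENNReal.rpow_ne_top_of_nonneg (by positivity)
    (ENNReal.add_ne_top.2 ⟨ENNReal.one_ne_top, sphereArea_ne_top d⟩)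
  -- Replacing ε by its minimum with 1 keeps the final inequality strict when ε is infinite.
  have hε1 : min ε 1 ≠ 0 := (lt_min hε one_pos).ne'
  have hε1t : min ε 1 ≠ ⊤ := ne_top_of_le_ne_top ENNReal.one_ne_top (min_le_right _ _)
  have hδ : min ε 1 / 2 / M ≠ 0 := ENNReal.div_ne_zero.2 ⟨by simpa using hε1, hMt⟩
  obtain ⟨φ, hφ, hφs, h1, h2⟩ := exists_radial_approx hp hd ha hab hΩ hη hI hvg.2 hf hfin hδ
  refine ⟨fun x => φ ‖x‖, comp_norm_mem_LipRadial hφ hφs, ?_⟩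
  refine (normW_comp_norm_sub_le hp hd ha hab hΩ hη hI hvg huv hφ h1 h2).trans_lt ?_
  calc M * (min ε 1 / 2 / M) ≤ min ε 1 / 2 := ENNReal.mul_div_le
    _ < min ε 1 := ENNReal.half_lt_self hε1 hε1t
    _ ≤ ε := min_le_left _ _

lemma functional_mono {μ : Measure (E d)} {C C' : Set (E d → ℝ)} (h : C ⊆ C')
    (f : Lp ℝ (ENNReal.ofReal p) μ) : functional p η Ω μ C' f ≤ functional p η Ω μ C f :=
  biInf_mono fun _ hu => ⟨h hu.1, hu.2⟩

/-- A lower semicontinuous functional below the energy on regular radial functions is below the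
energy on `AC_r^d(Ω)`. -/
lemma le_functional_ACRadial [Fact (1 < p)] (hd : 1 ≤ d) (ha : 0 ≤ a) (hab : a < b)
    (hΩ : Ω = {x | ‖x‖ < b} ∨ Ω = {x | a < ‖x‖ ∧ ‖x‖ < b})
    (hη : LocallyIntegrableOn η (Ici 0)) (hI : IsIntervalDecomposition (goodRadii p a b η) α β)
    {C : Set (E d → ℝ)} (hC : ∀ φ : ℝ → ℝ, ContDiff ℝ 1 φ → IsBoundedSupported a b (deriv φ) →
      (fun x : E d => φ ‖x‖) ∈ C)
    {G : Lp ℝ (ENNReal.ofReal p) (hatMeasure p a b η Ω α β) → ℝ≥0∞} (hG : LowerSemicontinuous G)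
    (hGC : ∀ f, G f ≤ functional p η Ω (hatMeasure p a b η Ω α β) C f)
    (f : Lp ℝ (ENNReal.ofReal p) (hatMeasure p a b η Ω α β)) :
    G f ≤ functional p η Ω (hatMeasure p a b η Ω α β) (ACRadial p a b η Ω) f := by
  have hp : 1 < p := Fact.out
  have hp0 : 0 < p := by linarith
  refine le_iInf₂ fun u hu => ?_
  obtain ⟨⟨-, -, v, hv, huv⟩, hfu⟩ := hu
  by_contra hlt
  rw [not_le] at hlt
  obtain ⟨c, hc1, hc2⟩ := exists_between hlt
  have hen := lintegral_deriv_profile_le_energy hd ha hΩ hη hI hp huv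
  have hIab := goodRadii_subset (p := p) (a := a) (b := b) (η := η)
  have hfin : ∫⁻ r in goodRadii p a b η,
      ENNReal.ofReal (r ^ (d - 1)) * ‖deriv v r‖ₑ ^ p * ENNReal.ofReal (η r) < ⊤ := by
    refine ENNReal.lt_top_of_mul_ne_top_right (ne_top_of_lt (hen.trans_lt hc1))
      (sphereArea_ne_zero hd)
  have hg : LocallyIntegrableOn (deriv v) (goodRadii p a b η) :=
    (hasWeakDerivative_of_absolutelyContinuous hab.le hv hIab).2
  have hfv : ∀ i, ∀ᵐ x : E d, ‖x‖ ∈ Ioo (α i) (β i) →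
      u x = v ((α i + β i) / 2) + ∫ r in (α i + β i) / 2..‖x‖, deriv v r := by
    intro i
    refine .of_forall fun x hx => ?_
    have hxI := hI.Ioo_subset i hx
    have hac : AbsolutelyContinuousOnInterval v ((α i + β i) / 2) ‖x‖ := by
      refine hv.mono ?_
      rw [uIcc_of_le hab.le]
      exact ordConnected_Icc.uIcc_subset
        (Ioo_subset_Icc_self (hIab (hI.Ioo_subset i (hI.mid_mem i))))
        (Ioo_subset_Icc_self (hIab hxI))
    rw [hac.integral_deriv_eq_sub, huv x ⟨mem_domain_of_norm_mem hΩ (hIab hxI), hxI⟩]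
    ring
  -- The derivative is replaced by 0 outside I_p, so that the approximants have asymptotically no
  -- energy there. The energy of u dominates what remains.
  set g : ℝ → ℝ := (goodRadii p a b η).indicator (deriv v) with hgdef
  set A : ℝ≥0∞ := eLpNorm g (ENNReal.ofReal p) (radialMeasure d a b η) with hA
  have hgL : MemLp g (ENNReal.ofReal p) (radialMeasure d a b η) :=
    memLp_indicator_goodRadii hp ha hη hI hg hfin
  have hAc : sphereArea d * A ^ p < c := by
    rw [hA, hgdef, eLpNorm_indicator_goodRadii hp ha hη hI]
    exact hen.trans_lt hc1
  -- A positive δ is sought for which an approximant within δ has energy at most c, yet lies in a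
  -- ball around f on which G > c.
  have hlim : Tendsto (fun δ : ℝ≥0∞ => sphereArea d * (A + δ) ^ p) (𝓝 0)
      (𝓝 (sphereArea d * (A + 0) ^ p)) :=
    ENNReal.Tendsto.const_mul ((ENNReal.continuous_rpow_const.tendsto _).comp
      (tendsto_const_nhds.add tendsto_id)) (Or.inr (sphereArea_ne_top d))
  rw [add_zero] at hlim
  have hev1 : ∀ᶠ δ : ℝ≥0∞ in 𝓝 0, sphereArea d * (A + δ) ^ p < c :=
    hlim.eventually (gt_mem_nhds hAc)
  obtain ⟨ρ, hρ, hball⟩ := EMetric.mem_nhds_iff.1 (hG f c hc2)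
  have hev2 : ∀ᶠ δ : ℝ≥0∞ in 𝓝 0, δ < ρ := gt_mem_nhds hρ
  obtain ⟨δ, ⟨hδ1, hδ2⟩, hδ0⟩ := (((hev1.and hev2).filter_mono nhdsWithin_le_nhds).and
    (self_mem_nhdsWithin : Ioi (0 : ℝ≥0∞) ∈ 𝓝[>] 0)).exists
  obtain ⟨φ, hφ, hφs, h1, h2⟩ := exists_radial_approx hp hd ha hab hΩ hη hI hg hfv hfin
    (ne_of_gt hδ0)
  have hl : MemLp (fun x : E d => φ ‖x‖) (ENNReal.ofReal p) (hatMeasure p a b η Ω α β) :=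
    memLp_hatMeasure_of_continuousOn hp hd ha hΩ hη hI
      (hφ.continuous.comp continuous_norm).continuousOn
  have hdist : edist (hl.toLp _) f < ρ := by
    rw [edist_comm, Lp.edist_def]
    refine lt_of_eq_of_lt (eLpNorm_congr_ae ?_) (h2.trans_lt hδ2)
    filter_upwards [hfu, hl.coeFn_toLp] with x hx hx'
    simp only [Pi.sub_apply, hx, hx']
  have hcG : c < G (hl.toLp _) := hball hdist
  have hGle : G (hl.toLp _) ≤ energy p η Ω (fun x : E d => φ ‖x‖) :=
    (hGC _).trans (iInf₂_le (fun x : E d => φ ‖x‖) ⟨hC φ hφ hφs, hl.coeFn_toLp⟩)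
  have hφA : eLpNorm (deriv φ) (ENNReal.ofReal p) (radialMeasure d a b η) ≤ A + δ := by
    have e : deriv φ = g - (g - deriv φ) := by ring
    rw [e]
    exact (eLpNorm_sub_le hgL.1 (hgL.1.sub hφs.measurable.aestronglyMeasurable)
      (by simpa using hp.le)).trans (by gcongr)
  refine lt_irrefl c (hcG.trans_le (hGle.trans ?_))
  refine (energy_comp_norm_le hp hd ha hη hφ hφs).trans (le_trans ?_ hδ1.le)
  gcongr

/-- Both envelopes are suprema over the same set of lower semicontinuous minorants: one inclusion is
`le_functional_ACRadial`, the other is the monotonicity of the functional in the class. -/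
lemma relaxation_eq_relaxation_ACRadial [Fact (1 < p)] (hd : 1 ≤ d) (ha : 0 ≤ a) (hab : a < b)
    (hΩ : Ω = {x | ‖x‖ < b} ∨ Ω = {x | a < ‖x‖ ∧ ‖x‖ < b})
    (hη : LocallyIntegrableOn η (Ici 0)) (hI : IsIntervalDecomposition (goodRadii p a b η) α β)
    {C : Set (E d → ℝ)} (hC : ∀ φ : ℝ → ℝ, ContDiff ℝ 1 φ → IsBoundedSupported a b (deriv φ) →
      (fun x : E d => φ ‖x‖) ∈ C) (hCA : C ⊆ ACRadial p a b η Ω)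
    (f : Lp ℝ (ENNReal.ofReal p) (hatMeasure p a b η Ω α β)) :
    relaxation p η Ω (hatMeasure p a b η Ω α β) C f
      = relaxation p η Ω (hatMeasure p a b η Ω α β) (ACRadial p a b η Ω) f := by
  refine le_antisymm (biSup_mono fun G hG => ⟨hG.1, ?_⟩) (biSup_mono fun G hG => ⟨hG.1, ?_⟩)
  · exact le_functional_ACRadial hd ha hab hΩ hη hI hC hG.1 hG.2
  · exact fun y => (hG.2 y).trans (functional_mono hCA y)

end Main

end RadialRelaxation

/-! ### The theorem -/

open RadialRelaxation
theorem corollary4p2 (d : ℕ) (hd : 1 ≤ d) (p : ℝ) [Fact (1 < p)] (a b : ℝ) (ha : 0 ≤ a)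
    (hab : a < b) (Ω : Set (E d))
    (hΩ : Ω = {x | ‖x‖ < b} ∨ Ω = {x | a < ‖x‖ ∧ ‖x‖ < b})
    (η : ℝ → ℝ) (hη_nonneg : ∀ᵐ r ∂volume.restrict (Ici (0 : ℝ)), 0 ≤ η r)
    (hη_int : LocallyIntegrableOn η (Ici 0))
    (hη_supp : ∀ᵐ r ∂volume.restrict (Ici (0 : ℝ)), r ∉ Ioo a b → η r = 0)
    (N : ℕ) (hN : 1 ≤ N) (α β : Fin N → ℝ)
    (hI : IsIntervalDecomposition (goodRadii p a b η) α β) :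
    (∀ f : Lp ℝ (ENNReal.ofReal p) (hatMeasure p a b η Ω α β),
      relaxation p η Ω (hatMeasure p a b η Ω α β) (C1Radial Ω) f =
          relaxation p η Ω (hatMeasure p a b η Ω α β) (ACRadial p a b η Ω) f ∧
      relaxation p η Ω (hatMeasure p a b η Ω α β) (LipRadial Ω) f =
          relaxation p η Ω (hatMeasure p a b η Ω α β) (ACRadial p a b η Ω) f ∧
      relaxation p η Ω (hatMeasure p a b η Ω α β) (SobolevRadial p a b η Ω) f =
          relaxation p η Ω (hatMeasure p a b η Ω α β) (ACRadial p a b η Ω) f) ∧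
    LipRadial Ω ⊆ W p a b η Ω α β ∧
    closureInW p a b η Ω α β (LipRadial Ω) = W p a b η Ω α β := by
  have hp : 1 < p := Fact.out
  refine ⟨fun f => ⟨?_, ?_, ?_⟩, LipRadial_subset_W hp hd ha hab hΩ hη_int hI,
    closureInW_LipRadial hp hd ha hab hΩ hη_int hI⟩
  · exact relaxation_eq_relaxation_ACRadial hd ha hab hΩ hη_int hI
      (fun φ hφ hφs => comp_norm_mem_C1Radial ha hφ hφs)
      (C1Radial_subset_ACRadial hd ha hab hΩ hI) f
  · exact relaxation_eq_relaxation_ACRadial hd ha hab hΩ hη_int hI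
      (fun φ hφ hφs => comp_norm_mem_LipRadial hφ hφs)
      (LipRadial_subset_ACRadial hd ha hab hΩ hI) f
  · exact relaxation_eq_relaxation_ACRadial hd ha hab hΩ hη_int hI
      (fun φ hφ hφs => comp_norm_mem_SobolevRadial hd ha hab hΩ hI hφ hφs)
      (fun u hu => hu.1) f
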